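/- **Setting.** An instance $\mathcal I=(L,C,k,d,z,m)$ of the outlier $k$-supplier problem consists of a metric space $(\mathcal X,d)$, finite sets $C\subseteq\mathcal X$ of clients and $L\subseteq\mathcal X$ of facility locations with $L\neq\emptyset$, integers $k\ge 1$ and $m\ge 0$, and a real $z>0$; put $n=|C\cup L|$. The $k$-center version is the case $L=C$. A $k$-center-set is a $k$-tuple $F=(f_1,\dots,f_k)\in L^k$ (several facilities may be opened at one location). A *feasible clustering* is a family $\mathbb O=(O_1,\dots,O_k)$ of pairwise disjoint, possibly empty, subsets of $C$ with $|C\setminus\bigcup_i O_i|\le m$ that satisfies the constraint of the problem at hand. Its cost with respect to $F$, and its cost, are $$\Psi(F,\mathbb O)=\max_{1\le i\le k}\ \min_{1\le j\le k}\ \max_{x\in O_i} d(x,f_j)^z,\qquad \Psi^*(\mathbb O)=\min_{F\in L^k}\Psi(F,\mathbb O)$$ (a maximum over the empty set is $0$). An algorithm *solves the problem with factor $\alpha$* if, whenever a feasible clustering exists, it outputs a feasible clustering $\mathbb O$ and a $k$-center-set $F$ with $\Psi(F,\mathbb O)\le\alpha\cdot\Psi^*(\mathbb O')$ for every feasible clustering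 $\mathbb O'$, and otherwise reports that there is none. The problems are: 1. *$r$-gather*: given nonnegative integers $r_1,\dots,r_k$, require $|O_i|\ge r_i$ for all $i$. 2. *$r$-capacity*: given nonnegative integers $r_1,\dots,r_k$, require $|O_i|\le r_i$ for all $i$. 3. *Balanced*: given nonnegative integers $\ell_1,\dots,\ell_k$ and $r_1,\dots,r_k$, require $\ell_i\le|O_i|\le r_i$ for all $i$. 4. *Chromatic*: given a color for every client, require that no $O_i$ contains two clients of the same color. 5. *Fault-tolerant*: given an integer $1\le\ell_x\le k$ for every $x\in C$, find $F\in L^k$ and $Z\subseteq C$ with $|Z|\le m$. The cost is $\max_{x\in C\setminus Z} d_{\ell_x}(x,F)^z$, where $d_\ell(x,F)$ is the $\ell$-th smallest of $d(x,f_1),\dots,d(x,f_k)$; here factor $\alpha$ means that the cost of the output is at most $\alpha$ times the cost of every pair $(F',Z')$ of this kind. 6. *Strongly private*: given a partition of $C$ into nonempty classes $C_1,\dots,C_\omega$ and integers $\ell_1,\dots,\ell_\omega$, require $|C_j\cap O_i|\ge\ell_j$ for all $i\le k$, $j\le\omega$. **Theorem.** For each of these six outlier $k$-supplier problems there is an algorithm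 which, on every instance, solves the problem with factor $3^z$, and with factor $2^z$ if $L=C$ (the $k$-center version), in time $(k+m)^{O(k)}\cdot n^{O(1)}$; that is, there is an absolute constant $c$ such that the number of steps is at most $c\,(k+m)^{ck}\,n^{c}$. Here an algorithm is a fixed finite program over cons cells whose atoms are integers and reals. Its unit-cost steps are pointer copies, building and opening a cell, addition, subtraction and comparison of integers, comparison of reals, and branching and looping on such tests. The input lists $n,k,m,z$, the distance matrix of $C\cup L$, the membership of every point in $C$ and in $L$, and the constraint data. -/

import Mathlib

open scoped NNReal

universe u

noncomputable section

namespace OutlierClustering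

/-! ### The model of computation

A first-order functional language over cons cells. A program is one finite term, the same for all
inputs. Data are binary trees built from `nil`, integers and real numbers. Every construct charges
one step, and every primitive is a constant-time operation of a (real) RAM with heap-allocated
cons cells: copying a pointer, building or opening a cell, adding, subtracting or comparing two
integers, comparing two reals. There is no integer multiplication, no real arithmetic and no real
literal: real numbers enter through the input only, and can only be moved and compared. -/

/-- Data: cons trees with integers and reals as atoms. -/
inductive Data : Type
  | nil : Data
  | int (a : ℤ) : Data
  | real (r : ℝ) : Data
  | cons (x y : Data) : Data

namespace Data

/-- Truth values: `nil` is false, everything else is true. -/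
def ofProp (P : Prop) [Decidable P] : Data := if P then int 1 else nil

/-- First component of a cell (`nil` on atoms). -/
def fst : Data → Data
  | cons x _ => x
  | _ => nil

/-- Second component of a cell (`nil` on atoms). -/
def snd : Data → Data
  | cons _ y => y
  | _ => nil

/-- Sum of the two integers in a cell. -/
def add : Data → Data
  | cons (int a) (int b) => int (a + b)
  | _ => nil

/-- Difference of the two integers in a cell. -/
def sub : Data → Data
  | cons (int a) (int b) => int (a - b)
  | _ => nil

/-- Comparison of the two integers in a cell. -/
def leInt : Data → Data
  | cons (int a) (int b) => ofProp (a ≤ b)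
  | _ => nil

/-- Comparison of the two reals in a cell. -/
def leReal : Data → Data
  | cons (real a) (real b) => ofProp (a ≤ b)
  | _ => nil

/-- A finite sequence of data as a `nil`-terminated list of cells. -/
def list : List Data → Data
  | [] => nil
  | x :: l => cons x (list l)

/-- A vector of data as a list. -/
def vec {N : ℕ} (f : Fin N → Data) : Data := list (List.ofFn f)

end Data

/-- Programs; each denotes a partial function from `Data` to `Data`. -/
inductive Code : Type
  | id : Code
  | nil : Code
  | int (a : ℤ) : Code
  | fst : Code
  | snd : Code
  | add : Code
  | sub : Code
  | leInt : Code
  | leReal : Code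
  | pair (f g : Code) : Code
  | comp (g f : Code) : Code
  | ite (b f g : Code) : Code
  | loop (b f : Code) : Code

/-- `c.Runs x y t`: started on `x`, the program `c` halts with result `y` after `t` steps.
`pair f g` builds a cell from the results of `f` and `g`, `comp g f` runs `f` and then `g`,
`ite b f g` branches on the result of `b`, and `loop b f` repeats `f` while `b` is true. -/
inductive Code.Runs : Code → Data → Data → ℕ → Prop
  | id (x : Data) : Runs .id x x 1
  | nil (x : Data) : Runs .nil x .nil 1
  | int (a : ℤ) (x : Data) : Runs (.int a) x (.int a) 1
  | fst (x : Data) : Runs .fst x x.fst 1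
  | snd (x : Data) : Runs .snd x x.snd 1
  | add (x : Data) : Runs .add x x.add 1
  | sub (x : Data) : Runs .sub x x.sub 1
  | leInt (x : Data) : Runs .leInt x x.leInt 1
  | leReal (x : Data) : Runs .leReal x x.leReal 1
  | pair {f g : Code} {x y w : Data} {s t : ℕ} :
      Runs f x y s → Runs g x w t → Runs (.pair f g) x (.cons y w) (s + t + 1)
  | comp {g f : Code} {x y w : Data} {s t : ℕ} :
      Runs f x y s → Runs g y w t → Runs (.comp g f) x w (s + t + 1)
  | ite_true {b f g : Code} {x v y : Data} {s t : ℕ} :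
      Runs b x v s → v ≠ .nil → Runs f x y t → Runs (.ite b f g) x y (s + t + 1)
  | ite_false {b f g : Code} {x y : Data} {s t : ℕ} :
      Runs b x .nil s → Runs g x y t → Runs (.ite b f g) x y (s + t + 1)
  | loop_done {b f : Code} {x : Data} {s : ℕ} :
      Runs b x .nil s → Runs (.loop b f) x x (s + 1)
  | loop_step {b f : Code} {x v y w : Data} {s t r : ℕ} :
      Runs b x v s → v ≠ .nil → Runs f x y t → Runs (.loop b f) y w r →
        Runs (.loop b f) x w (s + t + r + 1)

/-- Runs are deterministic: result and step count are determined by program and input. -/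
theorem Code.Runs.det {c : Code} {x y y' : Data} {t t' : ℕ}
    (h : c.Runs x y t) (h' : c.Runs x y' t') : y = y' ∧ t = t' := by
  induction h generalizing y' t' with
  | pair _ _ ih₁ ih₂ =>
    cases h' with
    | pair h₁ h₂ => obtain ⟨rfl, rfl⟩ := ih₁ h₁; obtain ⟨rfl, rfl⟩ := ih₂ h₂; exact ⟨rfl, rfl⟩
  | comp _ _ ih₁ ih₂ =>
    cases h' with
    | comp h₁ h₂ => obtain ⟨rfl, rfl⟩ := ih₁ h₁; obtain ⟨rfl, rfl⟩ := ih₂ h₂; exact ⟨rfl, rfl⟩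
  | ite_true _ hv _ ih₁ ih₂ =>
    cases h' with
    | ite_true h₁ _ h₂ =>
      obtain ⟨rfl, rfl⟩ := ih₁ h₁; obtain ⟨rfl, rfl⟩ := ih₂ h₂; exact ⟨rfl, rfl⟩
    | ite_false h₁ _ => exact absurd (ih₁ h₁).1 hv
  | ite_false _ _ ih₁ ih₂ =>
    cases h' with
    | ite_true h₁ hv _ => exact absurd (ih₁ h₁).1.symm hv
    | ite_false h₁ h₂ =>
      obtain ⟨_, rfl⟩ := ih₁ h₁; obtain ⟨rfl, rfl⟩ := ih₂ h₂; exact ⟨rfl, rfl⟩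
  | loop_done _ ih =>
    cases h' with
    | loop_done h₁ => obtain ⟨_, rfl⟩ := ih h₁; exact ⟨rfl, rfl⟩
    | loop_step h₁ hv _ _ => exact absurd (ih h₁).1.symm hv
  | loop_step _ hv _ _ ih₁ ih₂ ih₃ =>
    cases h' with
    | loop_done h₁ => exact absurd (ih₁ h₁).1 hv
    | loop_step h₁ _ h₂ h₃ =>
      obtain ⟨rfl, rfl⟩ := ih₁ h₁; obtain ⟨rfl, rfl⟩ := ih₂ h₂
      obtain ⟨rfl, rfl⟩ := ih₃ h₃; exact ⟨rfl, rfl⟩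
  | _ => cases h'; exact ⟨rfl, rfl⟩

/-! ### Instances, clusterings and costs -/

/-- An instance `(L, C, k, d, z, m)` of the outlier `k`-supplier problem in a metric space `X`.
The points of `C ∪ L` are named by `0, …, n - 1`, so that `n = |C ∪ L|`. -/
structure Inst (X : Type u) [MetricSpace X] where
  /-- number of points of `C ∪ L` -/
  n : ℕ
  /-- number of facilities -/
  k : ℕ
  /-- number of outliers allowed -/
  m : ℕ
  /-- exponent of the distances in the cost -/
  z : ℝ
  /-- the points of `C ∪ L`, without repetition -/
  pt : Fin n → X
  /-- the clients `C` -/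
  clients : Finset (Fin n)
  /-- the facility locations `L` -/
  locs : Finset (Fin n)
  pt_injective : Function.Injective pt
  union_eq : clients ∪ locs = Finset.univ
  locs_nonempty : locs.Nonempty
  k_pos : 0 < k
  z_pos : 0 < z

namespace Inst

variable {X : Type u} [MetricSpace X] (I : Inst X)

/-- A `k`-center-set: `k` facilities in `L`, where several facilities may be opened at the same
location (soft assignment). -/
abbrev Centers : Type := Fin I.k → {y : Fin I.n // y ∈ I.locs}

/-- Indexed families of `k` clusters `O₁, …, O_k` (clusters may be empty). -/
abbrev Clustering : Type := Fin I.k → Finset (Fin I.n)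

/-- `d(x, y)^z`. -/
def pcost (x y : Fin I.n) : ℝ≥0 := nndist (I.pt x) (I.pt y) ^ I.z

/-- `Ψ(F, O)`: the maximum over the clusters `O i` of the `1`-supplier cost of `O i` at the
facility of `F` that is best for `O i`. An empty cluster costs nothing. -/
def psi (F : I.Centers) (O : I.Clustering) : ℝ≥0 :=
  Finset.univ.sup fun i => ⨅ j : Fin I.k, (O i).sup fun x => I.pcost x (F j)

/-- `Ψ*(O)`: the minimum of `Ψ(F, O)` over all `k`-center-sets `F`. -/
def psiStar (O : I.Clustering) : ℝ≥0 := ⨅ F : I.Centers, I.psi F O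

/-- `O` is a partitioning into `k` clusters of a set of clients that misses at most `m` clients. -/
def IsOutlierPartition (O : I.Clustering) : Prop :=
  (∀ i, O i ⊆ I.clients) ∧ (∀ i j, i ≠ j → Disjoint (O i) (O j)) ∧
    (I.clients \ Finset.univ.biUnion O).card ≤ I.m

/-- `r`-gather: `|O i| ≥ r i`. -/
def gather (r : Fin I.k → ℕ) : Set I.Clustering :=
  {O | I.IsOutlierPartition O ∧ ∀ i, r i ≤ (O i).card}

/-- `r`-capacity: `|O i| ≤ r i`. -/
def capacity (r : Fin I.k → ℕ) : Set I.Clustering :=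
  {O | I.IsOutlierPartition O ∧ ∀ i, (O i).card ≤ r i}

/-- Balanced: `l i ≤ |O i| ≤ r i`. -/
def balanced (l r : Fin I.k → ℕ) : Set I.Clustering :=
  {O | I.IsOutlierPartition O ∧ ∀ i, l i ≤ (O i).card ∧ (O i).card ≤ r i}

/-- Chromatic: no cluster contains two clients of the same color. -/
def chromatic (color : Fin I.n → ℕ) : Set I.Clustering :=
  {O | I.IsOutlierPartition O ∧ ∀ i, ∀ x ∈ O i, ∀ y ∈ O i, color x = color y → x = y}

/-- `color` (read on the clients only) describes a partitioning of the client set into `ω`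
(nonempty) classes `C_j = {x | color x = j}`, `j < ω`. -/
def IsColoring (ω : ℕ) (color : Fin I.n → ℕ) : Prop :=
  (∀ x ∈ I.clients, color x < ω) ∧ ∀ j < ω, ∃ x ∈ I.clients, color x = j

/-- Strongly private: `|C_j ∩ O i| ≥ l j` for every cluster `O i` and every class `C_j`. -/
def stronglyPrivate {ω : ℕ} (color : Fin I.n → ℕ) (l : Fin ω → ℤ) : Set I.Clustering :=
  {O | I.IsOutlierPartition O ∧
    ∀ i, ∀ j : Fin ω, l j ≤ (((O i).filter fun x => color x = (j : ℕ)).card : ℤ)}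

/-- The distance of `x` to its `l`-th closest facility in `F`, `1 ≤ l ≤ k`: the least radius within
which there are at least `l` of the `k` facilities. -/
def kthDist (F : I.Centers) (l : ℕ) (x : Fin I.n) : ℝ≥0 :=
  sInf {ρ : ℝ≥0 |
    l ≤ (Finset.univ.filter fun j : Fin I.k => nndist (I.pt x) (I.pt (F j)) ≤ ρ).card}

/-- Fault-tolerant cost of the centers `F` and the outliers `Z`: the maximum over the clients `x`
outside `Z` of the `z`-th power of the distance of `x` to its `l x`-th closest facility. -/
def ftCost (l : Fin I.n → ℕ) (F : I.Centers) (Z : Finset (Fin I.n)) : ℝ≥0 :=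
  (I.clients \ Z).sup fun x => I.kthDist F (l x) x ^ I.z

/-! ### Input, output and guarantees of algorithms -/

/-- The input: `n`, `k`, `m`, `z`, the distance matrix, the membership flags of `C` and of `L`,
and the data `e` of the constraints. -/
def input (e : Data) : Data :=
  .list [.int I.n, .int I.k, .int I.m, .real I.z,
    .vec fun x => .vec fun y => .real (dist (I.pt x) (I.pt y)),
    .vec fun x => .ofProp (x ∈ I.clients), .vec fun x => .ofProp (x ∈ I.locs), e]

/-- Output of a `k`-center-set: the names of its `k` facilities. -/
def encCenters (F : I.Centers) : Data := .vec fun j => .int ((F j : Fin I.n) : ℕ)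

/-- The clustering described by cluster labels: `a x = some i` puts `x` into `O i`, and
`a x = none` leaves `x` unassigned. -/
def ofLabels (a : Fin I.n → Option (Fin I.k)) : I.Clustering :=
  fun i => Finset.univ.filter fun x => a x = some i

/-- Output of cluster labels: for every point the index of its cluster, or `nil`. -/
def encLabels (a : Fin I.n → Option (Fin I.k)) : Data :=
  .vec fun x => match a x with
    | none => .nil
    | some i => .int (i : ℕ)

/-- The time bound `c · (k + m)^(c k) · n^c`; with `c` a constant this is
`(k + m)^{O(k)} · n^{O(1)}`. -/
def timeBound (c : ℕ) : ℕ := c * (I.k + I.m) ^ (c * I.k) * I.n ^ c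

/-- `p` solves the constrained outlier `k`-supplier problem on `I` with the collection `S` of
feasible partitionings (described to `p` by `e`) within the time bound: it reports `nil` if `S` is
empty, and otherwise outputs some `O ∈ S` with centers `F` whose cost is at most `3^z` times the
optimum, and at most `2^z` times the optimum if `L = C`. -/
def SolvesClustering (p : Code) (c : ℕ) (e : Data) (S : Set I.Clustering) : Prop :=
  ∃ (out : Data) (t : ℕ), p.Runs (I.input e) out t ∧ t ≤ I.timeBound c ∧
    (S = ∅ → out = .nil) ∧
    (S.Nonempty → ∃ (F : I.Centers) (a : Fin I.n → Option (Fin I.k)),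
      out = .cons (I.encCenters F) (I.encLabels a) ∧ I.ofLabels a ∈ S ∧
      (∀ O ∈ S, I.psi F (I.ofLabels a) ≤ 3 ^ I.z * I.psiStar O) ∧
      (I.locs = I.clients → ∀ O ∈ S, I.psi F (I.ofLabels a) ≤ 2 ^ I.z * I.psiStar O))

/-- `p` solves the fault-tolerant outlier `k`-supplier problem on `I` with requirements `l` within
the time bound: it outputs centers `F` and a set `Z` of at most `m` outliers (by flags) whose cost
is at most `3^z` times the optimum, and at most `2^z` times the optimum if `L = C`. -/
def SolvesFaultTolerant (p : Code) (c : ℕ) (l : Fin I.n → ℕ) : Prop :=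
  ∃ (out : Data) (t : ℕ), p.Runs (I.input (.vec fun x => .int (l x))) out t ∧
    t ≤ I.timeBound c ∧
    ∃ (F : I.Centers) (Z : Finset (Fin I.n)),
      out = .cons (I.encCenters F) (.vec fun x => .ofProp (x ∈ Z)) ∧
      Z ⊆ I.clients ∧ Z.card ≤ I.m ∧
      (∀ (F' : I.Centers) (Z' : Finset (Fin I.n)), Z' ⊆ I.clients → Z'.card ≤ I.m →
        I.ftCost l F Z ≤ 3 ^ I.z * I.ftCost l F' Z') ∧
      (I.locs = I.clients →
        ∀ (F' : I.Centers) (Z' : Finset (Fin I.n)), Z' ⊆ I.clients → Z'.card ≤ I.m →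
          I.ftCost l F Z ≤ 2 ^ I.z * I.ftCost l F' Z')

end Inst

end OutlierClustering

end

noncomputable section

namespace OutlierClustering

/-! ### Encodings and polynomial-time functions -/

/-! Fix an optimal solution of radius `r` (the cost to the power `1/z`). Up to rounding, `r` is an
entry of the distance matrix, so all entries are tried as guesses. For each guess a greedy maximum
coverage repeatedly opens the location with the most uncovered clients within the guess. The optimal
centers leave at most `m` clients uncovered, so every step shrinks the excess over `m` by the factor
`1 - 1/k`. After `k * (log₂ n + 1)` steps at most `m` clients are uncovered. Adding one nearby
location for each of them, if there is one, gives a list `G` of at most `k * (log₂ n + 1) + m`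
candidates (`candidates_spec`). Every client with a location within the guess then has a candidate
within the guess.

Replacing each optimal center by a suitable candidate costs a factor 3. If `y` is served by the
center `f` and `g` is a candidate near `y`, then `d(x,g) ≤ d(x,f) + d(f,y) + d(y,g) ≤ 3r` for every
`x` served by `f`. If `L = C`, then `f` is itself a client with a candidate `g` near it, and two
terms suffice (`exists_tuple`). So some `k`-tuple over `G` is good. There are at most `|G|^k` tuples
for each guess, and `(log₂ n + 1)^k ≤ k^k * 2n` (`pow_le_pow_mul_two_pow`) makes this `(k+m)^{O(k)}
* n^{O(1)}`.

For a fixed tuple and a fixed radius, feasibility is a polynomial-time test. Bounds on the numbers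
of clients of each color in each cluster become a bipartite matching of clients and dummies to
numbered slots (`boundsTest_sound`, `boundsTest_complete`). An auction with integer prices solves
it, and it fails only in the presence of a Hall violator (`auction_complete`). All problems but the
fault-tolerant one are of this kind; there one only counts the clients with too few centers nearby.
The algorithm returns the outcome of least radius (`bestOutcome_spec`). Since radii are only
compared, never multiplied, `3r` and `2r` occur only in the analysis, rounded down to a matrix
entry.

Running times are handled by `PolyFun`, a class of functions closed under composition and suitably
bounded folds. Only the list `0, …, k - 1` and the enumeration of the tuples fall outside it and are
treated by hand (`exists_solver`). -/

/-- Number of nodes of a tree. -/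
def Data.size : Data → ℕ
  | .cons x y => x.size + y.size + 1
  | _ => 1

theorem Data.size_pos (x : Data) : 1 ≤ x.size := by
  cases x <;> simp [Data.size]

/-- Types whose elements are represented by data. -/
class Enc (α : Type) where
  /-- the representation of an element -/
  enc : α → Data

open Enc (enc)

instance : Enc Data := ⟨fun x => x⟩
instance : Enc ℤ := ⟨.int⟩
instance : Enc ℝ := ⟨.real⟩
instance : Enc Unit := ⟨fun _ => .nil⟩
instance : Enc Bool := ⟨fun b => Data.ofProp (b = true)⟩

variable {α β γ δ : Type} [Enc α] [Enc β] [Enc γ] [Enc δ]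

instance : Enc (α × β) := ⟨fun p => .cons (enc p.1) (enc p.2)⟩
instance : Enc (List α) := ⟨fun l => .list (l.map enc)⟩

/-- Size of the representation. -/
def esize (a : α) : ℕ := (enc a).size

theorem esize_pos (a : α) : 1 ≤ esize a := Data.size_pos _

@[simp] theorem esize_int (a : ℤ) : esize a = 1 := rfl
@[simp] theorem esize_real (a : ℝ) : esize a = 1 := rfl
@[simp] theorem esize_bool (a : Bool) : esize a = 1 := by cases a <;> simp [esize, enc, Data.ofProp, Data.size]
@[simp] theorem esize_prod (p : α × β) : esize p = esize p.1 + esize p.2 + 1 := rfl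
@[simp] theorem esize_nil : esize ([] : List α) = 1 := rfl
@[simp] theorem esize_cons (a : α) (l : List α) : esize (a :: l) = esize a + esize l + 1 := rfl

theorem eval_mono (P : Polynomial ℕ) {s t : ℕ} (h : s ≤ t) : P.eval s ≤ P.eval t := by
  induction P using Polynomial.induction_on' with
  | add p q hp hq => simp only [Polynomial.eval_add]; omega
  | monomial n a => simp only [Polynomial.eval_monomial]; gcongr

/-- Functions computed by a program in polynomial time and with results of polynomial size. -/
@[fun_prop] def PolyFun (f : α → β) : Prop :=
  ∃ (c : Code) (P : Polynomial ℕ), ∀ a, ∃ t, c.Runs (enc a) (enc (f a)) t ∧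
    t ≤ P.eval (esize a) ∧ esize (f a) ≤ P.eval (esize a)

@[fun_prop] theorem PolyFun.id : PolyFun (fun a : α => a) :=
  ⟨.id, .X + 1, fun a => ⟨1, .id _, by simp, by simp⟩⟩

@[fun_prop] theorem PolyFun.comp {g : β → γ} {f : α → β} (hg : PolyFun g) (hf : PolyFun f) :
    PolyFun (fun a => g (f a)) := by
  obtain ⟨c, P, h⟩ := hf
  obtain ⟨d, Q, k⟩ := hg
  refine ⟨.comp d c, P + Q.comp P + 1, fun a => ?_⟩
  obtain ⟨s, h1, h2, h3⟩ := h a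
  obtain ⟨t, k1, k2, k3⟩ := k (f a)
  refine ⟨_, .comp h1 k1, ?_, ?_⟩ <;> simp only [Polynomial.eval_add, Polynomial.eval_comp, Polynomial.eval_one]
  · have := eval_mono Q h3; omega
  · have := eval_mono Q h3; omega

@[fun_prop] theorem PolyFun.pair {f : α → β} {g : α → γ} (hf : PolyFun f) (hg : PolyFun g) :
    PolyFun (fun a => (f a, g a)) := by
  obtain ⟨c, P, h⟩ := hf
  obtain ⟨d, Q, k⟩ := hg
  refine ⟨.pair c d, P + Q + 1, fun a => ?_⟩
  obtain ⟨s, h1, h2, h3⟩ := h a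
  obtain ⟨t, k1, k2, k3⟩ := k a
  refine ⟨_, .pair h1 k1, ?_, ?_⟩ <;> simp only [Polynomial.eval_add, Polynomial.eval_one, esize_prod] <;> omega

@[fun_prop] theorem PolyFun.fst {f : α → β × γ} (hf : PolyFun f) : PolyFun (fun a => (f a).1) :=
  .comp (g := Prod.fst) ⟨.fst, .X + 1, fun a => ⟨1, .fst _, by simp, by simp; omega⟩⟩ hf

@[fun_prop] theorem PolyFun.snd {f : α → β × γ} (hf : PolyFun f) : PolyFun (fun a => (f a).2) :=
  .comp (g := Prod.snd) ⟨.snd, .X + 1, fun a => ⟨1, .snd _, by simp, by simp; omega⟩⟩ hf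

@[fun_prop] theorem polyFun_int (z : ℤ) : PolyFun (fun _ : α => z) :=
  ⟨.int z, 1, fun a => ⟨1, .int _ _, by simp, by simp⟩⟩

@[fun_prop] theorem polyFun_add : PolyFun (fun p : ℤ × ℤ => p.1 + p.2) :=
  ⟨.add, 1, fun a => ⟨1, .add _, by simp, by simp⟩⟩

@[fun_prop] theorem polyFun_sub : PolyFun (fun p : ℤ × ℤ => p.1 - p.2) :=
  ⟨.sub, 1, fun a => ⟨1, .sub _, by simp, by simp⟩⟩

/-- Comparison of integers. -/
def ile (x y : ℤ) : Bool := decide (x ≤ y)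

/-- Comparison of reals. -/
def rle (x y : ℝ) : Bool := decide (x ≤ y)

@[simp] theorem ile_iff {x y : ℤ} : ile x y = true ↔ x ≤ y := by simp [ile]
@[simp] theorem rle_iff {x y : ℝ} : rle x y = true ↔ x ≤ y := by simp [rle]

@[fun_prop] theorem polyFun_ile : PolyFun (fun p : ℤ × ℤ => ile p.1 p.2) :=
  ⟨.leInt, 1, fun a => ⟨1, by
    have := Code.Runs.leInt (enc a)
    simpa [enc, Data.leInt, ile] using this, by simp, by simp⟩⟩

@[fun_prop] theorem polyFun_rle : PolyFun (fun p : ℝ × ℝ => rle p.1 p.2) :=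
  ⟨.leReal, 1, fun a => ⟨1, by
    have := Code.Runs.leReal (enc a)
    have e : enc (rle a.1 a.2) = Data.leReal (enc a) := by
      simp only [enc, Data.leReal, rle, Data.ofProp, decide_eq_true_eq]
    rwa [e], by simp, by simp⟩⟩

theorem enc_true : enc true = Data.int 1 := by simp [enc, Data.ofProp]
theorem enc_false : enc false = Data.nil := by simp [enc, Data.ofProp]

@[fun_prop] theorem polyFun_false : PolyFun (fun _ : α => false) :=
  ⟨.nil, 1, fun a => ⟨1, by rw [enc_false]; exact .nil _, by simp, by simp⟩⟩

-- The list `x :: l` and the pair `(x, l)` are represented by the same tree, so no extra program is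
-- needed.
@[fun_prop] theorem PolyFun.cons {f : α → β} {g : α → List β} (hf : PolyFun f) (hg : PolyFun g) :
    PolyFun (fun a => f a :: g a) :=
  hf.pair hg

/-- The representation of an element. -/
def toData (a : α) : Data := enc a

@[fun_prop] theorem PolyFun.toData {f : α → β} (hf : PolyFun f) :
    PolyFun (fun a => toData (f a)) :=
  hf

@[fun_prop] theorem PolyFun.cond {b : α → Bool} {f g : α → β} (hb : PolyFun b) (hf : PolyFun f)
    (hg : PolyFun g) : PolyFun (fun a => bif b a then f a else g a) := by
  obtain ⟨d, R, l⟩ := hb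
  obtain ⟨c, P, h⟩ := hf
  obtain ⟨e, Q, k⟩ := hg
  refine ⟨.ite d c e, R + P + Q + 1, fun a => ?_⟩
  obtain ⟨r, l1, l2, l3⟩ := l a
  obtain ⟨s, h1, h2, h3⟩ := h a
  obtain ⟨t, k1, k2, k3⟩ := k a
  simp only [Polynomial.eval_add, Polynomial.eval_one]
  cases hb : b a with
  | true =>
    rw [hb, enc_true] at l1
    exact ⟨_, .ite_true l1 (by simp) h1, by omega, by simp only [cond_true]; omega⟩
  | false =>
    rw [hb, enc_false] at l1
    exact ⟨_, .ite_false l1 k1, by omega, by simp only [cond_false]; omega⟩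

@[fun_prop] theorem PolyFun.and {b c : α → Bool} (hb : PolyFun b) (hc : PolyFun c) :
    PolyFun (fun a => b a && c a) := by
  have : PolyFun (fun a => bif b a then c a else false) := by fun_prop
  convert this using 2 with a
  cases b a <;> rfl

@[fun_prop] theorem PolyFun.or {b c : α → Bool} (hb : PolyFun b) (hc : PolyFun c) :
    PolyFun (fun a => b a || c a) := by
  have : PolyFun (fun a => bif b a then true else c a) := by fun_prop
  convert this using 2 with a
  cases b a <;> rfl

@[fun_prop] theorem PolyFun.not {b : α → Bool} (hb : PolyFun b) :
    PolyFun (fun a => !(b a)) := by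
  have : PolyFun (fun a => bif b a then false else true) := by fun_prop
  convert this using 2 with a
  cases b a <;> rfl

/-- Equality of integers. -/
def ieq (x y : ℤ) : Bool := ile x y && ile y x

/-- Strict comparison of integers. -/
def ilt (x y : ℤ) : Bool := !ile y x

@[simp] theorem ieq_iff {x y : ℤ} : ieq x y = true ↔ x = y := by
  rw [ieq, Bool.and_eq_true, ile_iff, ile_iff, le_antisymm_iff]
@[simp] theorem ilt_iff {x y : ℤ} : ilt x y = true ↔ x < y := by simp [ilt, ile]

@[fun_prop] theorem polyFun_ieq : PolyFun (fun p : ℤ × ℤ => ieq p.1 p.2) := by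
  unfold ieq; fun_prop

@[fun_prop] theorem polyFun_ilt : PolyFun (fun p : ℤ × ℤ => ilt p.1 p.2) := by
  unfold ilt; fun_prop

/-- Case distinction on a list. -/
def listCase (l : List α) (b : β) (f : α → List α → β) : β :=
  match l with
  | [] => b
  | x :: l' => f x l'

-- A nonempty list is a cell, so its representation serves both as the truth value of the test and
-- as the pair of head and tail.
@[fun_prop] theorem PolyFun.listCase {l : γ → List α} {b : γ → β} {f : γ → α → List α → β}
    (hl : PolyFun l) (hb : PolyFun b) (hf : PolyFun fun p : γ × α × List α => f p.1 p.2.1 p.2.2) :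
    PolyFun (fun a => listCase (l a) (b a) (f a)) := by
  obtain ⟨d, R, l'⟩ := hl
  obtain ⟨c, P, h⟩ := hf
  obtain ⟨e, Q, k⟩ := hb
  -- The branch consumes the result of its test, so the list is computed a second time to pass it
  -- on.
  refine ⟨.ite d (.comp c (.pair .id d)) e, 2 * R + P.comp (R + .X + 1) + Q + 5, fun a => ?_⟩
  obtain ⟨r, l1, l2, l3⟩ := l' a
  obtain ⟨t, k1, k2, k3⟩ := k a
  simp only [Polynomial.eval_add, Polynomial.eval_one, Polynomial.eval_comp, Polynomial.eval_X,
    Polynomial.eval_mul, Polynomial.eval_ofNat]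
  cases hl : l a with
  | nil =>
    rw [hl] at l1
    exact ⟨_, .ite_false l1 k1, by omega, by simp only [OutlierClustering.listCase]; omega⟩
  | cons x l' =>
    rw [hl] at l1 l3
    obtain ⟨s, h1, h2, h3⟩ := h (a, x, l')
    have := eval_mono P (s := esize (a, x, l')) (t := R.eval (esize a) + esize a + 1)
      (by simp only [esize_prod, esize_cons] at *; omega)
    refine ⟨_, .ite_true l1 (by simp [enc, Data.list]) (.comp (.pair (.id _) l1) h1), by omega, ?_⟩
    simp only [OutlierClustering.listCase] at h3 ⊢; omega

theorem length_lt_esize (l : List α) : l.length < esize l := by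
  induction l with
  | nil => simp
  | cons a l ih => simp; omega

/-- The loop of a left fold with step `c`. -/
def foldlLoop (c : Code) : Code :=
  .loop (.comp .snd .snd) (.pair .fst (.pair (.comp c (.pair .fst (.pair
    (.comp .fst .snd) (.comp .fst (.comp .snd .snd))))) (.comp .snd (.comp .snd .snd))))

/-- `S` bounds the accumulator at every prefix, hence the input of every call of the step. The
constant 40 absorbs the moves of pointers in one round. -/
theorem foldl_loop {f : γ × β × α → β} {c : Code} {P : Polynomial ℕ}
    (hc : ∀ a, ∃ t, c.Runs (enc a) (enc (f a)) t ∧ t ≤ P.eval (esize a)) (g : γ) (S : ℕ)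
    (l : List α) (b : β)
    (hS : ∀ l', l' <+: l → esize (l'.foldl (fun b x => f (g, b, x)) b) ≤ S) :
    ∃ t, (foldlLoop c).Runs
      (enc (g, b, l)) (enc (g, l.foldl (fun b x => f (g, b, x)) b, ([] : List α))) t ∧
      t ≤ (l.length + 1) * (P.eval (esize g + S + esize l) + 40) := by
  induction l generalizing b with
  | nil =>
    refine ⟨_, .loop_done (.comp (.snd _) (.snd _)), ?_⟩
    simp
  | cons x l ih =>
    obtain ⟨t, h1, h2⟩ := ih (f (g, b, x)) fun l' hl' => by
      simpa using hS (x :: l') (by simpa using hl')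
    obtain ⟨s, k1, k2⟩ := hc (g, b, x)
    refine ⟨_, .loop_step (.comp (.snd _) (.snd _)) (by simp [enc, Data.list, Data.snd])
      (.pair (.fst _) (.pair (.comp (.pair (.fst _) (.pair (.comp (.snd _) (.fst _))
        (.comp (.comp (.snd _) (.snd _)) (.fst _)))) k1)
        (.comp (.comp (.snd _) (.snd _)) (.snd _)))) h1, ?_⟩
    have hb := hS [] (by simp)
    have e1 := eval_mono P (s := esize (g, b, x)) (t := esize g + S + esize (x :: l)) (by
      have := esize_pos l
      simp only [esize_prod, esize_cons, List.foldl_nil] at *; omega)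
    have e2 := eval_mono P (s := esize g + S + esize l) (t := esize g + S + esize (x :: l)) (by
      simp only [esize_cons]; omega)
    have e3 := Nat.mul_le_mul_left (l.length + 1) (Nat.add_le_add_right e2 40)
    simp only [List.length_cons]
    rw [Nat.add_mul (l.length + 1) 1]
    omega

/-- The bound `S` on the accumulators stays a parameter. This version therefore also covers the
enumeration of all tuples, whose size is not polynomial in the input. -/
theorem exists_foldl_code {f : γ × β × α → β} (hf : PolyFun f) :
    ∃ (c : Code) (P : Polynomial ℕ), ∀ (g : γ) (b : β) (l : List α) (S : ℕ),
      (∀ l', l' <+: l → esize (l'.foldl (fun b x => f (g, b, x)) b) ≤ S) →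
      ∃ t, c.Runs (enc (g, b, l)) (enc (l.foldl (fun b x => f (g, b, x)) b)) t ∧
        t ≤ P.eval (esize g + S + esize l) := by
  obtain ⟨c, P, h⟩ := hf
  refine ⟨.comp (.comp .fst .snd) (foldlLoop c), .X * (P + 40) + 5, fun g b l S hS => ?_⟩
  obtain ⟨t, h1, h2⟩ := foldl_loop (fun a => by
    obtain ⟨t, h1, h2, -⟩ := h a; exact ⟨t, h1, h2⟩) g S l b hS
  refine ⟨_, .comp h1 (.comp (.snd _) (.fst _)), ?_⟩
  simp only [Polynomial.eval_add, Polynomial.eval_mul, Polynomial.eval_X, Polynomial.eval_ofNat]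
  have := length_lt_esize l
  have : (l.length + 1) * (P.eval (esize g + S + esize l) + 40) ≤
      (esize g + S + esize l) * (P.eval (esize g + S + esize l) + 40) :=
    Nat.mul_le_mul_right _ (by omega)
  omega

/-- The hypothesis on prefixes is essential: iterating a polynomial-time step that, say, doubles its
argument would produce exponential size. -/
theorem PolyFun.foldl {l : γ → List α} {i : γ → β} {h : γ → β → α → β} (hl : PolyFun l)
    (hi : PolyFun i) (hh : PolyFun fun p : γ × β × α => h p.1 p.2.1 p.2.2)
    (hS : ∃ P : Polynomial ℕ, ∀ g l', l' <+: l g →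
      esize (l'.foldl (h g) (i g)) ≤ P.eval (esize g)) :
    PolyFun (fun g => (l g).foldl (h g) (i g)) := by
  obtain ⟨c, P, hc⟩ := exists_foldl_code hh
  obtain ⟨d, Q, hd⟩ := PolyFun.id.pair (hi.pair hl)
  obtain ⟨R, hR⟩ := hS
  refine ⟨.comp c d, Q + P.comp (.X + R + Q) + R + 1, fun g => ?_⟩
  obtain ⟨s, h1, h2, h3⟩ := hd g
  obtain ⟨t, k1, k2⟩ := hc g (i g) (l g) (R.eval (esize g)) (hR g)
  have := eval_mono P (s := esize g + R.eval (esize g) + esize (l g))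
    (t := esize g + R.eval (esize g) + Q.eval (esize g)) (by simp at h3; omega)
  have := hR g _ (List.prefix_refl _)
  refine ⟨_, .comp h1 k1, ?_, ?_⟩ <;> simp only [Polynomial.eval_add, Polynomial.eval_comp,
    Polynomial.eval_one, Polynomial.eval_X] <;> omega

end OutlierClustering

end

noncomputable section

namespace OutlierClustering

open Enc (enc)

variable {α β γ δ : Type} [Enc α] [Enc β] [Enc γ] [Enc δ]

/-! ### List operations in polynomial time -/

theorem esize_append (l l' : List α) : esize (l ++ l') + 1 = esize l + esize l' := by
  induction l with
  | nil => simp; omega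
  | cons a l ih => simp; omega

theorem esize_reverse (l : List α) : esize l.reverse = esize l := by
  induction l with
  | nil => simp
  | cons a l ih => have := esize_append l.reverse [a]; simp at *; omega

theorem esize_le_of_prefix {l l' : List α} (h : l' <+: l) : esize l' ≤ esize l := by
  obtain ⟨k, rfl⟩ := h
  have := esize_append l' k; have := esize_pos k; omega

theorem esize_le_of_sublist {l l' : List α} (h : l'.Sublist l) : esize l' ≤ esize l := by
  induction h <;> simp <;> omega

theorem esize_le_of_mem {l : List α} {a : α} (h : a ∈ l) : esize a < esize l := by
  induction l with
  | nil => simp at h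
  | cons b l ih => 
    simp only [esize_cons]
    rcases List.mem_cons.1 h with rfl | h
    · have := esize_pos l; omega
    · have := ih h; omega

theorem esize_le_mul (l : List α) (S : ℕ) (h : ∀ a ∈ l, esize a ≤ S) :
    esize l ≤ l.length * (S + 1) + 1 := by
  induction l with
  | nil => simp
  | cons b l ih =>
    have := ih fun a ha => h a (by simp [ha])
    have := h b (by simp)
    simp only [esize_cons, List.length_cons, Nat.add_mul]; omega

@[simp] theorem esize_listInt (l : List ℤ) : esize l = 2 * l.length + 1 := by
  induction l with
  | nil => simp
  | cons b l ih => simp; omega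

@[fun_prop] theorem PolyFun.reverse {f : γ → List α} (hf : PolyFun f) :
    PolyFun (fun a => (f a).reverse) := by
  have : PolyFun (fun l : List α => l.foldl (fun acc x => x :: acc) []) :=
    .foldl (by fun_prop) (by fun_prop) (by fun_prop) ⟨.X, fun l l' h => by
      have := esize_le_of_prefix h
      simpa [esize_reverse] using this⟩
  convert this.comp hf using 2 with a
  simp

-- Lists grow at the head only, so the first list is reversed and then pushed onto the second.
@[fun_prop] theorem PolyFun.append {f g : γ → List α} (hf : PolyFun f) (hg : PolyFun g) :
    PolyFun (fun a => f a ++ g a) := by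
  have : PolyFun (fun p : List α × List α => p.1.reverse.foldl (fun acc x => x :: acc) p.2) :=
    .foldl (by fun_prop) (by fun_prop) (by fun_prop) ⟨.X, fun p l' h => by
      have := esize_le_of_prefix h
      have h2 := esize_append l'.reverse p.2
      rw [esize_reverse] at *
      simp; omega⟩
  convert this.comp (hf.pair hg) using 2 with a
  simp

@[fun_prop] theorem PolyFun.flatMap {f : γ → List α} {h : γ → α → List β} (hf : PolyFun f)
    (hh : PolyFun fun p : γ × α => h p.1 p.2) : PolyFun (fun a => (f a).flatMap (h a)) := by
  have : PolyFun (fun a => (f a).foldl (fun acc x => acc ++ h a x) []) := by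
    refine .foldl (by fun_prop) (by fun_prop) ?_ ?_
    · exact (show PolyFun fun p : γ × List β × α => p.2.1 from by fun_prop).append
        (hh.comp (show PolyFun fun p : γ × List β × α => (p.1, p.2.2) from by fun_prop))
    · obtain ⟨_, P, hP⟩ := hh
      obtain ⟨_, Q, hQ⟩ := hf
      refine ⟨Q * (P.comp (.X + Q + 1)) + 1, fun g l' hl' => ?_⟩
      simp only [Polynomial.eval_add, Polynomial.eval_mul, Polynomial.eval_comp, Polynomial.eval_X,
        Polynomial.eval_one]
      obtain ⟨-, -, -, hQ⟩ := hQ g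
      -- Stated for arbitrary lists of elements of `f g` instead of prefixes, so that induction from
      -- the head applies.
      have key : ∀ l' : List α, (∀ x ∈ l', x ∈ f g) → esize (l'.foldl (fun acc x => acc ++ h g x) []) ≤
          l'.length * (P.eval (esize g + Q.eval (esize g) + 1)) + 1 := by
        intro l' hl'
        rw [List.foldl_append_eq_append]
        simp only [List.nil_append]
        induction l' with
        | nil => simp
        | cons x l' ih =>
          have := ih fun y hy => hl' y (by simp [hy])
          obtain ⟨-, -, -, h1⟩ := hP (g, x)
          have h2 := eval_mono P (s := esize (g, x)) (t := esize g + Q.eval (esize g) + 1) (by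
            have := esize_le_of_mem (hl' x (by simp))
            simp only [esize_prod]; omega)
          have := esize_append (h g x) (l'.map (h g)).flatten
          simp only [List.map_cons, List.flatten_cons, List.length_cons, Nat.add_mul] at *; omega
      refine (key l' fun x hx => hl'.subset hx).trans ?_
      have := length_lt_esize l'
      have := esize_le_of_prefix hl'
      gcongr; omega
  convert this using 2 with a
  rw [List.foldl_append_eq_append, List.nil_append, List.flatMap_def]

@[fun_prop] theorem PolyFun.map {f : γ → List α} {h : γ → α → β} (hf : PolyFun f)
    (hh : PolyFun fun p : γ × α => h p.1 p.2) : PolyFun (fun a => (f a).map (h a)) := by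
  have : PolyFun (fun a => (f a).flatMap fun x => [h a x]) := by
    refine hf.flatMap (.cons hh ?_); fun_prop
  convert this using 2 with a
  simp [List.flatMap_def]
  induction f a <;> simp_all

@[fun_prop] theorem PolyFun.filter {f : γ → List α} {h : γ → α → Bool} (hf : PolyFun f)
    (hh : PolyFun fun p : γ × α => h p.1 p.2) : PolyFun (fun a => (f a).filter (h a)) := by
  have : PolyFun (fun a => (f a).flatMap fun x => bif h a x then [x] else []) := by
    refine hf.flatMap (.cond hh ?_ ?_) <;> fun_prop
  convert this using 2 with a
  induction f a with
  | nil => simp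
  | cons x l ih => cases hx : h a x <;> simp [hx, ih]

theorem polyFun_foldl_int {l : γ → List α} {i : γ → ℤ} {h : γ → ℤ → α → ℤ} (hl : PolyFun l)
    (hi : PolyFun i) (hh : PolyFun fun p : γ × ℤ × α => h p.1 p.2.1 p.2.2) :
    PolyFun (fun g => (l g).foldl (h g) (i g)) :=
  .foldl hl hi hh ⟨1, fun g l' _ => by simp⟩

theorem polyFun_foldl_bool {l : γ → List α} {i : γ → Bool} {h : γ → Bool → α → Bool}
    (hl : PolyFun l) (hi : PolyFun i) (hh : PolyFun fun p : γ × Bool × α => h p.1 p.2.1 p.2.2) :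
    PolyFun (fun g => (l g).foldl (h g) (i g)) :=
  .foldl hl hi hh ⟨1, fun g l' _ => by simp⟩

@[fun_prop] theorem PolyFun.any {f : γ → List α} {h : γ → α → Bool} (hf : PolyFun f)
    (hh : PolyFun fun p : γ × α => h p.1 p.2) : PolyFun (fun a => (f a).any (h a)) := by
  have : PolyFun (fun a => (f a).foldl (fun b x => b || h a x) false) := by
    refine polyFun_foldl_bool hf (by fun_prop) (.or (by fun_prop) ?_)
    exact hh.comp (show PolyFun fun p : γ × Bool × α => (p.1, p.2.2) from by fun_prop)
  convert this using 2 with a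
  have : ∀ (l : List α) (b : Bool), (b || l.any (h a)) = l.foldl (fun b x => b || h a x) b := by
    intro l
    induction l with
    | nil => simp
    | cons x l ih => intro b; rw [List.foldl_cons, ← ih]; simp [Bool.or_assoc]
  simpa using this (f a) false

/-- Length as an integer. -/
def len (l : List α) : ℤ := l.foldl (fun n _ => n + 1) 0

omit [Enc α] in
@[simp] theorem len_eq (l : List α) : len l = l.length := by
  have : ∀ (l : List α) (n : ℤ), l.foldl (fun n _ => n + 1) n = n + l.length := by
    intro l
    induction l with
    | nil => simp
    | cons x l ih => intro n; simp [ih]; ring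
  simp [len, this]

@[fun_prop] theorem polyFun_len : PolyFun (len : List α → ℤ) :=
  polyFun_foldl_int (by fun_prop) (by fun_prop) (by fun_prop)

/-- The elements of a list with their positions. -/
def enum (l : List α) : List (ℤ × α) := l.zipIdx.map fun p => ((p.2 : ℤ), p.1)

@[fun_prop] theorem polyFun_enum : PolyFun (enum : List α → List (ℤ × α)) := by
  have key : ∀ (l : List α) (n : ℕ) (acc : List (ℤ × α)),
      l.foldl (fun (b : ℤ × List (ℤ × α)) x => (b.1 + 1, (b.1, x) :: b.2)) ((n : ℤ), acc) =
        (((n + l.length : ℕ) : ℤ), ((l.zipIdx n).map fun p => ((p.2 : ℤ), p.1)).reverse ++ acc) := by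
    intro l
    induction l with
    | nil => simp
    | cons x l ih =>
      intro n acc
      have := ih (n + 1) (((n : ℤ), x) :: acc)
      push_cast at this
      simp [this]
      ring
  have hs : ∀ (l : List α) (n : ℕ), esize ((l.zipIdx n).map fun p => ((p.2 : ℤ), p.1)) ≤
      3 * esize l := by
    intro l
    induction l with
    | nil => simp
    | cons x l ih => intro n; have := ih (n + 1); simp; omega
  have : PolyFun (fun l : List α =>
      ((l.foldl (fun (b : ℤ × List (ℤ × α)) x => (b.1 + 1, (b.1, x) :: b.2))
        (0, ([] : List (ℤ × α)))).2).reverse) := by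
    refine .reverse (.snd (.foldl (by fun_prop) (by fun_prop) (by fun_prop)
      ⟨3 * .X + 2, fun l l' h => ?_⟩))
    have h1 := key l' 0 []
    have h2 := hs l' 0
    have h3 := esize_le_of_prefix h
    simp only [Nat.cast_zero] at h1
    rw [h1]
    simp [esize_reverse]
    omega
  convert this using 2 with l
  have := key l 0 []
  simp only [Nat.cast_zero] at this
  rw [this]
  simp [enum]

omit [Enc α] in
theorem mem_enum {l : List α} {i : ℤ} {a : α} :
    (i, a) ∈ enum l ↔ ∃ j : ℕ, (j : ℤ) = i ∧ l[j]? = some a := by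
  simp only [enum, List.mem_map, Prod.mk.injEq, Prod.exists]
  constructor
  · rintro ⟨b, j, h, rfl, rfl⟩
    exact ⟨j, rfl, List.mk_mem_zipIdx_iff_getElem?.1 h⟩
  · rintro ⟨j, rfl, h⟩
    exact ⟨a, j, List.mk_mem_zipIdx_iff_getElem?.2 h, rfl, rfl⟩

/-- The `i`-th element, `d` if there is none. -/
def nthD (d : ℤ) (l : List ℤ) (i : ℤ) : ℤ :=
  (enum l).foldl (fun b p => bif ieq p.1 i then p.2 else b) d

@[fun_prop] theorem PolyFun.nthD {d : ℤ} {l : γ → List ℤ} {i : γ → ℤ} (hl : PolyFun l)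
    (hi : PolyFun i) : PolyFun (fun a => nthD d (l a) (i a)) :=
  polyFun_foldl_int (by fun_prop) (by fun_prop) (by fun_prop)

/-- The value that an association list gives to a key, `d` if there is none. -/
def assocD (d : ℤ) (l : List (ℤ × ℤ)) (i : ℤ) : ℤ :=
  l.foldl (fun b p => bif ieq p.1 i then p.2 else b) d

@[fun_prop] theorem PolyFun.assocD {d : ℤ} {l : γ → List (ℤ × ℤ)} {i : γ → ℤ} (hl : PolyFun l)
    (hi : PolyFun i) : PolyFun (fun a => assocD d (l a) (i a)) :=
  polyFun_foldl_int (by fun_prop) (by fun_prop) (by fun_prop)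

theorem assocD_eq_of_mem {d : ℤ} {l : List (ℤ × ℤ)} (hl : (l.map Prod.fst).Nodup) {i j : ℤ}
    (h : (i, j) ∈ l) : assocD d l i = j := by
  have key : ∀ (l : List (ℤ × ℤ)) (b : ℤ), i ∉ l.map Prod.fst →
      l.foldl (fun b p => bif ieq p.1 i then p.2 else b) b = b := by
    intro l
    induction l with
    | nil => simp
    | cons p l ih =>
      intro b hb
      have hp : ieq p.1 i = false := by
        rw [Bool.eq_false_iff, Ne, ieq_iff]; rintro rfl; simp at hb
      rw [List.foldl_cons, hp, cond_false]
      exact ih _ fun h => hb (by simp at h ⊢; tauto)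
  unfold assocD
  induction l generalizing d with
  | nil => simp at h
  | cons p l ih =>
    rw [List.map_cons, List.nodup_cons] at hl
    rcases List.mem_cons.1 h with rfl | h
    · rw [List.foldl_cons, key _ _ hl.1]
      simp [show ieq i i = true by simp]
    · exact ih hl.2 h

theorem assocD_eq_default {d : ℤ} {l : List (ℤ × ℤ)} {i : ℤ} (h : i ∉ l.map Prod.fst) :
    assocD d l i = d := by
  unfold assocD
  induction l generalizing d with
  | nil => simp
  | cons p l ih =>
    have hp : ieq p.1 i = false := by
      rw [Bool.eq_false_iff, Ne, ieq_iff]; rintro rfl; simp at h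
    rw [List.foldl_cons, hp, cond_false]
    exact ih fun h' => h (by simp at h' ⊢; tauto)

omit [Enc α] in
theorem map_fst_enum_nodup (l : List α) : ((enum l).map Prod.fst).Nodup := by
  have : (enum l).map Prod.fst = (List.range l.length).map (Nat.cast : ℕ → ℤ) := by
    refine List.ext_getElem (by simp [enum]) fun i h1 h2 => ?_
    simp [enum]
  rw [this]
  exact List.nodup_range.map Nat.cast_injective

theorem nthD_of_getElem? {d : ℤ} {l : List ℤ} {j : ℕ} {a : ℤ} (h : l[j]? = some a) :
    nthD d l j = a :=
  assocD_eq_of_mem (map_fst_enum_nodup l) (mem_enum.2 ⟨j, rfl, h⟩)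

theorem nthD_neg {d : ℤ} {l : List ℤ} {j : ℤ} (h : j < 0) : nthD d l j = d := by
  refine assocD_eq_default fun hj => ?_
  obtain ⟨⟨i, a⟩, h1, rfl⟩ := List.mem_map.1 hj
  obtain ⟨k, rfl, -⟩ := mem_enum.1 h1
  exact absurd h (by simp)

/-- A least element for a total preorder, as a list with at most one element. -/
def bestBy (le : α → α → Bool) (l : List α) : List α :=
  l.foldl (fun b x => listCase b [x] fun y _ => bif le y x then b else [x]) []

omit [Enc α] in
theorem bestBy_spec {le : α → α → Bool} (total : ∀ x y, le x y = true ∨ le y x = true)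
    (trans : ∀ x y z, le x y = true → le y z = true → le x z = true) (l : List α) :
    (l = [] ∧ bestBy le l = []) ∨
      ∃ x ∈ l, bestBy le l = [x] ∧ ∀ y ∈ l, le x y = true := by
  have step : ∀ (l : List α) (z : α), ∃ x, (x = z ∨ x ∈ l) ∧
      l.foldl (fun b x => listCase b [x] fun y _ => bif le y x then b else [x]) [z] =
        [x] ∧ le x z = true ∧ ∀ y ∈ l, le x y = true := by
    intro l
    induction l with
    | nil => intro z; exact ⟨z, by simpa using total z z⟩
    | cons w l ih =>
      intro z
      simp only [List.foldl_cons, listCase]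
      cases hw : le z w with
      | false =>
        obtain ⟨x, h1, h2, h3, h4⟩ := ih w
        have hzw := (total z w).resolve_left (by simp [hw])
        refine ⟨x, ?_, h2, trans _ _ _ h3 hzw, ?_⟩
        · rcases h1 with rfl | h1 <;> simp [*]
        · simpa [h3] using h4
      | true =>
        obtain ⟨x, h1, h2, h3, h4⟩ := ih z
        refine ⟨x, ?_, h2, h3, ?_⟩
        · rcases h1 with rfl | h1 <;> simp [*]
        · simp only [List.mem_cons, forall_eq_or_imp]
          exact ⟨trans _ _ _ h3 hw, h4⟩
  cases l with
  | nil => exact .inl ⟨rfl, rfl⟩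
  | cons z l =>
    right
    obtain ⟨x, h1, h2, h3, h4⟩ := step l z
    exact ⟨x, by simpa using h1, h2, by simpa [h3] using h4⟩

-- No property of `le` is needed here. This suffices to bound the size of the accumulator in
-- `PolyFun.bestBy`, where `le` is arbitrary.
omit [Enc α] in
theorem bestBy_eq (le : α → α → Bool) (l : List α) :
    bestBy le l = [] ∨ ∃ x ∈ l, bestBy le l = [x] := by
  refine List.foldlRecOn (motive := fun b => b = [] ∨ ∃ x ∈ l, b = [x]) l _ (.inl rfl) ?_
  rintro b (rfl | ⟨y, hy, rfl⟩) x hx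
  · exact .inr ⟨x, hx, rfl⟩
  · simp only [listCase]
    cases le y x
    · exact .inr ⟨x, hx, rfl⟩
    · exact .inr ⟨y, hy, rfl⟩

@[fun_prop] theorem PolyFun.bestBy {f : γ → List α} {le : γ → α → α → Bool} (hf : PolyFun f)
    (hk : PolyFun fun p : γ × α × α => le p.1 p.2.1 p.2.2) :
    PolyFun (fun a => bestBy (le a) (f a)) := by
  have hf' := hf
  obtain ⟨_, P, hP⟩ := hf
  refine .foldl hf' (by fun_prop) (.listCase (by fun_prop) (by fun_prop)
    (.cond ?_ (by fun_prop) (by fun_prop))) ⟨P + 2, fun g l' hl' => ?_⟩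
  · exact hk.comp (f := fun p : (γ × List α × α) × α × List α => (p.1.1, p.2.1, p.1.2.2))
      (by fun_prop)
  · obtain ⟨-, -, -, h⟩ := hP g
    have h1 := esize_le_of_prefix hl'
    rcases bestBy_eq (le g) l' with h2 | ⟨x, hx, h2⟩ <;>
      rw [OutlierClustering.bestBy] at h2 <;> rw [h2]
    · simp
    · have := esize_le_of_mem hx
      simp; omega

/-- An element with the least key, as a list with at most one element. -/
def argmin (key : α → ℤ) (l : List α) : List α := bestBy (fun x y => ile (key x) (key y)) l

omit [Enc α] in
theorem argmin_spec (key : α → ℤ) (l : List α) :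
    (l = [] ∧ argmin key l = []) ∨
      ∃ x ∈ l, argmin key l = [x] ∧ ∀ y ∈ l, key x ≤ key y := by
  simpa [argmin] using bestBy_spec (le := fun x y => ile (key x) (key y))
    (fun x y => by simpa using le_total _ _) (fun x y z => by simpa using le_trans) l

@[fun_prop] theorem PolyFun.argmin {f : γ → List α} {key : γ → α → ℤ} (hf : PolyFun f)
    (hk : PolyFun fun p : γ × α => key p.1 p.2) :
    PolyFun (fun a => argmin (key a) (f a)) := by
  refine .bestBy hf (polyFun_ile.comp (.pair
    (hk.comp (f := fun p : γ × α × α => (p.1, p.2.1)) (by fun_prop))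
    (hk.comp (f := fun p : γ × α × α => (p.1, p.2.2)) (by fun_prop))))

end OutlierClustering

end

noncomputable section

namespace OutlierClustering

open Enc (enc)

variable {α β γ δ ε : Type} [Enc α] [Enc β] [Enc γ] [Enc δ] [Enc ε]

/-! ### The algorithm -/

/-- The input `n, k, m, z`, distance matrix, flags of clients and locations, constraint data. -/
abbrev Input (ε : Type) : Type :=
  ℤ × ℤ × ℤ × ℝ × List (List ℝ) × List Bool × List Bool × ε × Unit

namespace Input

/-- The number of points. -/
def nn (a : Input ε) : ℤ := a.1
/-- The number of outliers. -/
def mm (a : Input ε) : ℤ := a.2.2.1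
/-- The distance matrix. -/
def mat (a : Input ε) : List (List ℝ) := a.2.2.2.2.1
/-- The constraint data. -/
def dat (a : Input ε) : ε := a.2.2.2.2.2.2.2.1

end Input

/-- The positions of the set flags. -/
def members (l : List Bool) : List ℤ := ((enum l).filter fun p => p.2).map fun p => p.1

namespace Input

/-- The names of the clients. -/
def cli (a : Input ε) : List ℤ := members a.2.2.2.2.2.1
/-- The names of the locations. -/
def loc (a : Input ε) : List ℤ := members a.2.2.2.2.2.2.1
/-- The names of the points. -/
def pts (a : Input ε) : List ℤ := (enum a.mat).map fun p => p.1

end Input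

/-- Are `x` and `y` at distance at most `r`? -/
def near (mat : List (List ℝ)) (x y : ℤ) (r : ℝ) : Bool :=
  (enum mat).any fun p => ieq p.1 x && (enum p.2).any fun q => ieq q.1 y && rle q.2 r

/-- The powers of two up to `n`, obtained in `l.length` steps. -/
def powers (n : ℤ) (l : List α) : List ℤ :=
  (l.foldl (fun (b : ℤ × List ℤ) _ => bif ile b.1 n then (b.1 + b.1, b.1 :: b.2) else b)
    (1, [])).2

/-- One step of the greedy cover: the state holds uncovered clients and chosen locations. -/
def greedyStep (mat : List (List ℝ)) (locs : List ℤ) (r : ℝ) (s : List ℤ × List ℤ) :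
    List ℤ × List ℤ :=
  listCase (argmin (fun g => 0 - len (s.1.filter fun x => near mat x g r)) locs) s
    fun g _ => (s.1.filter fun x => !near mat x g r, g :: s.2)

/-- The state of the greedy cover after as many steps as the list `fuel` is long. -/
def greedy (mat : List (List ℝ)) (clis locs : List ℤ) (r : ℝ) (fuel : List ℤ) :
    List ℤ × List ℤ :=
  fuel.foldl (fun s _ => greedyStep mat locs r s) (clis, [])

/-- The candidate locations for the radius `r`, if the greedy cover succeeds. -/
def candidates (a : Input ε) (ks : List ℤ) (r : ℝ) : List (List ℤ) :=
  (fun s : List ℤ × List ℤ =>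
    bif ile (len s.1) a.mm then
      [s.2 ++ s.1.flatMap fun x =>
        listCase (a.loc.filter fun y => near a.mat x y r) [] fun y _ => [y]]
    else [])
  (greedy a.mat a.cli a.loc r ((powers a.nn a.mat).flatMap fun _ => ks))

/-- The lists of candidate locations for all radii, each with an empty tuple. -/
def guesses (a : Input ε) (ks : List ℤ) : List (List ℤ × List ℤ) :=
  a.mat.flatMap fun row => row.flatMap fun r => (candidates a ks r).map fun G => (G, [])

/-- Extends every tuple by every candidate location. -/
def tupleStep (T : List (List ℤ × List ℤ)) : List (List ℤ × List ℤ) :=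
  T.flatMap fun p => p.1.map fun g => (p.1, g :: p.2)

/-- All outcomes of a test on the tuples and radii. -/
def outcomes (test : Input ε × List ℤ → List ℤ → ℝ → List Data) (a : Input ε × List ℤ)
    (T : List (List ℤ × List ℤ)) : List (ℝ × Data) :=
  T.flatMap fun p => a.1.mat.flatMap fun row => row.flatMap fun r =>
    (test a p.2 r).map fun o => (r, o)

/-- The outcome with the least radius, `nil` if there is none. -/
def bestOutcome (test : Input ε × List ℤ → List ℤ → ℝ → List Data) (a : Input ε × List ℤ)
    (T : List (List ℤ × List ℤ)) : Data :=
  listCase (bestBy (fun x y => rle x.1 y.1) (outcomes test a T)) Data.nil fun p _ => p.2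

/-- One bid of the auction. The state holds the unmatched left nodes, each with its name and the
names of its neighbours, and for every right node its name, its price and its owner. -/
def bid (N : ℤ) (s : List (ℤ × List ℤ) × List (ℤ × ℤ × List (ℤ × List ℤ))) :
    List (ℤ × List ℤ) × List (ℤ × ℤ × List (ℤ × List ℤ)) :=
  listCase s.1 s fun x rest =>
    listCase (argmin (fun e => e.2.1)
      (s.2.filter fun e => ilt e.2.1 N && x.2.any fun i => ieq i e.1)) s
    fun e _ => (e.2.2 ++ rest,
      s.2.map fun e' => bif ieq e'.1 e.1 then (e.1, e.2.1 + 1, [x]) else e')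

/-- The final state of the auction. -/
def auctionState (lefts : List (ℤ × List ℤ)) (ids : List ℤ) :
    List (ℤ × List ℤ) × List (ℤ × ℤ × List (ℤ × List ℤ)) :=
  ((0 :: ids).flatMap fun _ => 0 :: 0 :: ids).foldl (fun s _ => bid (len ids + 1) s)
    (lefts, ids.map fun i => (i, 0, []))

/-- A matching of all left nodes, if there is one, as a list of pairs. -/
def auction (lefts : List (ℤ × List ℤ)) (ids : List ℤ) : List (List (ℤ × ℤ)) :=
  (fun s : List (ℤ × List ℤ) × List (ℤ × ℤ × List (ℤ × List ℤ)) =>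
    listCase s.1 [s.2.flatMap fun e => e.2.2.map fun x => (x.1, e.1)] fun _ _ => [])
  (auctionState lefts ids)

/-- The test for the fault-tolerant problem. -/
def ftTest (a : Input (List ℤ) × List ℤ) (F : List ℤ) (r : ℝ) : List Data :=
  (fun Z : List ℤ => bif ile (len Z) a.1.mm then
      [toData (F, a.1.pts.map fun x => Z.any fun y => ieq y x)] else [])
  (a.1.cli.filter fun x => ilt (len (F.filter fun f => near a.1.mat x f r)) (nthD 0 a.1.dat x))

/-- A slot of a cluster: cluster, color, lower and upper bound, and position in the cluster. -/
abbrev Slot : Type := (ℤ × ℤ × ℤ × ℤ) × ℤ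

/-- The numbered slots. Those of the cluster `-1` are for the outliers. -/
def slots (a : Input ε) (demands : List (ℤ × ℤ × ℤ × ℤ)) : List (ℤ × Slot) :=
  -- The positions run through `0, …, n`. One position more than there are points makes a lower
  -- bound above `n` unsatisfiable for the matching too, although the slots stop at `n`.
  enum (((-1, 0, 0, a.mm) :: demands).flatMap fun q => (a.pts ++ [a.nn]).map fun t => (q, t))

/-- May the client `x` take the slot `s`? -/
def fits (mat : List (List ℝ)) (colors F : List ℤ) (r : ℝ) (x : ℤ) (s : Slot) : Bool :=
  ilt s.2 s.1.2.2.2 && (ilt s.1.1 0 ||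
    (ieq (nthD 0 colors x) s.1.2.1 && near mat x (nthD (-1) F s.1.1) r))

/-- The left nodes: the clients, and dummies for the slots above the lower bounds. -/
def lefts (mat : List (List ℝ)) (colors F : List ℤ) (r : ℝ) (clis : List ℤ)
    (sl : List (ℤ × Slot)) : List (ℤ × List ℤ) :=
  (clis.map fun x => (x, (sl.filter fun s => fits mat colors F r x s.2).map fun s => s.1)) ++
  (clis.foldl (fun l _ => listCase l [] fun _ l' => l') sl).map fun s =>
    (-1 - s.1, (sl.filter fun s => ile s.2.1.2.2.1 s.2.2).map fun s => s.1)

/-- The label of a point given a matching of the clients to the slots. -/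
def label (sl : List (ℤ × Slot)) (M : List (ℤ × ℤ)) (x : ℤ) : Data :=
  (fun i : ℤ => bif ile 0 i then toData i else Data.nil)
  (nthD (-1) (sl.map fun s => s.2.1.1) (assocD (-1) M x))

/-- The test for clustering problems with bounds on the numbers of clients of the colors. -/
def boundsTest (prep : Input ε × List ℤ → List ℤ × List (ℤ × ℤ × ℤ × ℤ)) (a : Input ε × List ℤ)
    (F : List ℤ) (r : ℝ) : List Data :=
  (fun q : List ℤ × List (ℤ × Slot) =>
    (auction (lefts a.1.mat q.1 F r a.1.cli q.2) (q.2.map fun s => s.1)).map fun M =>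
      toData (F, a.1.pts.map fun x => label q.2 M x))
  ((prep a).1, slots a.1 (prep a).2)

/-! ### The algorithm runs in polynomial time, but for the enumeration of the tuples -/

@[fun_prop] theorem PolyFun.nn {f : γ → Input ε} (hf : PolyFun f) : PolyFun fun a => (f a).nn := by
  unfold Input.nn; fun_prop
@[fun_prop] theorem PolyFun.mm {f : γ → Input ε} (hf : PolyFun f) : PolyFun fun a => (f a).mm := by
  unfold Input.mm; fun_prop
@[fun_prop] theorem PolyFun.mat {f : γ → Input ε} (hf : PolyFun f) :
    PolyFun fun a => (f a).mat := by
  unfold Input.mat; fun_prop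
@[fun_prop] theorem PolyFun.dat {f : γ → Input ε} (hf : PolyFun f) :
    PolyFun fun a => (f a).dat := by
  unfold Input.dat; fun_prop
@[fun_prop] theorem polyFun_members : PolyFun members := by
  unfold members; fun_prop
@[fun_prop] theorem PolyFun.cli {f : γ → Input ε} (hf : PolyFun f) :
    PolyFun fun a => (f a).cli := by
  unfold Input.cli; fun_prop
@[fun_prop] theorem PolyFun.loc {f : γ → Input ε} (hf : PolyFun f) :
    PolyFun fun a => (f a).loc := by
  unfold Input.loc; fun_prop
@[fun_prop] theorem PolyFun.pts {f : γ → Input ε} (hf : PolyFun f) :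
    PolyFun fun a => (f a).pts := by
  unfold Input.pts; fun_prop

@[fun_prop] theorem PolyFun.near {mat : γ → List (List ℝ)} {x y : γ → ℤ} {r : γ → ℝ}
    (hm : PolyFun mat) (hx : PolyFun x) (hy : PolyFun y) (hr : PolyFun r) :
    PolyFun fun a => near (mat a) (x a) (y a) (r a) := by
  unfold OutlierClustering.near; fun_prop

-- An integer has size one whatever its magnitude, so only the number of listed powers matters.
@[fun_prop] theorem PolyFun.powers {n : γ → ℤ} {l : γ → List α} (hn : PolyFun n)
    (hl : PolyFun l) : PolyFun fun a => powers (n a) (l a) := by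
  have hl' := hl
  obtain ⟨_, P, hP⟩ := hl'
  refine .snd (.foldl hl (by fun_prop) (by fun_prop) ⟨2 * P + 3, fun g l' h => ?_⟩)
  obtain ⟨-, -, -, h1⟩ := hP g
  have h2 := (h.length_le).trans_lt (length_lt_esize (l g))
  have : ∀ (l' : List α) (b : ℤ × List ℤ), (l'.foldl (fun (b : ℤ × List ℤ) _ =>
      bif ile b.1 (n g) then (b.1 + b.1, b.1 :: b.2) else b) b).2.length ≤
      l'.length + b.2.length := by
    intro l'
    induction l' with
    | nil => simp
    | cons x l' ih =>
      intro b
      simp only [List.foldl_cons]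
      refine (ih _).trans ?_
      cases ile b.1 (n g) <;> simp; omega
  have := this l' (1, [])
  simp at this ⊢
  omega

@[fun_prop] theorem PolyFun.greedyStep {mat : γ → List (List ℝ)} {locs : γ → List ℤ} {r : γ → ℝ}
    {s : γ → List ℤ × List ℤ} (hm : PolyFun mat) (hl : PolyFun locs) (hr : PolyFun r)
    (hs : PolyFun s) : PolyFun fun a => greedyStep (mat a) (locs a) (r a) (s a) := by
  unfold OutlierClustering.greedyStep; fun_prop

theorem greedyStep_length_le (mat : List (List ℝ)) (locs : List ℤ) (r : ℝ) (s : List ℤ × List ℤ) :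
    (greedyStep mat locs r s).1.length ≤ s.1.length ∧
      (greedyStep mat locs r s).2.length ≤ s.2.length + 1 := by
  unfold greedyStep listCase
  split
  · simp
  · simp [List.length_filter_le]

theorem greedy_length_le (mat : List (List ℝ)) (clis locs : List ℤ) (r : ℝ) (fuel : List ℤ) :
    (greedy mat clis locs r fuel).1.length ≤ clis.length ∧
      (greedy mat clis locs r fuel).2.length ≤ fuel.length := by
  unfold greedy
  induction fuel using List.reverseRecOn with
  | nil => simp
  | append_singleton l x ih =>
    simp only [List.foldl_append, List.foldl_cons, List.foldl_nil, List.length_append,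
      List.length_singleton]
    have := greedyStep_length_le mat locs r
      (l.foldl (fun s _ => greedyStep mat locs r s) (clis, []))
    omega

@[fun_prop] theorem PolyFun.greedy {mat : γ → List (List ℝ)} {clis locs : γ → List ℤ} {r : γ → ℝ}
    {fuel : γ → List ℤ} (hm : PolyFun mat) (hc : PolyFun clis) (hl : PolyFun locs)
    (hr : PolyFun r) (hf : PolyFun fuel) :
    PolyFun fun a => greedy (mat a) (clis a) (locs a) (r a) (fuel a) := by
  have hf' := hf
  have hc' := hc
  obtain ⟨_, P, hP⟩ := hf'
  obtain ⟨_, Q, hQ⟩ := hc'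
  refine .foldl hf (by fun_prop) (by fun_prop) ⟨2 * P + 2 * Q + 3, fun g l' h => ?_⟩
  obtain ⟨-, -, -, h1⟩ := hP g
  obtain ⟨-, -, -, h2⟩ := hQ g
  have h3 := greedy_length_le (mat g) (clis g) (locs g) (r g) l'
  have h4 := h.length_le
  unfold OutlierClustering.greedy at h3
  simp at *
  omega

@[fun_prop] theorem PolyFun.candidates {a : γ → Input ε} {ks : γ → List ℤ} {r : γ → ℝ}
    (ha : PolyFun a) (hk : PolyFun ks) (hr : PolyFun r) :
    PolyFun fun x => candidates (a x) (ks x) (r x) := by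
  have : PolyFun fun p : γ × List ℤ × List ℤ =>
    bif ile (len p.2.1) (a p.1).mm then
      [p.2.2 ++ p.2.1.flatMap fun x =>
        OutlierClustering.listCase ((a p.1).loc.filter fun y => OutlierClustering.near (a p.1).mat x y (r p.1)) []
          fun y _ => [y]]
    else [] := by fun_prop
  exact this.comp (f := fun x => (x, OutlierClustering.greedy (a x).mat (a x).cli (a x).loc (r x)
    ((OutlierClustering.powers (a x).nn (a x).mat).flatMap fun _ => ks x))) (by fun_prop)

@[fun_prop] theorem PolyFun.guesses {a : γ → Input ε} {ks : γ → List ℤ}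
    (ha : PolyFun a) (hk : PolyFun ks) : PolyFun fun x => guesses (a x) (ks x) := by
  unfold OutlierClustering.guesses; fun_prop

@[fun_prop] theorem polyFun_tupleStep : PolyFun tupleStep := by
  unfold tupleStep; fun_prop

theorem PolyFun.bestOutcome {test : Input ε × List ℤ → List ℤ → ℝ → List Data}
    (ht : PolyFun fun p : (Input ε × List ℤ) × List ℤ × ℝ => test p.1 p.2.1 p.2.2) :
    PolyFun fun p : (Input ε × List ℤ) × List (List ℤ × List ℤ) => bestOutcome test p.1 p.2 := by
  have : PolyFun fun p : (Input ε × List ℤ) × List (List ℤ × List ℤ) => outcomes test p.1 p.2 := by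
    unfold outcomes
    refine .flatMap (by fun_prop) (.flatMap (by fun_prop) (.flatMap (by fun_prop)
      (.map ?_ (by fun_prop))))
    exact ht.comp (f := fun p : ((((Input ε × List ℤ) × List (List ℤ × List ℤ)) ×
      (List ℤ × List ℤ)) × List ℝ) × ℝ => (p.1.1.1.1, p.1.1.2.2, p.2)) (by fun_prop)
  unfold OutlierClustering.bestOutcome
  fun_prop

@[fun_prop] theorem PolyFun.bid {N : γ → ℤ}
    {s : γ → List (ℤ × List ℤ) × List (ℤ × ℤ × List (ℤ × List ℤ))}
    (hN : PolyFun N) (hs : PolyFun s) : PolyFun fun a => bid (N a) (s a) := by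
  unfold OutlierClustering.bid; fun_prop

/-- This controls the size of the auction state: nodes only move between the queue and the owner
lists, and an evicted owner takes the place of the bidder in the queue. -/
theorem bid_mem {N : ℤ} {A : List (ℤ × List ℤ)} {m n : ℕ}
    {s : List (ℤ × List ℤ) × List (ℤ × ℤ × List (ℤ × List ℤ))}
    (h : s.1.length ≤ m ∧ (∀ x ∈ s.1, x ∈ A) ∧ s.2.length = n ∧
      ∀ e ∈ s.2, e.2.2.length ≤ 1 ∧ ∀ x ∈ e.2.2, x ∈ A) :
    (bid N s).1.length ≤ m ∧ (∀ x ∈ (bid N s).1, x ∈ A) ∧ (bid N s).2.length = n ∧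
      ∀ e ∈ (bid N s).2, e.2.2.length ≤ 1 ∧ ∀ x ∈ e.2.2, x ∈ A := by
  obtain ⟨U, T⟩ := s
  cases U with
  | nil => exact h
  | cons x U =>
    have hargmin := argmin_spec (fun e : ℤ × ℤ × List (ℤ × List ℤ) => e.2.1)
      (T.filter fun e => ilt e.2.1 N && x.2.any fun i => ieq i e.1)
    unfold bid
    simp only [listCase] at *
    rcases hargmin with ⟨-, h1⟩ | ⟨e, he, h1, -⟩ <;> rw [h1]
    · exact h
    · obtain ⟨h2, h3, h4, h5⟩ := h
      have heT := (List.mem_filter.1 he).1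
      simp only [List.length_append, List.mem_append, List.length_map, List.mem_map] at *
      refine ⟨?_, ?_, h4, ?_⟩
      · have := (h5 e heT).1
        simp at h2; omega
      · rintro y (hy | hy)
        · exact (h5 e heT).2 y hy
        · exact h3 y (by simp [hy])
      · rintro _ ⟨e', he', rfl⟩
        cases ieq e'.1 e.1
        · exact h5 e' he'
        · simpa using h3 x (by simp)

@[fun_prop] theorem PolyFun.auctionState {A : γ → List (ℤ × List ℤ)} {ids : γ → List ℤ}
    (hA : PolyFun A) (hi : PolyFun ids) : PolyFun fun a => auctionState (A a) (ids a) := by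
  have hA' := hA
  have hi' := hi
  obtain ⟨_, P, hP⟩ := hA'
  obtain ⟨_, Q, hQ⟩ := hi'
  refine .foldl (by fun_prop) (by fun_prop) (by fun_prop)
    ⟨(P * (P + 1) + 1) + (Q * (2 * P + 10) + 1) + 1, fun g l' _ => ?_⟩
  obtain ⟨-, -, -, h1⟩ := hP g
  obtain ⟨-, -, -, h2⟩ := hQ g
  obtain ⟨k1, k2, k3, k4⟩ := List.foldlRecOn
    (motive := fun s : List (ℤ × List ℤ) × List (ℤ × ℤ × List (ℤ × List ℤ)) =>
      s.1.length ≤ (A g).length ∧ (∀ x ∈ s.1, x ∈ A g) ∧ s.2.length = (ids g).length ∧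
      ∀ e ∈ s.2, e.2.2.length ≤ 1 ∧ ∀ x ∈ e.2.2, x ∈ A g) l'
    (fun s _ => OutlierClustering.bid (len (ids g) + 1) s)
    (b := (A g, (ids g).map fun i => (i, 0, [])))
    ⟨le_rfl, fun x hx => hx, by simp, by simp⟩ fun s hs _ _ => bid_mem hs
  set s := l'.foldl (fun s _ => OutlierClustering.bid (len (ids g) + 1) s)
    (A g, (ids g).map fun i => (i, 0, [])) with hs
  have e1 := esize_le_mul s.1 (P.eval (esize g)) fun x hx =>
    (esize_le_of_mem (k2 x hx)).le.trans h1
  have e2 := esize_le_mul s.2 (2 * P.eval (esize g) + 9) fun x hx => by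
    obtain ⟨i, p, o⟩ := x
    have hb := esize_le_mul o (P.eval (esize g)) fun y hy =>
      (esize_le_of_mem ((k4 _ hx).2 y hy)).le.trans h1
    have ho : o.length ≤ 1 := (k4 _ hx).1
    have := Nat.mul_le_mul_right (P.eval (esize g) + 1) ho
    simp only [esize_prod, esize_int]
    omega
  have l1 := length_lt_esize (A g)
  have l2 := length_lt_esize (ids g)
  have f1 : s.1.length * (P.eval (esize g) + 1) ≤ P.eval (esize g) * (P.eval (esize g) + 1) :=
    Nat.mul_le_mul_right _ (by omega)
  have f2 : s.2.length * (2 * P.eval (esize g) + 9 + 1) ≤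
      Q.eval (esize g) * (2 * P.eval (esize g) + 10) :=
    Nat.mul_le_mul_right _ (by omega)
  simp only [esize_prod, Polynomial.eval_add, Polynomial.eval_mul, Polynomial.eval_one,
    Polynomial.eval_ofNat]
  omega

@[fun_prop] theorem PolyFun.auction {A : γ → List (ℤ × List ℤ)} {ids : γ → List ℤ}
    (hA : PolyFun A) (hi : PolyFun ids) : PolyFun fun a => auction (A a) (ids a) := by
  unfold OutlierClustering.auction
  refine (show PolyFun fun s : List (ℤ × List ℤ) × List (ℤ × ℤ × List (ℤ × List ℤ)) =>
    OutlierClustering.listCase s.1 [s.2.flatMap fun e => e.2.2.map fun x => (x.1, e.1)]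
      fun _ _ => [] from by fun_prop).comp (by fun_prop)

theorem polyFun_ftTest : PolyFun fun p : (Input (List ℤ) × List ℤ) × List ℤ × ℝ =>
    ftTest p.1 p.2.1 p.2.2 := by
  have : PolyFun fun p : ((Input (List ℤ) × List ℤ) × List ℤ × ℝ) × List ℤ =>
      bif ile (len p.2) p.1.1.1.mm then
      [toData (p.1.2.1, p.1.1.1.pts.map fun x => p.2.any fun y => ieq y x)] else [] := by
    fun_prop
  exact this.comp (PolyFun.id.pair (by fun_prop))

@[fun_prop] theorem PolyFun.slots {a : γ → Input ε} {q : γ → List (ℤ × ℤ × ℤ × ℤ)}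
    (ha : PolyFun a) (hq : PolyFun q) : PolyFun fun x => slots (a x) (q x) := by
  unfold OutlierClustering.slots; fun_prop

@[fun_prop] theorem PolyFun.fits {mat : γ → List (List ℝ)} {colors F : γ → List ℤ} {r : γ → ℝ}
    {x : γ → ℤ} {s : γ → Slot} (hm : PolyFun mat) (hc : PolyFun colors) (hF : PolyFun F)
    (hr : PolyFun r) (hx : PolyFun x) (hs : PolyFun s) :
    PolyFun fun a => fits (mat a) (colors a) (F a) (r a) (x a) (s a) := by
  unfold OutlierClustering.fits; fun_prop

-- Used with the clients for `k` and the slots for `l`: what remains has as many elements as dummies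
-- are needed to fill all slots.
omit [Enc α] [Enc β] in
theorem foldl_tail (k : List β) (l : List α) :
    k.foldl (fun l _ => listCase l [] fun _ l' => l') l = l.drop k.length := by
  induction k generalizing l with
  | nil => simp
  | cons x k ih =>
    rw [List.foldl_cons, ih]
    cases l <;> simp [listCase]

@[fun_prop] theorem PolyFun.lefts {mat : γ → List (List ℝ)} {colors F : γ → List ℤ} {r : γ → ℝ}
    {clis : γ → List ℤ} {sl : γ → List (ℤ × Slot)} (hm : PolyFun mat) (hc : PolyFun colors)
    (hF : PolyFun F) (hr : PolyFun r) (hx : PolyFun clis) (hs : PolyFun sl) :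
    PolyFun fun a => lefts (mat a) (colors a) (F a) (r a) (clis a) (sl a) := by
  have : PolyFun fun a =>
      (clis a).foldl (fun l _ => OutlierClustering.listCase l [] fun _ l' => l') (sl a) := by
    have hs' := hs
    obtain ⟨_, P, hP⟩ := hs'
    refine .foldl hx hs (by fun_prop) ⟨P, fun g l' _ => ?_⟩
    obtain ⟨-, -, -, h⟩ := hP g
    rw [foldl_tail]
    exact (esize_le_of_sublist (List.drop_sublist _ _)).trans h
  unfold OutlierClustering.lefts; fun_prop

@[fun_prop] theorem PolyFun.label {sl : γ → List (ℤ × Slot)} {M : γ → List (ℤ × ℤ)} {x : γ → ℤ}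
    (hs : PolyFun sl) (hM : PolyFun M) (hx : PolyFun x) :
    PolyFun fun a => label (sl a) (M a) (x a) := by
  unfold OutlierClustering.label
  exact (show PolyFun fun i : ℤ => bif ile 0 i then OutlierClustering.toData i else Data.nil from by
    fun_prop).comp (by fun_prop)

theorem PolyFun.boundsTest {prep : Input ε × List ℤ → List ℤ × List (ℤ × ℤ × ℤ × ℤ)}
    (hp : PolyFun prep) : PolyFun fun p : (Input ε × List ℤ) × List ℤ × ℝ =>
      boundsTest prep p.1 p.2.1 p.2.2 := by
  have : PolyFun fun p : ((Input ε × List ℤ) × List ℤ × ℝ) × List ℤ × List (ℤ × Slot) =>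
    (OutlierClustering.auction (OutlierClustering.lefts p.1.1.1.mat p.2.1 p.1.2.1 p.1.2.2
        p.1.1.1.cli p.2.2) (p.2.2.map fun s => s.1)).map fun M =>
      OutlierClustering.toData (p.1.2.1, p.1.1.1.pts.map fun x =>
        OutlierClustering.label p.2.2 M x) := by
    fun_prop
  exact this.comp (PolyFun.id.pair (by fun_prop))

end OutlierClustering

end

noncomputable section

namespace OutlierClustering

/-! ### Correctness of the auction -/

/-- What every bid of the auction preserves. -/
structure AuctionInv (A : List (ℤ × List ℤ)) (ids : List ℤ) (N : ℤ)
    (s : List (ℤ × List ℤ) × List (ℤ × ℤ × List (ℤ × List ℤ))) : Prop where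
  perm : (s.1 ++ s.2.flatMap fun e => e.2.2).Perm A
  ids_eq : s.2.map (fun e => e.1) = ids
  zero : ∀ e ∈ s.2, e.2.2 = [] → e.2.1 = 0
  one : ∀ e ∈ s.2, e.2.2.length ≤ 1
  nonneg : ∀ e ∈ s.2, 0 ≤ e.2.1
  le : ∀ e ∈ s.2, e.2.1 ≤ N
  slack : ∀ e ∈ s.2, ∀ x ∈ e.2.2, e.1 ∈ x.2 ∧ ∀ e' ∈ s.2, e'.1 ∈ x.2 → e.2.1 ≤ e'.2.1 + 1

/-- A bid either finds no slot or takes the slot of an entry `e`. -/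
theorem bid_cases {A : List (ℤ × List ℤ)} {ids : List ℤ} {N : ℤ} (hi : ids.Nodup)
    {s : List (ℤ × List ℤ) × List (ℤ × ℤ × List (ℤ × List ℤ))} (h : AuctionInv A ids N s) :
    (bid N s = s ∧ ∀ x ∈ s.1.head?, ∀ e ∈ s.2, e.1 ∈ x.2 → N ≤ e.2.1) ∨
    ∃ x rest T₁ e T₂, s = (x :: rest, T₁ ++ e :: T₂) ∧
      bid N s = (e.2.2 ++ rest, T₁ ++ (e.1, e.2.1 + 1, [x]) :: T₂) ∧ e.2.1 < N ∧ e.1 ∈ x.2 ∧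
      ∀ e' ∈ s.2, e'.1 ∈ x.2 → e.2.1 ≤ e'.2.1 := by
  obtain ⟨U, T⟩ := s
  cases U with
  | nil => left; simp [bid, listCase]
  | cons x rest =>
    have hargmin := argmin_spec (fun e : ℤ × ℤ × List (ℤ × List ℤ) => e.2.1)
      (T.filter fun e => ilt e.2.1 N && x.2.any fun i => ieq i e.1)
    unfold bid
    simp only [listCase]
    rcases hargmin with ⟨h1, h2⟩ | ⟨e, he, h2, h3⟩ <;> rw [h2]
    · left
      refine ⟨rfl, ?_⟩
      simp only [List.head?_cons, Option.mem_def, Option.some.injEq, forall_eq']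
      intro e he hx
      by_contra hN
      have := List.filter_eq_nil_iff.1 h1 e he
      simp at this
      exact this (by omega) hx
    · right
      simp only [List.mem_filter, Bool.and_eq_true, ilt_iff, List.any_eq_true, ieq_iff] at he h3
      obtain ⟨heT, hN, i, hi1, rfl⟩ := he
      obtain ⟨T₁, T₂, rfl⟩ := List.append_of_mem heT
      -- The names are distinct, so the update by name changes the entry `e` only.
      have hnd : ((T₁ ++ e :: T₂).map (fun e => e.1)).Nodup := by rw [h.ids_eq]; exact hi
      simp only [List.map_append, List.map_cons, List.nodup_append, List.nodup_cons,
        List.mem_map, List.mem_cons, forall_exists_index, and_imp, not_exists, not_and] at hnd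
      obtain ⟨-, ⟨hT2, -⟩, hT1⟩ := hnd
      refine ⟨x, rest, T₁, e, T₂, rfl, ?_, hN, hi1, fun e' he' hx => ?_⟩
      · simp only [List.map_append, List.map_cons, show ieq e.1 e.1 = true by simp, cond_true]
        have upd : ∀ T : List (ℤ × ℤ × List (ℤ × List ℤ)), (∀ e' ∈ T, e'.1 ≠ e.1) →
            (T.map fun e' => bif ieq e'.1 e.1 then (e.1, e.2.1 + 1, [x]) else e') = T := by
          intro T hT
          conv_rhs => rw [← List.map_id T]
          refine List.map_congr_left fun e' he' => ?_
          rw [show ieq e'.1 e.1 = false by rw [Bool.eq_false_iff, Ne, ieq_iff]; exact hT e' he']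
          rfl
        rw [upd T₁ fun e' he' => hT1 _ e' he' rfl _ (.inl rfl), upd T₂ hT2]
      · by_cases hp : e'.2.1 < N
        · exact h3 e' ⟨he', hp, _, hx, rfl⟩
        · omega

/-- A price increase only relaxes the slackness conditions of the other owners. The new owner chose
a cheapest neighbour, so after the increase by one its price exceeds no neighbouring price by more
than one. A right node once owned stays owned, hence a price is zero as long as there is no owner.
-/
theorem AuctionInv.bid {A : List (ℤ × List ℤ)} {ids : List ℤ} {N : ℤ} (hi : ids.Nodup)
    {s : List (ℤ × List ℤ) × List (ℤ × ℤ × List (ℤ × List ℤ))} (h : AuctionInv A ids N s) :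
    AuctionInv A ids N (bid N s) ∧ (bid N s = s ∨
      ((OutlierClustering.bid N s).2.map fun e => e.2.1).sum = (s.2.map fun e => e.2.1).sum + 1) := by
  rcases bid_cases hi h with ⟨h1, -⟩ | ⟨x, rest, T₁, e, T₂, rfl, h1, hN, hx, hmin⟩
  · exact ⟨by rwa [h1], .inl h1⟩
  rw [h1]
  refine ⟨⟨?_, ?_, ?_, ?_, ?_, ?_, ?_⟩, .inr ?_⟩
  · refine .trans ?_ h.perm
    rw [List.perm_iff_count]
    intro a
    simp [List.count_cons]
    omega
  · simpa using h.ids_eq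
  · have := h.zero
    simp only [List.mem_append, List.mem_cons] at this ⊢
    rintro f (hf | rfl | hf)
    · exact this f (by tauto)
    · simp
    · exact this f (by tauto)
  · have := h.one
    simp only [List.mem_append, List.mem_cons] at this ⊢
    rintro f (hf | rfl | hf)
    · exact this f (by tauto)
    · simp
    · exact this f (by tauto)
  · have := h.nonneg
    simp only [List.mem_append, List.mem_cons] at this ⊢
    rintro f (hf | rfl | hf)
    · exact this f (by tauto)
    · have := this e (by tauto); simp; omega
    · exact this f (by tauto)
  · have := h.le
    simp only [List.mem_append, List.mem_cons] at this ⊢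
    rintro f (hf | rfl | hf)
    · exact this f (by tauto)
    · simp; omega
    · exact this f (by tauto)
  · have key : ∀ f ∈ T₁ ++ e :: T₂, ∀ y ∈ f.2.2, f.1 ∈ y.2 ∧
        ∀ e' ∈ T₁ ++ (e.1, e.2.1 + 1, [x]) :: T₂, e'.1 ∈ y.2 → f.2.1 ≤ e'.2.1 + 1 := by
      intro f hf y hy
      refine ⟨(h.slack f hf y hy).1, fun e' he' hy' => ?_⟩
      rcases List.mem_append.1 he' with he' | he'
      · exact (h.slack f hf y hy).2 e' (by simp [he']) hy'
      · rcases List.mem_cons.1 he' with rfl | he'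
        · have := (h.slack f hf y hy).2 e (by simp) hy'
          simp; omega
        · exact (h.slack f hf y hy).2 e' (by simp [he']) hy'
    intro f hf
    simp only [List.mem_append, List.mem_cons] at hf
    rcases hf with hf | rfl | hf
    · exact key f (by simp [hf])
    · simp only [List.mem_singleton, forall_eq]
      refine ⟨hx, fun e' he' hy' => ?_⟩
      simp only [List.mem_append, List.mem_cons] at he'
      rcases he' with he' | rfl | he'
      · have := hmin e' (by simp [he']) hy'; omega
      · simp
      · have := hmin e' (by simp [he']) hy'; omega
    · exact key f (by simp [hf])
  · simp; ring

/-- Each effective bid raises the sum of the prices by one. With `N = ids.length + 1` that sum is at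
most `ids.length * (ids.length + 1)`, less than the number `(ids.length + 1) * (ids.length + 2)` of
rounds, so the final state is a fixed point. -/
theorem auctionState_inv {A : List (ℤ × List ℤ)} {ids : List ℤ} (hi : ids.Nodup) :
    AuctionInv A ids (ids.length + 1) (auctionState A ids) ∧
      bid (ids.length + 1) (auctionState A ids) = auctionState A ids := by
  have h0 : AuctionInv A ids (ids.length + 1) (A, ids.map fun i => (i, 0, [])) := by
    refine ⟨?_, ?_, ?_, ?_, ?_, ?_, ?_⟩
    · simp [List.flatMap_eq_nil_iff.2]
    · simp [List.map_map, Function.comp_def]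
    all_goals simp
    intro _ _; omega
  have key : ∀ l : List ℤ,
      AuctionInv A ids (ids.length + 1) (l.foldl (fun s _ => bid (ids.length + 1) s)
        (A, ids.map fun i => (i, 0, []))) ∧
      (bid (ids.length + 1) (l.foldl (fun s _ => bid (ids.length + 1) s)
        (A, ids.map fun i => (i, 0, []))) = (l.foldl (fun s _ => bid (ids.length + 1) s)
        (A, ids.map fun i => (i, 0, []))) ∨
      (l.length : ℤ) ≤ ((l.foldl (fun s _ => bid (ids.length + 1) s)
        (A, ids.map fun i => (i, 0, []))).2.map fun e => e.2.1).sum) := by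
    intro l
    induction l using List.reverseRecOn with
    | nil => exact ⟨h0, .inr (by simp [Function.comp_def])⟩
    | append_singleton l y ih =>
      rw [List.foldl_append, List.foldl_cons, List.foldl_nil]
      obtain ⟨h1, h2⟩ := ih
      obtain ⟨h3, h4⟩ := h1.bid hi
      refine ⟨h3, ?_⟩
      rcases h2 with h2 | h2
      · left; rw [h2, h2]
      · rcases h4 with h4 | h4
        · left; rw [h4, h4]
        · right; rw [h4]; simp; omega
  unfold auctionState
  rw [len_eq]
  obtain ⟨h1, h2⟩ := key ((0 :: ids).flatMap fun _ => 0 :: 0 :: ids)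
  refine ⟨h1, h2.resolve_right fun h3 => ?_⟩
  set s := List.foldl (fun s _ => bid (ids.length + 1) s) (A, ids.map fun i => (i, 0, []))
    ((0 :: ids).flatMap fun _ => 0 :: 0 :: ids)
  have h4 := List.sum_le_card_nsmul (s.2.map fun e => e.2.1) (ids.length + 1) (by
    simp only [List.mem_map, forall_exists_index, and_imp, forall_apply_eq_imp_iff₂]
    exact h1.le)
  have h5 : s.2.length = ids.length := by rw [← h1.ids_eq, List.length_map]
  have h6 : ((0 :: ids).flatMap fun _ => 0 :: 0 :: ids).length =
      (ids.length + 1) * (ids.length + 2) := by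
    simp [List.length_flatMap]; ring
  rw [h6] at h3
  simp only [List.length_map, h5, nsmul_eq_mul] at h4
  push_cast at h3
  nlinarith

/-- An output exists only if the queue is empty. Then the owners are a permutation of `A`, and each
right node has at most one owner. -/
theorem auction_sound {A : List (ℤ × List ℤ)} {ids : List ℤ} (hi : ids.Nodup)
    {M : List (ℤ × ℤ)} (hM : M ∈ auction A ids) :
    (M.map Prod.fst).Perm (A.map Prod.fst) ∧ (M.map Prod.snd).Sublist ids ∧
      ∀ p ∈ M, ∃ x ∈ A, x.1 = p.1 ∧ p.2 ∈ x.2 := by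
  obtain ⟨h, -⟩ := auctionState_inv (A := A) hi
  unfold auction listCase at hM
  beta_reduce at hM
  rcases hs : (auctionState A ids).1 with _ | ⟨x, U⟩
  · rw [hs] at hM
    simp only [List.mem_singleton] at hM
    subst hM
    have hp := h.perm
    rw [hs, List.nil_append] at hp
    refine ⟨?_, ?_, ?_⟩
    · convert hp.map Prod.fst using 1
      simp [List.map_flatMap, Function.comp_def]
    · have : ∀ T : List (ℤ × ℤ × List (ℤ × List ℤ)), (∀ e ∈ T, e.2.2.length ≤ 1) →
          ((T.flatMap fun e => e.2.2.map fun x => (x.1, e.1)).map Prod.snd).Sublist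
            (T.map fun e => e.1) := by
        intro T
        induction T with
        | nil => simp
        | cons e T ih =>
          intro hT
          have h1 := ih fun f hf => hT f (by simp [hf])
          obtain ⟨i, p, o⟩ := e
          have h2 := hT (i, p, o) (by simp)
          rcases o with _ | ⟨y, _ | ⟨z, o⟩⟩
          · simpa using h1.cons i
          · simpa using h1
          · simp at h2
      have h2 := this _ h.one
      rwa [h.ids_eq] at h2
    · intro p hp'
      simp only [List.mem_flatMap, List.mem_map] at hp'
      obtain ⟨e, he, x, hx, rfl⟩ := hp'
      exact ⟨x, hp.subset (List.mem_flatMap.2 ⟨e, he, hx⟩), rfl, (h.slack e he x hx).1⟩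
  · rw [hs] at hM
    simp at hM

/-- A stuck auction with an unmatched node `x` exhibits a Hall violator. The neighbours of `x` all
have the maximal price, and some price `v` below it is not attained. Let `R` be the right nodes
dearer than `v`. By slackness the neighbours of owners of nodes in `R` cost at least `v`, hence more
than `v`. So `x` and the owners of `R`, at least `|R| + 1` left nodes, have all their neighbours in
`R`, which contradicts the injective choice `f`. -/
theorem auction_complete {A : List (ℤ × List ℤ)} {ids : List ℤ} (hA : A.Nodup) (hi : ids.Nodup)
    (f : ℤ × List ℤ → ℤ) (hf : ∀ x ∈ A, f x ∈ ids ∧ f x ∈ x.2)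
    (inj : ∀ x ∈ A, ∀ y ∈ A, f x = f y → x = y) : auction A ids ≠ [] := by
  obtain ⟨h, hfix⟩ := auctionState_inv (A := A) hi
  unfold auction listCase
  rcases hs : auctionState A ids with ⟨_ | ⟨x, U⟩, T⟩
  · simp
  exfalso
  rw [hs] at h hfix
  -- A successful bid would change a price, which is impossible at a fixed point.
  have hstuck : ∀ e ∈ T, e.1 ∈ x.2 → (ids.length : ℤ) + 1 ≤ e.2.1 := by
    rcases bid_cases hi h with ⟨-, h1⟩ | ⟨y, rest, T₁, e, T₂, h0, h1, -⟩
    · simpa using h1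
    · rw [h1, h0] at hfix
      simp at hfix
      have := congrArg (fun e : ℤ × ℤ × List (ℤ × List ℤ) => e.2.1) hfix.2
      simp at this
  have hlen : T.length = ids.length := by rw [← h.ids_eq, List.length_map]
  -- Pigeonhole: there are `ids.length` prices, but `ids.length + 1` values below the maximal price.
  obtain ⟨v, hv1, hv2⟩ : ∃ v ∈ Finset.range (ids.length + 1),
      v ∉ (T.map fun e => e.2.1.toNat).toFinset := by
    refine Finset.exists_mem_notMem_of_card_lt_card ?_
    refine (List.toFinset_card_le _).trans_lt ?_
    simp [hlen]
  have hv : ∀ e ∈ T, e.2.1 ≠ v := by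
    intro e he hev
    refine hv2 ?_
    simp only [List.mem_toFinset, List.mem_map]
    exact ⟨e, he, by simp [hev]⟩
  set R := T.filter fun e => ilt v e.2.1
  have hR : ∀ e ∈ T, (v : ℤ) ≤ e.2.1 → e ∈ R := fun e he hle =>
    List.mem_filter.2 ⟨he, by have := hv e he; simp; omega⟩
  have hnd := h.perm.nodup_iff.2 hA
  have hW : (x :: R.flatMap fun e => e.2.2).Sublist
      ((x :: U) ++ T.flatMap fun e => e.2.2) := by
    refine List.Sublist.cons_cons x ?_
    refine List.Sublist.trans ?_ (List.sublist_append_right _ _)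
    exact (List.filter_sublist).flatMap _
  have hWA : ∀ y ∈ x :: R.flatMap (fun e => e.2.2), y ∈ A := fun y hy =>
    h.perm.subset (hW.subset hy)
  have himg : ((x :: R.flatMap fun e => e.2.2).map f).Nodup :=
    (hnd.sublist hW).map_on fun y hy z hz => inj y (hWA y hy) z (hWA z hz)
  have hsub : (x :: R.flatMap fun e => e.2.2).map f ⊆ R.map fun e => e.1 := by
    intro i hi
    obtain ⟨y, hy, rfl⟩ := List.mem_map.1 hi
    obtain ⟨h1, h2⟩ := hf y (hWA y hy)
    rw [← h.ids_eq] at h1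
    obtain ⟨e', he', h3⟩ := List.mem_map.1 h1
    refine List.mem_map.2 ⟨e', hR e' he' ?_, h3⟩
    rw [← h3] at h2
    rcases List.mem_cons.1 hy with rfl | hy
    · have := hstuck e' he' h2
      simp at hv1; omega
    · obtain ⟨e, he, hye⟩ := List.mem_flatMap.1 hy
      obtain ⟨heT, hev⟩ := List.mem_filter.1 he
      have := (h.slack e heT y hye).2 e' he' h2
      simp at hev; omega
  have hle := (himg.subperm hsub).length_le
  -- Nodes in `R` have positive prices and are therefore owned.
  have hone : ∀ R : List (ℤ × ℤ × List (ℤ × List ℤ)), (∀ e ∈ R, e.2.2 ≠ []) →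
      R.length ≤ (R.flatMap fun e => e.2.2).length := by
    intro R
    induction R with
    | nil => simp
    | cons e R ih =>
      intro hR
      have h1 := ih fun f hf => hR f (by simp [hf])
      have h2 := List.length_pos_iff.2 (hR e (by simp))
      simp at *; omega
  have := hone R fun e he h0 => by
    obtain ⟨heT, hev⟩ := List.mem_filter.1 he
    have := h.zero e heT h0
    simp at hev; omega
  simp at hle this
  omega

end OutlierClustering

end

noncomputable section

namespace OutlierClustering

open Enc (enc)

variable {α ε : Type}

/-! ### Correctness of the greedy cover -/

/-- After `i` steps the state holds `2 ^ j` and `j` powers with `j = min i (log₂ n + 1)`. A list of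
length `n` is long enough because `log₂ n < n`. -/
theorem length_powers {n : ℕ} (hn : 0 < n) {l : List α} (hl : l.length = n) :
    (powers n l).length = Nat.log 2 n + 1 := by
  have key : ∀ l : List α, ∃ j, l.foldl (fun (b : ℤ × List ℤ) _ =>
      bif ile b.1 n then (b.1 + b.1, b.1 :: b.2) else b) (1, []) = (2 ^ j, (l.foldl
        (fun (b : ℤ × List ℤ) _ => bif ile b.1 n then (b.1 + b.1, b.1 :: b.2) else b)
        (1, [])).2) ∧ (l.foldl (fun (b : ℤ × List ℤ) _ =>
          bif ile b.1 n then (b.1 + b.1, b.1 :: b.2) else b) (1, [])).2.length = j ∧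
      j = min l.length (Nat.log 2 n + 1) := by
    intro l
    induction l using List.reverseRecOn with
    | nil => exact ⟨0, by simp⟩
    | append_singleton l x ih =>
      obtain ⟨j, h1, h2, h3⟩ := ih
      rw [List.foldl_append, List.foldl_cons, List.foldl_nil]
      set s := l.foldl (fun (b : ℤ × List ℤ) _ =>
        bif ile b.1 n then (b.1 + b.1, b.1 :: b.2) else b) (1, [])
      have hs : s.1 = 2 ^ j := by rw [h1]
      have hc : ile s.1 n = true ↔ j ≤ Nat.log 2 n := by
        rw [ile_iff, hs, Nat.le_log_iff_pow_le (by norm_num) hn.ne']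
        exact_mod_cast Iff.rfl
      simp only [List.length_append, List.length_singleton]
      cases hb : ile s.1 n with
      | true =>
        refine ⟨j + 1, ?_, ?_, ?_⟩
        · simp [hs, pow_succ]; ring
        · simp [h2]
        · have := hc.1 hb; omega
      | false =>
        refine ⟨j, ?_, ?_, ?_⟩
        · simpa using h1
        · simpa using h2
        · have : ¬ j ≤ Nat.log 2 n := fun h => by rw [hc.2 h] at hb; simp at hb
          omega
  obtain ⟨j, -, h2, h3⟩ := key l
  have := Nat.log_lt_self 2 hn.ne'
  unfold powers
  omega

theorem countP_or_le (p q : α → Bool) (l : List α) :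
    l.countP (fun x => p x || q x) ≤ l.countP p + l.countP q := by
  induction l with
  | nil => simp
  | cons x l ih => simp only [List.countP_cons]; cases p x <;> cases q x <;> simp <;> omega

theorem countP_any_le (p : ℤ → α → Bool) (l : List α) (c : ℕ) (F : List ℤ)
    (h : ∀ g ∈ F, l.countP (p g) ≤ c) :
    l.countP (fun x => F.any fun g => p g x) ≤ F.length * c := by
  induction F with
  | nil => simp
  | cons g F ih =>
    have h1 := ih fun y hy => h y (by simp [hy])
    have h2 := h g (by simp)
    have h3 := countP_or_le (p g) (fun x => F.any fun g => p g x) l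
    simp only [List.any_cons, List.length_cons, Nat.add_mul] at *
    omega

/-- The locations in `F` together cover all but `m` of the remaining clients. By the union bound one
of them covers at least a fraction `1 / F.length` of the excess over `m`, and the greedy choice does
at least as well. The inequality also holds for a negative excess, so no case distinction is needed
later. -/
theorem greedyStep_decrease {mat : List (List ℝ)} {clis locs : List ℤ} {r : ℝ} {F : List ℤ}
    (hF : ∀ g ∈ F, g ∈ locs) (hk : 0 < F.length) {m : ℕ}
    (hm : (clis.filter fun x => !F.any fun g => near mat x g r).length ≤ m)
    {s : List ℤ × List ℤ} (hs : s.1.Sublist clis) :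
    ((greedyStep mat locs r s).1.length - m : ℝ) ≤
      (1 - 1 / (F.length : ℝ)) * (s.1.length - m : ℝ) := by
  unfold greedyStep listCase
  rcases argmin_spec (fun g => 0 - len (s.1.filter fun x => near mat x g r)) locs with
    ⟨h1, -⟩ | ⟨g, hg, h1, h2⟩
  · obtain ⟨g, hg⟩ := List.exists_mem_of_length_pos hk
    exact absurd (hF g hg) (by simp [h1])
  · rw [h1]
    simp only [len_eq] at h2 ⊢
    have h3 : s.1.countP (fun x => F.any fun g => near mat x g r) ≤
        F.length * s.1.countP fun x => near mat x g r := by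
      refine countP_any_le (fun g x => near mat x g r) s.1 _ F fun y hy => ?_
      have := h2 y (hF y hy)
      rw [List.countP_eq_length_filter, List.countP_eq_length_filter]
      omega
    have h4 := s.1.length_eq_countP_add_countP fun x => F.any fun g => near mat x g r
    have h5 := s.1.length_eq_countP_add_countP fun x => near mat x g r
    have h6 : s.1.countP (fun x => !F.any fun g => near mat x g r) ≤ m := by
      refine le_trans ?_ hm
      rw [← List.countP_eq_length_filter]
      exact hs.countP_le
    have h7 : (s.1.filter fun x => !near mat x g r).length =
        s.1.countP fun x => !near mat x g r := (List.countP_eq_length_filter ..).symm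
    rw [h7]
    simp only [Bool.not_eq_true, Bool.decide_eq_false] at h4 h5
    set c := s.1.countP fun x => near mat x g r
    have h8 : (s.1.length : ℝ) - m ≤ F.length * c := by
      have : s.1.length ≤ F.length * c + m := by omega
      have : (s.1.length : ℝ) ≤ F.length * c + m := by exact_mod_cast this
      linarith
    have h9 : (s.1.length : ℝ) = c + s.1.countP fun x => !near mat x g r := by exact_mod_cast h5
    have hk' : (0 : ℝ) < F.length := by exact_mod_cast hk
    have h10 : ((s.1.length : ℝ) - m) / F.length ≤ c := by
      rw [div_le_iff₀ hk']; linarith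
    have : (1 - 1 / (F.length : ℝ)) * (s.1.length - m : ℝ) =
      (s.1.length - m : ℝ) - ((s.1.length : ℝ) - m) / F.length := by ring
    rw [this]
    linarith

theorem greedy_inv (mat : List (List ℝ)) (clis locs : List ℤ) (r : ℝ) (fuel : List ℤ) :
    (greedy mat clis locs r fuel).1.Sublist clis ∧
      (∀ g ∈ (greedy mat clis locs r fuel).2, g ∈ locs) ∧
      ∀ x ∈ clis, x ∈ (greedy mat clis locs r fuel).1 ∨
        ∃ g ∈ (greedy mat clis locs r fuel).2, near mat x g r = true := by
  unfold greedy
  induction fuel using List.reverseRecOn with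
  | nil => simp
  | append_singleton l y ih =>
    rw [List.foldl_append, List.foldl_cons, List.foldl_nil]
    set s := l.foldl (fun s _ => greedyStep mat locs r s) (clis, [])
    obtain ⟨h1, h2, h3⟩ := ih
    unfold greedyStep listCase
    rcases argmin_spec (fun g => 0 - len (s.1.filter fun x => near mat x g r)) locs with
      ⟨-, h4⟩ | ⟨g, hg, h4, -⟩ <;> rw [h4]
    · exact ⟨h1, h2, h3⟩
    · refine ⟨List.filter_sublist.trans h1, by simpa [hg] using h2, fun x hx => ?_⟩
      simp only [List.mem_filter, List.mem_cons, exists_eq_or_imp, Bool.not_eq_true']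
      rcases h3 x hx with h | h
      · cases hn : near mat x g r
        · exact .inl ⟨h, rfl⟩
        · exact .inr (.inl rfl)
      · exact .inr (.inr h)

/-- By `(1 - 1/k)^k ≤ 1/e < 1/2`, each block of `k = F.length` steps halves the bound on the excess.
After `L` blocks the excess is at most `clis.length / 2 ^ L < 1`, and it is an integer. -/
theorem greedy_length_le_of_cover {mat : List (List ℝ)} {clis locs : List ℤ} {r : ℝ} {F : List ℤ}
    (hF : ∀ g ∈ F, g ∈ locs) (hk : 0 < F.length) {m : ℕ}
    (hm : (clis.filter fun x => !F.any fun g => near mat x g r).length ≤ m) {L : ℕ}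
    (hL : clis.length < 2 ^ L) {fuel : List ℤ} (hfuel : fuel.length = L * F.length) :
    (greedy mat clis locs r fuel).1.length ≤ m := by
  have hk' : (1 : ℝ) ≤ F.length := by exact_mod_cast hk
  have h0 : 0 ≤ 1 - 1 / (F.length : ℝ) := by
    rw [sub_nonneg, div_le_one (by linarith)]; exact hk'
  have key : ∀ fuel : List ℤ, ((greedy mat clis locs r fuel).1.length - m : ℝ) ≤
      (1 - 1 / (F.length : ℝ)) ^ fuel.length * clis.length := by
    intro fuel
    induction fuel using List.reverseRecOn with
    | nil => simp [greedy]
    | append_singleton l y ih =>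
      have h1 := greedyStep_decrease hF hk hm (greedy_inv mat clis locs r l).1
      have h2 : greedy mat clis locs r (l ++ [y]) =
          greedyStep mat locs r (greedy mat clis locs r l) := by simp [greedy]
      rw [h2]
      refine h1.trans ?_
      rw [List.length_append, List.length_singleton, pow_succ]
      nlinarith [mul_le_mul_of_nonneg_left ih h0]
  have h1 := key fuel
  have h2 : (1 - 1 / (F.length : ℝ)) ^ fuel.length ≤ (1 / 2) ^ L := by
    rw [hfuel, mul_comm, pow_mul]
    refine pow_le_pow_left₀ (pow_nonneg h0 _) ?_ _
    refine (Real.one_sub_div_pow_le_exp_neg hk').trans ?_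
    have := Real.exp_neg_one_lt_d9
    linarith
  have h3 : (clis.length : ℝ) < 2 ^ L := by exact_mod_cast hL
  have h4 : (1 / 2 : ℝ) ^ L * clis.length < 1 := by
    rw [one_div, inv_pow, inv_mul_lt_iff₀ (by positivity)]; linarith
  have h5 := mul_le_mul_of_nonneg_right h2 (Nat.cast_nonneg (α := ℝ) clis.length)
  have h6 : ((greedy mat clis locs r fuel).1.length : ℝ) < m + 1 := by linarith
  have : (greedy mat clis locs r fuel).1.length < m + 1 := by exact_mod_cast h6
  omega

/-- The number of steps of the greedy cover. -/
theorem length_fuel {n : ℕ} (hn : 0 < n) {l : List α} (hl : l.length = n) (ks : List ℤ) :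
    ((powers n l).flatMap fun _ => ks).length = (Nat.log 2 n + 1) * ks.length := by
  simp [List.length_flatMap, length_powers hn hl]

/-- A step opens a location even if that covers nothing new. This keeps the candidate list nonempty,
which is needed for centers that serve no client. -/
theorem greedy_length_eq {mat : List (List ℝ)} {clis locs : List ℤ} {r : ℝ} (hl : locs ≠ [])
    (fuel : List ℤ) : (greedy mat clis locs r fuel).2.length = fuel.length := by
  unfold greedy
  induction fuel using List.reverseRecOn with
  | nil => simp
  | append_singleton l y ih =>
    rw [List.foldl_append, List.foldl_cons, List.foldl_nil]
    set s := l.foldl (fun s _ => greedyStep mat locs r s) (clis, [])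
    unfold greedyStep listCase
    rcases argmin_spec (fun g => 0 - len (s.1.filter fun x => near mat x g r)) locs with
      ⟨h, -⟩ | ⟨g, hg, h4, -⟩
    · exact absurd h hl
    · rw [h4]; simp [ih]

/-- A client is either covered by a greedy location or left over. In the second case the first
location within `r`, if any, was added for it, at the price of at most `m` further candidates. -/
theorem candidates_spec {a : Input ε} {ks : List ℤ} {r : ℝ} {n m : ℕ} (hn : 0 < n)
    (hnn : a.nn = n) (hmm : a.mm = m) (hmat : a.mat.length = n)
    (hl : a.loc ≠ []) (hk : 0 < ks.length) {G : List ℤ}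
    (hG : G ∈ candidates a ks r) :
    (∀ g ∈ G, g ∈ a.loc) ∧ G ≠ [] ∧ G.length ≤ (Nat.log 2 n + 1) * ks.length + m ∧
      ∀ x ∈ a.cli, ∀ y ∈ a.loc, near a.mat x y r = true → ∃ g ∈ G, near a.mat x g r = true := by
  unfold candidates at hG
  beta_reduce at hG
  set fuel := (powers a.nn a.mat).flatMap fun _ => ks with hfuel
  have hfl : fuel.length = (Nat.log 2 n + 1) * ks.length := by
    rw [hfuel, hnn]; exact length_fuel hn hmat ks
  obtain ⟨-, h2, h3⟩ := greedy_inv a.mat a.cli a.loc r fuel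
  have h4 := greedy_length_eq (mat := a.mat) (clis := a.cli) (r := r) hl fuel
  set s := greedy a.mat a.cli a.loc r fuel
  cases hb : ile (len s.1) a.mm with
  | false => rw [hb, cond_false] at hG; simp at hG
  | true =>
    rw [hb, cond_true, List.mem_singleton] at hG
    rw [ile_iff, len_eq, hmm, Nat.cast_le] at hb
    subst hG
    refine ⟨fun g hg => ?_, ?_, ?_, fun x hx y hy hxy => ?_⟩
    · rcases List.mem_append.1 hg with hg | hg
      · exact h2 g hg
      · obtain ⟨x, -, hg⟩ := List.mem_flatMap.1 hg
        rcases hf : a.loc.filter fun y => near a.mat x y r with _ | ⟨y, l⟩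
        · simp [hf, listCase] at hg
        · simp only [hf, listCase, List.mem_singleton] at hg
          subst hg
          exact (List.mem_filter.1 (hf ▸ List.mem_cons_self : g ∈ a.loc.filter _)).1
    · have : 0 < fuel.length := by rw [hfl]; positivity
      intro h
      have := congrArg List.length (List.append_eq_nil_iff.1 h).1
      rw [h4, List.length_nil] at this
      omega
    · have : ∀ l : List ℤ, (l.flatMap fun x => listCase (a.loc.filter fun y =>
          near a.mat x y r) [] fun y _ => [y]).length ≤ l.length := by
        intro l
        induction l with
        | nil => simp
        | cons x l ih =>
          rw [List.flatMap_cons, List.length_append, List.length_cons]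
          have : (listCase (a.loc.filter fun y => near a.mat x y r) ([] : List ℤ)
              fun y _ => [y]).length ≤ 1 := by
            unfold listCase; split <;> simp
          omega
      have := this s.1
      rw [List.length_append]
      omega
    · rcases h3 x hx with h | ⟨g, hg, h⟩
      · rcases hf : a.loc.filter fun y => near a.mat x y r with _ | ⟨g, l⟩
        · have := List.filter_eq_nil_iff.1 hf y hy
          exact absurd hxy this
        · have hg := List.mem_filter.1 (hf ▸ List.mem_cons_self : g ∈ a.loc.filter _)
          refine ⟨g, List.mem_append.2 (.inr (List.mem_flatMap.2 ⟨x, h, ?_⟩)), hg.2⟩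
          simp [hf, listCase]
      · exact ⟨g, List.mem_append.2 (.inl hg), h⟩

theorem candidates_ne_nil {a : Input ε} {ks : List ℤ} {r : ℝ} {n m : ℕ} (hn : 0 < n)
    (hnn : a.nn = n) (hmm : a.mm = m) (hmat : a.mat.length = n) (hcli : a.cli.length ≤ n)
    {F : List ℤ} (hF : ∀ g ∈ F, g ∈ a.loc) (hk : 0 < F.length) (hks : ks.length = F.length)
    (hm : (a.cli.filter fun x => !F.any fun g => near a.mat x g r).length ≤ m) :
    candidates a ks r ≠ [] := by
  have h := greedy_length_le_of_cover (fuel := (powers a.nn a.mat).flatMap fun _ => ks) hF hk hm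
    (L := Nat.log 2 n + 1)
    (hcli.trans_lt (Nat.lt_pow_succ_log_self (by norm_num) n)) (by
      rw [hnn, length_fuel hn hmat, hks])
  unfold candidates
  beta_reduce
  rw [show ile (len (greedy a.mat a.cli a.loc r ((powers a.nn a.mat).flatMap fun _ => ks)).1)
    a.mm = true by rw [ile_iff, len_eq, hmm]; exact_mod_cast h]
  simp

end OutlierClustering

end

noncomputable section

namespace OutlierClustering

open Enc (enc)

/-! ### The search over tuples and radii -/

/-- The list `ks` serves as a counter only. The form with a general `T` and a suffix `t'` makes the
induction work; it is used with empty suffixes. -/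
theorem mem_tuples (ks : List ℤ) (T : List (List ℤ × List ℤ)) (G t : List ℤ) :
    (G, t) ∈ ks.foldl (fun T _ => tupleStep T) T ↔
      ∃ s t', (G, t') ∈ T ∧ t = s ++ t' ∧ s.length = ks.length ∧ ∀ g ∈ s, g ∈ G := by
  induction ks using List.reverseRecOn generalizing t with
  | nil => simp
  | append_singleton l x ih =>
    rw [List.foldl_append, List.foldl_cons, List.foldl_nil]
    simp only [tupleStep, List.mem_flatMap, List.mem_map, Prod.exists, Prod.mk.injEq,
      List.length_append, List.length_singleton]
    constructor
    · rintro ⟨G', u, h, g, hg, rfl, rfl⟩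
      obtain ⟨s, t', h1, rfl, h2, h3⟩ := (ih u).1 h
      exact ⟨g :: s, t', h1, rfl, by simp [h2], by simpa [hg] using h3⟩
    · rintro ⟨_ | ⟨g, s⟩, t', h1, rfl, h2, h3⟩
      · simp at h2
      · simp at h2 h3
        exact ⟨G, s ++ t', (ih _).2 ⟨s, t', h1, rfl, h2, h3.2⟩, g, h3.1, rfl, rfl⟩

/-- All tuples of the algorithm. -/
def tuples {ε : Type} (a : Input ε) (ks : List ℤ) : List (List ℤ × List ℤ) :=
  ks.foldl (fun T _ => tupleStep T) (guesses a ks)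

theorem mem_members {n : ℕ} {s : Finset (Fin n)} {i : ℤ} :
    i ∈ members (List.ofFn fun x => decide (x ∈ s)) ↔ ∃ x ∈ s, ((x : ℕ) : ℤ) = i := by
  simp only [members, List.mem_map, List.mem_filter, Prod.exists, mem_enum]
  constructor
  · rintro ⟨i, b, ⟨⟨j, rfl, h⟩, rfl⟩, rfl⟩
    obtain ⟨hj, h2⟩ := List.getElem?_eq_some_iff.1 h
    simp only [List.getElem_ofFn, decide_eq_true_eq] at h2
    exact ⟨_, h2, rfl⟩
  · rintro ⟨x, hx, rfl⟩
    refine ⟨x, true, ⟨⟨x, rfl, ?_⟩, rfl⟩, rfl⟩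
    rw [List.getElem?_eq_some_iff]
    exact ⟨by simp, by simpa using hx⟩

theorem nodup_members (l : List Bool) : (members l).Nodup :=
  (map_fst_enum_nodup l).sublist (List.filter_sublist.map _)

/-! ### Instances as inputs, and the approximation factors -/

namespace Inst

variable {X : Type u} [MetricSpace X] (I : Inst X) {ε : Type}

/-- The input as a tuple. -/
def toInput (e : ε) : Input ε :=
  (I.n, I.k, I.m, I.z, List.ofFn fun x => List.ofFn fun y => dist (I.pt x) (I.pt y),
    List.ofFn fun x => decide (x ∈ I.clients), List.ofFn fun x => decide (x ∈ I.locs), e, ())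

theorem enc_toInput [Enc ε] (e : ε) : enc (I.toInput e) = I.input (enc e) := by
  simp only [toInput, input, enc, Data.vec, Data.list, List.map_ofFn, Function.comp_def,
    Data.ofProp, decide_eq_true_eq]

theorem n_pos : 0 < I.n := by
  obtain ⟨x, -⟩ := I.locs_nonempty
  exact x.pos

/-- The name of a point. -/
abbrev name {n : ℕ} (x : Fin n) : ℤ := ((x : ℕ) : ℤ)

theorem near_toInput (e : ε) (x y : Fin I.n) (r : ℝ) :
    near (I.toInput e).mat (name x) (name y) r = true ↔ dist (I.pt x) (I.pt y) ≤ r := by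
  simp only [near, toInput, Input.mat, List.any_eq_true, Bool.and_eq_true, ieq_iff, rle_iff,
    Prod.exists, mem_enum]
  constructor
  · rintro ⟨i, row, ⟨i', rfl, h1⟩, h2, j, d, ⟨j', rfl, h3⟩, h4, h5⟩
    simp only [name, Nat.cast_inj] at h2 h4
    subst h2 h4
    obtain ⟨_, rfl⟩ := List.getElem?_eq_some_iff.1 h1
    obtain ⟨_, rfl⟩ := List.getElem?_eq_some_iff.1 h3
    simpa using h5
  · intro h
    refine ⟨_, _, ⟨x, rfl, List.getElem?_eq_some_iff.2 ⟨by simp, rfl⟩⟩, rfl, _, _,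
      ⟨y, rfl, List.getElem?_eq_some_iff.2 ⟨by simp, rfl⟩⟩, rfl, ?_⟩
    simpa using h

theorem mem_cli (e : ε) {i : ℤ} : i ∈ (I.toInput e).cli ↔ ∃ x ∈ I.clients, name x = i :=
  mem_members

theorem mem_loc (e : ε) {i : ℤ} : i ∈ (I.toInput e).loc ↔ ∃ x ∈ I.locs, name x = i :=
  mem_members

theorem name_injective {n : ℕ} : Function.Injective (name (n := n)) := fun x y h => by
  simpa [name, Fin.ext_iff] using h

theorem nodup_cli (e : ε) : (I.toInput e).cli.Nodup := nodup_members _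

theorem cli_toFinset (e : ε) :
    (I.toInput e).cli.toFinset = I.clients.map ⟨name, name_injective⟩ := by
  ext i
  simp [mem_cli]

/-- Counting clients in the list of their names. -/
theorem length_filter_cli (e : ε) (p : ℤ → Bool) :
    ((I.toInput e).cli.filter p).length = (I.clients.filter fun x => p (name x)).card := by
  rw [← List.toFinset_card_of_nodup ((I.nodup_cli e).filter _), List.toFinset_filter,
    cli_toFinset, Finset.filter_map, Finset.card_map]
  rfl

theorem length_cli (e : ε) : (I.toInput e).cli.length = I.clients.card := by
  simpa using I.length_filter_cli e fun _ => true

theorem length_mat (e : ε) : (I.toInput e).mat.length = I.n := by simp [toInput, Input.mat]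

theorem pts_toInput (e : ε) : (I.toInput e).pts = List.ofFn fun x : Fin I.n => name x := by
  refine List.ext_getElem (by simp [Input.pts, enum, length_mat]) fun i h1 h2 => ?_
  simp [Input.pts, enum]

/-- The names of the centers. -/
def centersList (F : I.Centers) : List ℤ := List.ofFn fun j => name (F j : Fin I.n)

theorem exists_centersList {t : List ℤ} (ht : t.length = I.k) (e : ε)
    (h : ∀ g ∈ t, g ∈ (I.toInput e).loc) : ∃ F : I.Centers, t = I.centersList F := by
  have : ∀ j : Fin I.k, ∃ x : {y : Fin I.n // y ∈ I.locs}, name x.1 = t[(j : ℕ)] := fun j => by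
    obtain ⟨x, hx, h⟩ := (I.mem_loc e).1 (h t[(j : ℕ)] (List.getElem_mem _))
    exact ⟨⟨x, hx⟩, h⟩
  choose F hF using this
  refine ⟨F, List.ext_getElem (by simp [centersList, ht]) fun i h1 h2 => ?_⟩
  simp [centersList, hF]

/-- `x` is within `r` of the `j`-th center. -/
def within (F : I.Centers) (r : ℝ) (x : Fin I.n) (j : Fin I.k) : Prop :=
  dist (I.pt x) (I.pt (F j)) ≤ r

theorem mem_entries (e : ε) {r : ℝ} : (∃ row ∈ (I.toInput e).mat, r ∈ row) ↔
    ∃ x y, dist (I.pt x) (I.pt y) = r := by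
  simp only [toInput, Input.mat, List.mem_ofFn]
  constructor
  · rintro ⟨_, ⟨x, rfl⟩, h⟩
    obtain ⟨y, h⟩ := List.mem_ofFn.1 h
    exact ⟨x, y, h⟩
  · rintro ⟨x, y, rfl⟩
    exact ⟨_, ⟨x, rfl⟩, List.mem_ofFn.2 ⟨y, rfl⟩⟩

/-- Every nonnegative radius can be rounded down to a distance. -/
theorem exists_round {r : ℝ} (hr : 0 ≤ r) : ∃ x y, dist (I.pt x) (I.pt y) ≤ r ∧
    ∀ x' y', dist (I.pt x') (I.pt y') ≤ r → dist (I.pt x') (I.pt y') ≤ dist (I.pt x) (I.pt y) := by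
  have x₀ : Fin I.n := ⟨0, I.n_pos⟩
  obtain ⟨p, hp, hmax⟩ := Finset.exists_max_image
    ((Finset.univ : Finset (Fin I.n × Fin I.n)).filter fun p => dist (I.pt p.1) (I.pt p.2) ≤ r)
    (fun p => dist (I.pt p.1) (I.pt p.2)) ⟨(x₀, x₀), by simpa using hr⟩
  refine ⟨p.1, p.2, (Finset.mem_filter.1 hp).2, fun x' y' h => ?_⟩
  exact hmax (x', y') (by simpa using h)

theorem mem_guesses (e : ε) (ks : List ℤ) {G t : List ℤ} :
    (G, t) ∈ guesses (I.toInput e) ks ↔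
      t = [] ∧ ∃ x y, G ∈ candidates (I.toInput e) ks (dist (I.pt x) (I.pt y)) := by
  simp only [guesses, List.mem_flatMap, List.mem_map, Prod.mk.injEq]
  constructor
  · rintro ⟨row, h1, r, h2, G', h3, rfl, rfl⟩
    obtain ⟨x, y, rfl⟩ := (I.mem_entries e).1 ⟨row, h1, h2⟩
    exact ⟨rfl, x, y, h3⟩
  · rintro ⟨rfl, x, y, h⟩
    obtain ⟨row, h1, h2⟩ := (I.mem_entries e).2 ⟨x, y, rfl⟩
    exact ⟨row, h1, _, h2, G, h, rfl, rfl⟩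

theorem loc_ne_nil (e : ε) : (I.toInput e).loc ≠ [] := by
  obtain ⟨x, hx⟩ := I.locs_nonempty
  exact List.ne_nil_of_mem ((I.mem_loc e).2 ⟨x, hx, rfl⟩)

theorem candidates_spec (e : ε) {ks : List ℤ} (hks : ks.length = I.k) {r : ℝ} {G : List ℤ}
    (hG : G ∈ candidates (I.toInput e) ks r) :
    (∀ g ∈ G, g ∈ (I.toInput e).loc) ∧ G ≠ [] ∧
      G.length ≤ (Nat.log 2 I.n + 1) * I.k + I.m ∧
      ∀ x ∈ I.clients, ∀ y ∈ I.locs, dist (I.pt x) (I.pt y) ≤ r →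
        ∃ g : Fin I.n, name g ∈ G ∧ dist (I.pt x) (I.pt g) ≤ r := by
  obtain ⟨h1, h2, h3, h4⟩ := OutlierClustering.candidates_spec I.n_pos rfl rfl (I.length_mat e)
    (I.loc_ne_nil e) (hks ▸ I.k_pos) hG
  refine ⟨h1, h2, hks ▸ h3, fun x hx y hy hxy => ?_⟩
  obtain ⟨g, hg, h⟩ := h4 (name x) ((I.mem_cli e).2 ⟨x, hx, rfl⟩) (name y)
    ((I.mem_loc e).2 ⟨y, hy, rfl⟩) ((I.near_toInput e x y r).2 hxy)
  obtain ⟨g', -, rfl⟩ := (I.mem_loc e).1 (h1 g hg)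
  exact ⟨g', hg, (I.near_toInput e x g' r).1 h⟩

open Classical in
theorem candidates_ne_nil (e : ε) {ks : List ℤ} (hks : ks.length = I.k) {r : ℝ} (F : I.Centers)
    (h : (I.clients.filter fun x => ∀ j, ¬ I.within F r x j).card ≤ I.m) :
    candidates (I.toInput e) ks r ≠ [] := by
  have hF : (I.centersList F).length = I.k := by simp [centersList]
  refine OutlierClustering.candidates_ne_nil (F := I.centersList F) I.n_pos rfl rfl
    (I.length_mat e) ?_ ?_ (by rw [hF]; exact I.k_pos) (by rw [hF, hks]) ?_
  · rw [length_cli]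
    exact (Finset.card_le_univ _).trans (by simp)
  · intro g hg
    obtain ⟨j, rfl⟩ := List.mem_ofFn.1 hg
    exact (I.mem_loc e).2 ⟨_, (F j).2, rfl⟩
  · rw [length_filter_cli]
    convert h using 2
    refine Finset.filter_congr fun x _ => ?_
    simp only [centersList, Bool.not_eq_true', List.any_eq_false, List.mem_ofFn,
      forall_exists_index, forall_apply_eq_imp_iff]
    exact forall_congr' fun j => not_congr (I.near_toInput e x _ r)

/-- `Q N` abstracts "the problem is solvable if `N x j` tells which clients may use which centers".
Monotonicity transfers `Q` to the replaced centers at the larger radius, and `cover` supplies the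
hypothesis of the greedy analysis. -/
theorem exists_tuple (e : ε) {ks : List ℤ} (hks : ks.length = I.k)
    {Q : (Fin I.n → Fin I.k → Prop) → Prop}
    (mono : ∀ N N' : Fin I.n → Fin I.k → Prop,
      (∀ x ∈ I.clients, ∀ j, N x j → N' x j) → Q N → Q N')
    (cover : ∀ N : Fin I.n → Fin I.k → Prop, Q N →
      ∃ Z : Finset (Fin I.n), Z.card ≤ I.m ∧ ∀ x ∈ I.clients, x ∉ Z → ∃ j, N x j)
    {F : I.Centers} {r : ℝ} (hr : 0 ≤ r) (hQ : Q (I.within F r)) :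
    ∃ (G : List ℤ) (F' : I.Centers) (x y : Fin I.n),
      (G, I.centersList F') ∈ tuples (I.toInput e) ks ∧ Q (I.within F' (dist (I.pt x) (I.pt y))) ∧
      dist (I.pt x) (I.pt y) ≤ 3 * r ∧
      (I.locs = I.clients → dist (I.pt x) (I.pt y) ≤ 2 * r) := by
  classical
  -- The candidates are computed for matrix entries only. Rounding `r` down to such an entry does
  -- not change which points are within the radius.
  obtain ⟨u, v, huv, hround⟩ := I.exists_round hr
  set r₀ := dist (I.pt u) (I.pt v)
  have hr₀ : 0 ≤ r₀ := dist_nonneg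
  have hcov : (I.clients.filter fun x => ∀ j, ¬ I.within F r₀ x j).card ≤ I.m := by
    obtain ⟨Z, h1, h2⟩ := cover _ hQ
    refine (Finset.card_le_card fun x hx => ?_).trans h1
    rw [Finset.mem_filter] at hx
    by_contra hxZ
    obtain ⟨j, hj⟩ := h2 x hx.1 hxZ
    exact hx.2 j (hround _ _ hj)
  obtain ⟨G, hG⟩ := List.exists_mem_of_ne_nil _ (I.candidates_ne_nil e hks F hcov)
  obtain ⟨h1, h2, -, h4⟩ := I.candidates_spec e hks hG
  obtain ⟨c, hc3, hc2, hc⟩ : ∃ c : ℝ, 0 ≤ c ∧ (c ≤ 3 ∧ (I.locs = I.clients → c ≤ 2)) ∧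
      ∀ j, ∃ g : Fin I.n, name g ∈ G ∧ ∀ x ∈ I.clients, I.within F r x j →
        dist (I.pt x) (I.pt g) ≤ c * r := by
    by_cases hLC : I.locs = I.clients
    · refine ⟨2, by norm_num, ⟨by norm_num, fun _ => le_rfl⟩, fun j => ?_⟩
      -- The center is itself a client, with a location at distance 0, so it has a candidate within
      -- `r₀`.
      obtain ⟨g, hg, hd⟩ := h4 (F j) (hLC ▸ (F j).2) (F j) (F j).2 (by simpa using hr₀)
      refine ⟨g, hg, fun x _ hxj => ?_⟩
      have := dist_triangle (I.pt x) (I.pt (F j)) (I.pt g)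
      unfold within at hxj
      linarith
    · refine ⟨3, by norm_num, ⟨le_rfl, fun h => absurd h hLC⟩, fun j => ?_⟩
      by_cases hj : ∃ x ∈ I.clients, I.within F r x j
      · obtain ⟨y, hy, hyj⟩ := hj
        obtain ⟨g, hg, hd⟩ := h4 y hy (F j) (F j).2 (hround _ _ hyj)
        refine ⟨g, hg, fun x _ hxj => ?_⟩
        have t1 := dist_triangle4 (I.pt x) (I.pt (F j)) (I.pt y) (I.pt g)
        unfold within at hxj hyj
        rw [dist_comm] at hyj
        linarith
      -- A center without clients nearby may be replaced by any candidate.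
      · obtain ⟨g, hg⟩ := List.exists_mem_of_ne_nil _ h2
        obtain ⟨g', -, rfl⟩ := (I.mem_loc e).1 (h1 g hg)
        exact ⟨g', hg, fun x hx hxj => absurd ⟨x, hx, hxj⟩ hj⟩
  choose g hg hgc using hc
  have hgl : ∀ j, g j ∈ I.locs := fun j => by
    obtain ⟨y, hy, h⟩ := (I.mem_loc e).1 (h1 _ (hg j))
    rwa [← name_injective h]
  -- The radius `c * r` need not be a matrix entry, but the entry below it admits the same pairs.
  obtain ⟨x, y, hxy, hround'⟩ := I.exists_round (mul_nonneg hc3 hr)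
  refine ⟨G, fun j => ⟨g j, hgl j⟩, x, y, ?_, ?_, ?_, ?_⟩
  · refine (mem_tuples _ _ _ _).2 ⟨_, [], (I.mem_guesses e ks).2 ⟨rfl, u, v, hG⟩,
      (List.append_nil _).symm, by simp [centersList, hks], fun i hi => ?_⟩
    obtain ⟨j, rfl⟩ := List.mem_ofFn.1 hi
    exact hg j
  · exact mono _ _ (fun w hw j hj => hround' _ _ (hgc j w hw hj)) hQ
  · nlinarith [hc2.1]
  · intro h; nlinarith [hc2.2 h]

/-- Every solvable pair of centers and radius `r'` yields an outcome of radius at most `3r'`, or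
`2r'` if `L = C`, by `exists_tuple` and completeness of the test. The least outcome is no larger.
Soundness of the test is left to the applications. -/
theorem bestOutcome_spec (e : ε) {ks : List ℤ} (hks : ks.length = I.k)
    {test : Input ε × List ℤ → List ℤ → ℝ → List Data}
    {Q : (Fin I.n → Fin I.k → Prop) → Prop}
    (mono : ∀ N N' : Fin I.n → Fin I.k → Prop,
      (∀ x ∈ I.clients, ∀ j, N x j → N' x j) → Q N → Q N')
    (cover : ∀ N : Fin I.n → Fin I.k → Prop, Q N →
      ∃ Z : Finset (Fin I.n), Z.card ≤ I.m ∧ ∀ x ∈ I.clients, x ∉ Z → ∃ j, N x j)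
    (complete : ∀ (F : I.Centers) (r : ℝ), Q (I.within F r) →
      test (I.toInput e, ks) (I.centersList F) r ≠ []) :
    (bestOutcome test (I.toInput e, ks) (tuples (I.toInput e) ks) = .nil ∧
      ∀ (F : I.Centers) (r : ℝ), 0 ≤ r → ¬ Q (I.within F r)) ∨
    ∃ (F : I.Centers) (r : ℝ), 0 ≤ r ∧
      bestOutcome test (I.toInput e, ks) (tuples (I.toInput e) ks) ∈
        test (I.toInput e, ks) (I.centersList F) r ∧
      ∀ (F' : I.Centers) (r' : ℝ), 0 ≤ r' → Q (I.within F' r') →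
        r ≤ 3 * r' ∧ (I.locs = I.clients → r ≤ 2 * r') := by
  set T := tuples (I.toInput e) ks
  have key : ∀ (F' : I.Centers) (r' : ℝ), 0 ≤ r' → Q (I.within F' r') →
      ∃ p ∈ outcomes test (I.toInput e, ks) T, p.1 ≤ 3 * r' ∧
        (I.locs = I.clients → p.1 ≤ 2 * r') := by
    intro F' r' hr' hQ
    obtain ⟨G, F, x, y, h1, h2, h3, h4⟩ := I.exists_tuple e hks mono cover hr' hQ
    obtain ⟨o, ho⟩ := List.exists_mem_of_ne_nil _ (complete F _ h2)
    obtain ⟨row, hrow, hd⟩ := (I.mem_entries e).2 ⟨x, y, rfl⟩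
    refine ⟨(_, o), ?_, h3, h4⟩
    simp only [outcomes, List.mem_flatMap, List.mem_map, Prod.mk.injEq]
    exact ⟨_, h1, row, hrow, _, hd, o, ho, rfl, rfl⟩
  unfold bestOutcome listCase
  rcases bestBy_spec (le := fun x y : ℝ × Data => rle x.1 y.1)
    (fun x y => by simpa using le_total _ _) (fun x y z => by simpa using le_trans)
    (outcomes test (I.toInput e, ks) T) with ⟨h1, h2⟩ | ⟨p, hp, h2, h3⟩ <;> rw [h2]
  · refine .inl ⟨rfl, fun F r hr hQ => ?_⟩
    obtain ⟨p, hp, -⟩ := key F r hr hQ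
    simp [h1] at hp
  · right
    obtain ⟨r, o⟩ := p
    have hp' := hp
    simp only [outcomes, List.mem_flatMap, List.mem_map, Prod.mk.injEq, Prod.exists] at hp'
    obtain ⟨G, t, ht, row, hrow, r', hr', o', ho, rfl, rfl⟩ := hp'
    obtain ⟨s, t', hG, rfl, hs, hsG⟩ := (mem_tuples _ _ _ _).1 ht
    obtain ⟨rfl, u, v, hG⟩ := (I.mem_guesses e ks).1 hG
    rw [List.append_nil] at ho
    obtain ⟨h5, -⟩ := I.candidates_spec e hks hG
    obtain ⟨F, rfl⟩ := I.exists_centersList (hs.trans hks) e fun g hg => h5 g (hsG g hg)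
    obtain ⟨x, y, rfl⟩ := (I.mem_entries e).1 ⟨row, hrow, hr'⟩
    refine ⟨F, _, dist_nonneg, ho, fun F' r'' hr'' hQ => ?_⟩
    obtain ⟨q, hq, h6, h7⟩ := key F' r'' hr'' hQ
    have h8 := h3 q hq
    rw [rle_iff] at h8
    exact ⟨h8.trans h6, fun h => h8.trans (h7 h)⟩

end Inst

end OutlierClustering

end

noncomputable section

namespace OutlierClustering

open Enc (enc)

/-! ### The program and its running time -/

/-- The list `0, …, k - 1`. -/
def indices (k : ℕ) : List ℤ := (List.range k).map Nat.cast

/-- A program that lists `0, …, k - 1` for an input with `k` facilities. -/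
def indicesCode : Code :=
  .comp .snd (.comp (.loop (.comp .leInt (.pair (.int 1) .fst))
    (.pair (.comp .sub (.pair .fst (.int 1)))
      (.pair (.comp .sub (.pair .fst (.int 1))) .snd))) (.pair (.comp .fst .snd) .nil))

/-- The integer `k` is a single atom of the input, so its unary form is not of polynomial size in
the input and needs its own bound. Counting down while consing produces the increasing order. -/
theorem indicesCode_loop (k : ℕ) (acc : List ℤ) : ∃ t,
    (Code.loop (.comp .leInt (.pair (.int 1) .fst))
      (.pair (.comp .sub (.pair .fst (.int 1)))
        (.pair (.comp .sub (.pair .fst (.int 1))) .snd))).Runs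
      (enc ((k : ℤ), acc)) (enc ((0 : ℤ), indices k ++ acc)) t ∧ t ≤ 30 * k + 10 := by
  induction k generalizing acc with
  | zero =>
    refine ⟨_, .loop_done (.comp (t := 1) (.pair (.int _ _) (.fst _)) ?_), by simp⟩
    convert Code.Runs.leInt _ using 1
    simp [enc, Data.fst, Data.leInt, Data.ofProp]
  | succ k ih =>
    obtain ⟨t, h1, h2⟩ := ih ((k : ℤ) :: acc)
    refine ⟨_, .loop_step (.comp (.pair (.int _ _) (.fst _)) (.leInt _)) ?_
      (.pair (.comp (.pair (.fst _) (.int _ _)) (.sub _))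
        (.pair (.comp (.pair (.fst _) (.int _ _)) (.sub _)) (.snd _))) (r := t) ?_, ?_⟩
    · simp [enc, Data.fst, Data.leInt, Data.ofProp]
    · convert h1 using 1
      · simp [enc, Data.fst, Data.snd, Data.sub, Data.list]
      · simp [indices, List.range_succ]
    · omega

/-- A program for the search over all tuples, with running time polynomial in the size of the input,
in `k` and in a bound on the total size of the tuples of length at most `k`. -/
theorem exists_solver {ε : Type} [Enc ε]
    {test : Input ε × List ℤ → List ℤ → ℝ → List Data}
    (ht : PolyFun fun p : (Input ε × List ℤ) × List ℤ × ℝ => test p.1 p.2.1 p.2.2) :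
    ∃ (c : Code) (P : Polynomial ℕ), ∀ (a : Input ε) (k S : ℕ), a.2.1 = k →
      (∀ l', l' <+: indices k →
        esize (l'.foldl (fun T _ => tupleStep T) (guesses a (indices k))) ≤ S) →
      ∃ t, c.Runs (enc a) (bestOutcome test (a, indices k) (tuples a (indices k))) t ∧
        t ≤ P.eval (k + esize a + S) := by
  obtain ⟨cD, PD, hD⟩ := PolyFun.bestOutcome ht
  obtain ⟨cC, PC, hC⟩ := exists_foldl_code (α := ℤ) (γ := Input ε × List ℤ)
    (f := fun p : (Input ε × List ℤ) × List (List ℤ × List ℤ) × ℤ => tupleStep p.2.1)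
    (by fun_prop)
  obtain ⟨cB, PB, hB⟩ := show PolyFun fun a : Input ε × List ℤ => (a, guesses a.1 a.2, a.2) by
    fun_prop
  refine ⟨.comp cD (.comp (.pair .fst cC) (.comp cB (.pair .id indicesCode))),
    30 * .X + 30 + PB.comp (3 * .X + 3) + PC.comp (6 * .X + 6) + PD.comp (6 * .X + 6),
    fun a k S hk hS => ?_⟩
  obtain ⟨tA, hA1, hA2⟩ := indicesCode_loop k []
  rw [List.append_nil] at hA1
  have hA : (Code.pair .id indicesCode).Runs (enc a) (enc (a, indices k)) _ :=
    .pair (.id _) (.comp (.comp (.pair (.comp (.snd _) (.fst _)) (.nil _)) (by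
      have e : (Data.cons (enc a).snd.fst .nil) = enc ((k : ℤ), ([] : List ℤ)) := by
        rw [← hk]; rfl
      rw [e]; exact hA1)) (.snd _))
  have hk1 : esize (indices k) = 2 * k + 1 := by simp [indices]
  obtain ⟨tB, hB1, hB2, -⟩ := hB (a, indices k)
  obtain ⟨tC, hC1, hC2⟩ := hC (a, indices k) (guesses a (indices k)) (indices k) S hS
  obtain ⟨tD, hD1, hD2, -⟩ := hD ((a, indices k), tuples a (indices k))
  refine ⟨_, .comp (.comp (.comp hA hB1) (.pair (.fst _) hC1)) hD1, ?_⟩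
  have hS' : esize (tuples a (indices k)) ≤ S := hS _ (List.prefix_refl _)
  have e1 := eval_mono PB (s := esize (a, indices k)) (t := 3 * (k + esize a + S) + 3) (by
    simp only [esize_prod, hk1]; omega)
  have e2 := eval_mono PC (s := esize (a, indices k) + S + esize (indices k))
    (t := 6 * (k + esize a + S) + 6) (by simp only [esize_prod, hk1]; omega)
  have e3 := eval_mono PD (s := esize ((a, indices k), tuples a (indices k)))
    (t := 6 * (k + esize a + S) + 6) (by simp only [esize_prod, hk1]; omega)
  simp only [Polynomial.eval_add, Polynomial.eval_comp, Polynomial.eval_mul, Polynomial.eval_X,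
    Polynomial.eval_ofNat]
  omega

/-! ### Size of the enumeration of tuples and the time bound -/

theorem length_flatMap_le {α β : Type} {l : List α} {f : α → List β} {c : ℕ}
    (h : ∀ x ∈ l, (f x).length ≤ c) : (l.flatMap f).length ≤ l.length * c := by
  induction l with
  | nil => simp
  | cons x l ih =>
    have := ih fun y hy => h y (by simp [hy])
    have := h x (by simp)
    simp only [List.flatMap_cons, List.length_append, List.length_cons, Nat.add_mul]
    omega

theorem length_candidates_le {ε : Type} (a : Input ε) (ks : List ℤ) (r : ℝ) :
    (candidates a ks r).length ≤ 1 := by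
  unfold candidates
  beta_reduce
  cases ile (len _) a.mm <;> simp

theorem tuples_bound (l : List ℤ) (T : List (List ℤ × List ℤ)) (g : ℕ)
    (hT : ∀ p ∈ T, p.1.length ≤ g ∧ p.2 = []) :
    (l.foldl (fun T _ => tupleStep T) T).length ≤ T.length * g ^ l.length ∧
      ∀ p ∈ l.foldl (fun T _ => tupleStep T) T, p.1.length ≤ g ∧ p.2.length = l.length := by
  induction l using List.reverseRecOn with
  | nil => simpa using hT
  | append_singleton l x ih =>
    rw [List.foldl_append, List.foldl_cons, List.foldl_nil]
    obtain ⟨h1, h2⟩ := ih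
    constructor
    · refine (length_flatMap_le (c := g) fun p hp => by simpa using (h2 p hp).1).trans ?_
      rw [List.length_append, List.length_singleton, pow_succ, ← mul_assoc]
      exact Nat.mul_le_mul_right _ h1
    · intro p hp
      simp only [tupleStep, List.mem_flatMap, List.mem_map] at hp
      obtain ⟨q, hq, y, -, rfl⟩ := hp
      have := h2 q hq
      simpa using this

/-- With `q = ⌊L/k⌋` one has `L < k * (q + 1) ≤ k * 2 ^ q`, and `q * k ≤ L`. For `L` about `log₂ n`
this turns a power of the logarithm into `k ^ k` times a polynomial in `n`. -/
theorem pow_le_pow_mul_two_pow (L k : ℕ) (hk : 0 < k) : L ^ k ≤ k ^ k * 2 ^ L := by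
  have h1 : L ≤ k * 2 ^ (L / k) := by
    have h2 : L / k + 1 ≤ 2 ^ (L / k) := Nat.lt_two_pow_self
    have h3 := Nat.div_add_mod L k
    have h4 := Nat.mod_lt L hk
    have h5 := Nat.mul_le_mul_left k h2
    rw [Nat.mul_add] at h5
    omega
  calc L ^ k ≤ (k * 2 ^ (L / k)) ^ k := Nat.pow_le_pow_left h1 k
    _ = k ^ k * 2 ^ (L / k * k) := by rw [mul_pow, ← pow_mul]
    _ ≤ k ^ k * 2 ^ L := by
      gcongr
      · norm_num
      · exact Nat.div_mul_le_self L k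

/-- One constant as both factor and exponent is the shape of `timeBound`. -/
theorem exists_eval_le (P : Polynomial ℕ) :
    ∃ A : ℕ, 0 < A ∧ ∀ s : ℕ, 1 ≤ s → P.eval s ≤ A * s ^ A := by
  induction P using Polynomial.induction_on' with
  | add p q hp hq =>
    obtain ⟨A, hA, h1⟩ := hp
    obtain ⟨B, hB, h2⟩ := hq
    refine ⟨A + B, by omega, fun s hs => ?_⟩
    rw [Polynomial.eval_add, Nat.add_mul]
    have e1 : s ^ A ≤ s ^ (A + B) := Nat.pow_le_pow_right hs (by omega)
    have e2 : s ^ B ≤ s ^ (A + B) := Nat.pow_le_pow_right hs (by omega)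
    exact Nat.add_le_add ((h1 s hs).trans (Nat.mul_le_mul_left _ e1))
      ((h2 s hs).trans (Nat.mul_le_mul_left _ e2))
  | monomial n a =>
    refine ⟨a + n + 1, by omega, fun s hs => ?_⟩
    rw [Polynomial.eval_monomial]
    exact Nat.mul_le_mul (by omega) (Nat.pow_le_pow_right hs (by omega))

namespace Inst

variable {X : Type u} [MetricSpace X] (I : Inst X) {ε : Type}

theorem length_guesses_le (e : ε) (ks : List ℤ) :
    (guesses (I.toInput e) ks).length ≤ I.n * (I.n * 1) := by
  have hrow : ∀ row ∈ (I.toInput e).mat, row.length = I.n := by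
    intro row hrow
    obtain ⟨x, rfl⟩ := List.mem_ofFn.1 hrow
    simp
  rw [← I.length_mat e]
  refine length_flatMap_le fun row h => ?_
  rw [I.length_mat e, ← hrow row h]
  refine length_flatMap_le fun r _ => ?_
  rw [List.length_map]
  exact length_candidates_le _ _ _

theorem esize_ofFn_real {n : ℕ} (f : Fin n → ℝ) : esize (List.ofFn f) ≤ 2 * n + 1 := by
  have := esize_le_mul (List.ofFn f) 1 (by simp)
  rw [List.length_ofFn] at this
  omega

theorem esize_ofFn_bool {n : ℕ} (f : Fin n → Bool) : esize (List.ofFn f) ≤ 2 * n + 1 := by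
  have := esize_le_mul (List.ofFn f) 1 (by simp)
  rw [List.length_ofFn] at this
  omega

theorem esize_toInput_le [Enc ε] (e : ε) :
    esize (I.toInput e) ≤ I.n * (2 * I.n + 2) + 4 * I.n + 16 + esize e := by
  have h1 := esize_le_mul (List.ofFn fun x : Fin I.n => List.ofFn fun y : Fin I.n =>
    dist (I.pt x) (I.pt y)) (2 * I.n + 1) (by
      simp only [List.mem_ofFn, forall_exists_index, forall_apply_eq_imp_iff]
      exact fun x => esize_ofFn_real _)
  rw [List.length_ofFn, show 2 * I.n + 1 + 1 = 2 * I.n + 2 from rfl] at h1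
  have h2 := esize_ofFn_bool fun x => decide (x ∈ I.clients)
  have h3 := esize_ofFn_bool fun x => decide (x ∈ I.locs)
  have h4 : esize () = 1 := rfl
  simp only [toInput, esize_prod, esize_int, esize_real]
  omega

/-- At most `n²` guesses, each with at most `g ^ k` tuples, where `g ≤ (k+m) * L` and `L ^ k ≤ k ^ k
* 2n`. Two factors `n` come from the guesses, one from `2 ^ L` and one from the size of a single
entry. -/
theorem tuples_size_le (e : ε) {l' : List ℤ} (h : l' <+: indices I.k) :
    esize (l'.foldl (fun T _ => tupleStep T) (guesses (I.toInput e) (indices I.k))) ≤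
      17 * (I.n ^ 4 * (I.k + I.m) ^ (3 * I.k)) := by
  set L := Nat.log 2 I.n + 1 with hL
  set K := I.k + I.m with hK
  set g := L * I.k + I.m with hg
  have hn := I.n_pos
  have hk := I.k_pos
  have hks : (indices I.k).length = I.k := by simp [indices]
  obtain ⟨h1, h2⟩ := tuples_bound l' (guesses (I.toInput e) (indices I.k)) g fun p hp => by
    obtain ⟨G, t⟩ := p
    obtain ⟨rfl, x, y, hG⟩ := (I.mem_guesses e _).1 hp
    exact ⟨(I.candidates_spec e hks hG).2.2.1, rfl⟩
  set T := l'.foldl (fun T _ => tupleStep T) (guesses (I.toInput e) (indices I.k))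
  have hl : l'.length ≤ I.k := hks ▸ h.length_le
  -- A pair of integer lists of lengths at most `g` and `k` has size at most `(2g + 1) + (2k + 1) +
  -- 1`.
  have h3 := esize_le_mul T (2 * g + 2 * I.k + 3) fun p hp => by
    have := h2 p hp
    simp only [esize_prod, esize_listInt]; omega
  rw [show 2 * g + 2 * I.k + 3 + 1 = 2 * g + 2 * I.k + 4 from rfl] at h3
  have hLn : L ≤ I.n := Nat.log_lt_self 2 hn.ne'
  have hL1 : 1 ≤ L := by omega
  have hK1 : 1 ≤ K := by omega
  have hgK : g ≤ K * L := by
    have e1 := Nat.mul_le_mul_left I.m hL1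
    have e2 : K * L = L * I.k + I.m * L := by rw [hK]; ring
    omega
  have hg1 : 1 ≤ g := by
    have := Nat.mul_le_mul hL1 hk
    omega
  have h4 : g ^ l'.length ≤ K ^ (2 * I.k) * (2 * I.n) := calc
    g ^ l'.length ≤ g ^ I.k := Nat.pow_le_pow_right hg1 hl
    _ ≤ (K * L) ^ I.k := Nat.pow_le_pow_left hgK _
    _ = K ^ I.k * L ^ I.k := mul_pow ..
    _ ≤ K ^ I.k * (K ^ I.k * (2 * I.n)) := by
      refine Nat.mul_le_mul_left _ ((pow_le_pow_mul_two_pow L I.k hk).trans ?_)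
      refine Nat.mul_le_mul (Nat.pow_le_pow_left (by omega) _) ?_
      rw [hL, pow_succ, mul_comm]
      exact Nat.mul_le_mul_left _ (Nat.pow_log_le_self 2 hn.ne')
    _ = _ := by ring
  have h5 : K ≤ K ^ I.k := Nat.le_self_pow hk.ne' K
  have h6 : 2 * g + 2 * I.k + 4 ≤ 8 * (I.n * K ^ I.k) := by
    have e1 : g ≤ I.n * K ^ I.k := hgK.trans (by rw [mul_comm]; exact Nat.mul_le_mul hLn h5)
    have e2 : K ^ I.k ≤ I.n * K ^ I.k := Nat.le_mul_of_pos_left _ hn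
    omega
  have h7 : T.length ≤ (I.n * (I.n * 1)) * (K ^ (2 * I.k) * (2 * I.n)) :=
    h1.trans (Nat.mul_le_mul (I.length_guesses_le e _) h4)
  have h8 : T.length * (2 * g + 2 * I.k + 4) ≤
      (I.n * (I.n * 1)) * (K ^ (2 * I.k) * (2 * I.n)) * (8 * (I.n * K ^ I.k)) :=
    Nat.mul_le_mul h7 h6
  have h9 : (I.n * (I.n * 1)) * (K ^ (2 * I.k) * (2 * I.n)) * (8 * (I.n * K ^ I.k)) =
      16 * (I.n ^ 4 * K ^ (3 * I.k)) := by ring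
  have h10 : 1 ≤ I.n ^ 4 * K ^ (3 * I.k) :=
    Nat.one_le_iff_ne_zero.2 (by positivity)
  omega

/-- The search with a polynomial-time test stays within the time bound. -/
theorem exists_solver_timeBound [Enc ε] {test : Input ε × List ℤ → List ℤ → ℝ → List Data}
    (ht : PolyFun fun p : (Input ε × List ℤ) × List ℤ × ℝ => test p.1 p.2.1 p.2.2) :
    ∃ (p : Code) (c : ℕ), ∀ (X : Type u) [MetricSpace X] (I : Inst X) (e : ε),
      esize e ≤ 8 * (I.n + I.k) → ∃ t, p.Runs (I.input (enc e))
        (bestOutcome test (I.toInput e, indices I.k) (tuples (I.toInput e) (indices I.k))) t ∧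
        t ≤ I.timeBound c := by
  obtain ⟨p, P, hp⟩ := exists_solver ht
  obtain ⟨A, hA, hP⟩ := exists_eval_le P
  -- The value to be bounded is `A * (60 * W) ^ A` with `W = n ^ 4 * (k+m) ^ (3k)`. So the constant
  -- has to dominate the factor `A * 60 ^ A` and the exponents `3 * A` and `4 * A`.
  refine ⟨p, A * 60 ^ A, fun X _ I e he => ?_⟩
  obtain ⟨t, h1, h2⟩ := hp (I.toInput e) I.k _ rfl fun l' hl' => I.tuples_size_le e hl'
  rw [enc_toInput] at h1
  refine ⟨t, h1, h2.trans ?_⟩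
  have hn := I.n_pos
  have hk := I.k_pos
  set K := I.k + I.m with hK
  have hK1 : 1 ≤ K := by omega
  set W := I.n ^ 4 * K ^ (3 * I.k) with hW
  have hn4 : I.n ^ 2 ≤ W := by
    calc I.n ^ 2 ≤ I.n ^ 4 := Nat.pow_le_pow_right hn (by norm_num)
      _ ≤ W := Nat.le_mul_of_pos_right _ (by positivity)
  have hn1 : I.n ≤ W := (Nat.le_self_pow (by norm_num) _).trans hn4
  have hkW : I.k ≤ W := by
    calc I.k ≤ K := by omega
      _ ≤ K ^ (3 * I.k) := Nat.le_self_pow (by omega) _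
      _ ≤ W := Nat.le_mul_of_pos_left _ (by positivity)
  have hM : I.k + esize (I.toInput e) + 17 * W ≤ 60 * W := by
    have := I.esize_toInput_le e
    have : I.n * (2 * I.n + 2) = 2 * I.n ^ 2 + 2 * I.n := by ring
    omega
  refine (hP _ (by omega)).trans ((Nat.mul_le_mul_left _ (Nat.pow_le_pow_left hM A)).trans ?_)
  have h60 : 4 ≤ 60 ^ A := (by norm_num : 4 ≤ 60 ^ 1).trans (Nat.pow_le_pow_right (by norm_num) hA)
  have hc : 4 * A ≤ A * 60 ^ A := by rw [mul_comm]; exact Nat.mul_le_mul_left _ h60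
  unfold timeBound
  calc A * (60 * W) ^ A = (A * 60 ^ A) * (K ^ (3 * A * I.k) * I.n ^ (4 * A)) := by
        rw [hW]; simp only [mul_pow, ← pow_mul]; ring_nf
    _ ≤ (A * 60 ^ A) * (K ^ (A * 60 ^ A * I.k) * I.n ^ (A * 60 ^ A)) := by
        refine Nat.mul_le_mul_left _ (Nat.mul_le_mul (Nat.pow_le_pow_right hK1 ?_)
          (Nat.pow_le_pow_right hn hc))
        exact Nat.mul_le_mul_right _ (by omega)
    _ = _ := by ring

end Inst

end OutlierClustering

end

noncomputable section

namespace OutlierClustering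

open Enc (enc)

/-! ### Correctness of the test for bounds on the numbers of clients of the colors -/

/-! ### Ranks in finite sets, used as positions of clients in clusters -/

section Rank

variable {n : ℕ}

/-- The number of smaller elements of a set. -/
def rank (s : Finset (Fin n)) (x : Fin n) : ℕ := (s.filter (· < x)).card

theorem rank_lt_card {s : Finset (Fin n)} {x : Fin n} (hx : x ∈ s) : rank s x < s.card :=
  Finset.card_lt_card (Finset.filter_ssubset.2 ⟨x, hx, lt_irrefl x⟩)

theorem rank_lt_rank {s : Finset (Fin n)} {x y : Fin n} (hx : x ∈ s) (h : x < y) :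
    rank s x < rank s y := by
  refine Finset.card_lt_card ((Finset.ssubset_iff_of_subset fun z hz => ?_).2 ⟨x, ?_, ?_⟩)
  · rw [Finset.mem_filter] at hz ⊢
    exact ⟨hz.1, hz.2.trans h⟩
  · exact Finset.mem_filter.2 ⟨hx, h⟩
  · simp

theorem rank_injOn (s : Finset (Fin n)) : Set.InjOn (rank s) s := by
  intro x hx y hy h
  rcases lt_trichotomy x y with h' | h' | h'
  · exact absurd h (rank_lt_rank hx h').ne
  · exact h'
  · exact absurd h (rank_lt_rank hy h').ne'

theorem exists_rank_eq {s : Finset (Fin n)} {t : ℕ} (ht : t < s.card) :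
    ∃ x ∈ s, rank s x = t := by
  have : s.image (rank s) = Finset.range s.card := by
    refine Finset.eq_of_subset_of_card_le (fun t ht => ?_) ?_
    · obtain ⟨x, hx, rfl⟩ := Finset.mem_image.1 ht
      exact Finset.mem_range.2 (rank_lt_card hx)
    · rw [Finset.card_image_of_injOn (rank_injOn s), Finset.card_range]
  exact Finset.mem_image.1 (this ▸ Finset.mem_range.2 ht)

end Rank

theorem map_fst_enum {α : Type} (l : List α) : (enum l).map Prod.fst = indices l.length := by
  refine List.ext_getElem (by simp [enum, indices]) fun i h1 h2 => ?_
  simp [enum, indices]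

theorem mem_indices {k : ℕ} {t : ℤ} : t ∈ indices k ↔ 0 ≤ t ∧ t < k := by
  simp only [indices, List.mem_map, List.mem_range]
  constructor
  · rintro ⟨j, hj, rfl⟩; omega
  · rintro ⟨h1, h2⟩; exact ⟨t.toNat, by omega, by omega⟩

theorem nodup_indices (k : ℕ) : (indices k).Nodup :=
  List.nodup_range.map Nat.cast_injective

theorem mem_enum_idxOf {α : Type} [BEq α] [LawfulBEq α] {l : List α} {a : α} (h : a ∈ l) :
    (((l.idxOf a : ℕ) : ℤ), a) ∈ enum l :=
  mem_enum.2 ⟨_, rfl, List.getElem?_eq_some_iff.2 ⟨List.idxOf_lt_length_iff.2 h, by simp⟩⟩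

theorem mem_drop_enum {α : Type} {l : List α} {c : ℕ} {i : ℤ} {a : α}
    (h : (i, a) ∈ (enum l).drop c) : ∃ j : ℕ, ((c + j : ℕ) : ℤ) = i ∧ c + j < l.length := by
  obtain ⟨j, hj, h⟩ := List.mem_iff_getElem.1 h
  refine ⟨j, ?_, ?_⟩
  · simp [enum] at h
    exact_mod_cast h.1
  · simp [enum] at hj; omega

namespace Inst

variable {X : Type u} [MetricSpace X] (I : Inst X) {ε : Type}

/-- Outlier partitions whose clusters respect bounds on the numbers of clients of the colors. Every
entry `(i, c, l, u)` of `D` demands that the cluster `i` has between `l` and `u` clients of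
color `c`. -/
def bounded (col : Fin I.n → ℤ) (D : List (ℤ × ℤ × ℤ × ℤ)) : Set I.Clustering :=
  {O | I.IsOutlierPartition O ∧ ∀ q ∈ D, ∀ i : Fin I.k, name i = q.1 →
    q.2.2.1 ≤ ((O i).filter fun x => col x = q.2.1).card ∧
      (((O i).filter fun x => col x = q.2.1).card : ℤ) ≤ q.2.2.2}

/-- The demands treat every cluster and every color of a client exactly once. -/
structure IsDemand (col : Fin I.n → ℤ) (D : List (ℤ × ℤ × ℤ × ℤ)) : Prop where
  nodup : (D.map fun q => (q.1, q.2.1)).Nodup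
  cluster : ∀ q ∈ D, ∃ i : Fin I.k, name i = q.1
  exists_mem : ∀ (i : Fin I.k), ∀ x ∈ I.clients, ∃ q ∈ D, q.1 = name i ∧ q.2.1 = col x
  upper : ∀ q ∈ D, 0 ≤ q.2.2.2

/-- The slots of all demands and of the outliers. -/
def slotList (D : List (ℤ × ℤ × ℤ × ℤ)) : List Slot :=
  ((-1, 0, 0, (I.m : ℤ)) :: D).flatMap fun q => (indices (I.n + 1)).map fun t => (q, t)

theorem slots_toInput (e : ε) (D : List (ℤ × ℤ × ℤ × ℤ)) :
    slots (I.toInput e) D = enum (I.slotList D) := by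
  have : (I.toInput e).pts ++ [(I.toInput e).nn] = indices (I.n + 1) := by
    rw [pts_toInput, indices, List.range_succ, List.map_append]
    congr 1
    refine List.ext_getElem (by simp) fun i h1 h2 => ?_
    simp
  rw [slots, this]
  rfl

variable {I} {col : Fin I.n → ℤ} {D : List (ℤ × ℤ × ℤ × ℤ)}

theorem mem_slotList {s : Slot} : s ∈ I.slotList D ↔
    (s.1 = (-1, 0, 0, (I.m : ℤ)) ∨ s.1 ∈ D) ∧ 0 ≤ s.2 ∧ s.2 < (I.n : ℤ) + 1 := by
  obtain ⟨q, t⟩ := s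
  simp only [slotList, List.mem_flatMap, List.mem_map, List.mem_cons, Prod.mk.injEq]
  constructor
  · rintro ⟨q', hq, t', ht, rfl, rfl⟩
    have := mem_indices.1 ht
    push_cast at this
    exact ⟨hq, this⟩
  · rintro ⟨hq, ht⟩
    exact ⟨q, hq, t, mem_indices.2 (by push_cast; exact ht), rfl, rfl⟩

theorem IsDemand.eq (hD : I.IsDemand col D) {q q' : ℤ × ℤ × ℤ × ℤ} (hq : q ∈ D) (hq' : q' ∈ D)
    (h1 : q.1 = q'.1) (h2 : q.2.1 = q'.2.1) : q = q' :=
  List.inj_on_of_nodup_map hD.nodup hq hq' (by rw [h1, h2])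

theorem IsDemand.nonneg (hD : I.IsDemand col D) {q : ℤ × ℤ × ℤ × ℤ} (hq : q ∈ D) : 0 ≤ q.1 := by
  obtain ⟨i, hi⟩ := hD.cluster q hq
  rw [← hi]; simp [name]

theorem IsDemand.nodup_slotList (hD : I.IsDemand col D) : (I.slotList D).Nodup := by
  have h1 : ((-1, 0, 0, (I.m : ℤ)) :: D).Nodup :=
    List.nodup_cons.2 ⟨fun h => by have := hD.nonneg h; simp at this, hD.nodup.of_map⟩
  refine List.nodup_flatMap.2 ⟨fun q _ => (nodup_indices _).map fun t t' h => by simpa using h, ?_⟩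
  refine h1.imp fun {q q'} hne => ?_
  rw [Function.onFun, List.disjoint_left]
  rintro s hs hs'
  obtain ⟨t, -, rfl⟩ := List.mem_map.1 hs
  obtain ⟨t', -, h⟩ := List.mem_map.1 hs'
  simp at h
  exact hne h.1.symm

/-- Clients have nonnegative names and dummies negative ones. -/
theorem nodup_lefts_fst (e : ε) {colors F : List ℤ} {r : ℝ} :
    ((lefts (I.toInput e).mat colors F r (I.toInput e).cli
      (enum (I.slotList D))).map Prod.fst).Nodup := by
  rw [lefts, List.map_append, List.map_map, List.map_map, foldl_tail]
  refine List.nodup_append.2 ⟨?_, ?_, ?_⟩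
  · simpa [Function.comp_def] using I.nodup_cli e
  · have h1 := (map_fst_enum_nodup (I.slotList D)).sublist
      ((List.drop_sublist (I.toInput e).cli.length (enum (I.slotList D))).map Prod.fst)
    have h2 := h1.map (f := fun i : ℤ => -1 - i) fun i j h => by simpa using h
    simpa [List.map_map, Function.comp_def] using h2
  · rintro a ha b hb rfl
    obtain ⟨x, hx, rfl⟩ := List.mem_map.1 ha
    obtain ⟨⟨i, s⟩, hs, h⟩ := List.mem_map.1 hb
    obtain ⟨y, -, rfl⟩ := (I.mem_cli e).1 hx
    obtain ⟨j, rfl, -⟩ := mem_drop_enum hs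
    simp [name] at h
    omega

/-- In each cluster the clients of one color take the slots of their demand in the order of their
ranks, and the unassigned clients take the outlier slots. Filling from position 0 uses up all
positions below the lower bound, so the remaining slots are all open to dummies. There are exactly
as many dummies as such slots. -/
theorem boundsTest_complete (e : ε) {ks : List ℤ}
    {prep : Input ε × List ℤ → List ℤ × List (ℤ × ℤ × ℤ × ℤ)}
    (hcol : ∀ x ∈ I.clients, nthD 0 (prep (I.toInput e, ks)).1 (name x) = col x)
    (hprep : (prep (I.toInput e, ks)).2 = D) (hD : I.IsDemand col D) {F : I.Centers} {r : ℝ}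
    {O : I.Clustering} (hO : O ∈ I.bounded col D) (hF : ∀ i, ∀ x ∈ O i, I.within F r x i) :
    boundsTest prep (I.toInput e, ks) (I.centersList F) r ≠ [] := by
  classical
  obtain ⟨⟨hO1, hO2, hO3⟩, hO4⟩ := hO
  -- the slots of the clients
  have hφ : ∀ x ∈ I.clients, ∃ s : Slot, s ∈ I.slotList D ∧
      fits (I.toInput e).mat (prep (I.toInput e, ks)).1 (I.centersList F) r (name x) s = true ∧
      ((∃ i, x ∈ O i ∧ s.1 ∈ D ∧ s.1.1 = name i ∧ s.1.2.1 = col x ∧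
          s.2 = rank ((O i).filter fun y => col y = col x) x) ∨
        ((∀ i, x ∉ O i) ∧ s.1.1 = -1 ∧ s.2 = rank (I.clients \ Finset.univ.biUnion O) x)) := by
    intro x hx
    by_cases h : ∃ i, x ∈ O i
    · obtain ⟨i, hi⟩ := h
      obtain ⟨q, hq, hq1, hq2⟩ := hD.exists_mem i x hx
      have hmem : x ∈ (O i).filter fun y => col y = col x := by simp [hi]
      have hr := rank_lt_card hmem
      have hn : ((O i).filter fun y => col y = col x).card ≤ I.n :=
        (Finset.card_le_univ _).trans (by simp)
      have hu := (hO4 q hq i hq1.symm).2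
      rw [hq2] at hu
      refine ⟨(q, rank ((O i).filter fun y => col y = col x) x), mem_slotList.2
        ⟨.inr hq, by simp, by simp; omega⟩, ?_, .inl ⟨i, hi, hq, hq1, hq2, rfl⟩⟩
      simp only [fits, Bool.and_eq_true, Bool.or_eq_true, ilt_iff, ieq_iff]
      refine ⟨by omega, .inr ⟨by rw [hcol x hx, hq2], ?_⟩⟩
      rw [hq1, nthD_of_getElem? (a := name (F i : Fin I.n)) (List.getElem?_eq_some_iff.2
        ⟨by simp [centersList], by simp [centersList]⟩)]
      exact (I.near_toInput e x (F i) r).2 (hF i x hi)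
    · push Not at h
      have hmem : x ∈ I.clients \ Finset.univ.biUnion O := by simp [hx, h]
      have hr := rank_lt_card hmem
      have hn : (I.clients \ Finset.univ.biUnion O).card ≤ I.n :=
        (Finset.card_le_univ _).trans (by simp)
      refine ⟨((-1, 0, 0, (I.m : ℤ)), rank (I.clients \ Finset.univ.biUnion O) x), mem_slotList.2
        ⟨.inl rfl, by simp, by simp; omega⟩, ?_, .inr ⟨h, rfl, rfl⟩⟩
      simp only [fits, Bool.and_eq_true, Bool.or_eq_true, ilt_iff]
      exact ⟨by omega, .inl (by norm_num)⟩
  choose! φ hφ1 hφ2 hφ3 using hφ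
  have hφinj : ∀ x ∈ I.clients, ∀ y ∈ I.clients, φ x = φ y → x = y := by
    intro x hx y hy hxy
    rcases hφ3 x hx with ⟨i, h1, h2, h3, h4, h5⟩ | ⟨h1, h2, h3⟩ <;>
    rcases hφ3 y hy with ⟨j, k1, k2, k3, k4, k5⟩ | ⟨k1, k2, k3⟩
    · rw [hxy] at h3 h4 h5
      obtain rfl : i = j := name_injective (h3.symm.trans k3)
      have hc : col x = col y := h4.symm.trans k4
      rw [k5, hc] at h5
      exact (rank_injOn ((O i).filter fun z => col z = col y) (by simp [k1]) (by simp [h1, hc])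
        (by exact_mod_cast h5)).symm
    · rw [hxy] at h2
      have := hD.nonneg h2; omega
    · rw [← hxy] at k2
      have := hD.nonneg k2; omega
    · rw [hxy, k3] at h3
      exact (rank_injOn (I.clients \ Finset.univ.biUnion O) (by simp [k1, hy]) (by simp [h1, hx])
        (by exact_mod_cast h3)).symm
  set l := I.slotList D with hl
  have hnd : l.Nodup := hD.nodup_slotList
  -- the slots that are left for the dummies
  set R := l.filter fun s => decide (s ∉ I.clients.image φ) with hR
  have hRnd : R.Nodup := hnd.filter _
  have hRlen : R.length = l.length - I.clients.card := by
    have h1 := l.length_eq_length_filter_add fun s => decide (s ∉ I.clients.image φ)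
    have h2 : (l.filter fun s => !decide (s ∉ I.clients.image φ)).length = I.clients.card := by
      rw [← List.toFinset_card_of_nodup (hnd.filter _),
        ← Finset.card_image_of_injOn (f := φ) (s := I.clients) fun x hx y hy => hφinj x hx y hy]
      congr 1
      ext s
      simp only [List.toFinset_filter, Finset.mem_filter, List.mem_toFinset, Bool.not_eq_true',
        decide_eq_false_iff_not, not_not]
      refine ⟨fun h => h.2, fun h => ⟨?_, h⟩⟩
      obtain ⟨x, hx, rfl⟩ := Finset.mem_image.1 h
      exact hφ1 x hx
    rw [← hR] at h1
    omega
  -- A position below the lower bound is the rank of some client of that cluster and color, so its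
  -- slot is taken by that client.
  have hRdummy : ∀ s ∈ R, s.1.2.2.1 ≤ s.2 := by
    intro s hs
    obtain ⟨hs1, hs2⟩ := List.mem_filter.1 hs
    obtain ⟨h1 | h1, h2, h3⟩ := mem_slotList.1 hs1
    · rw [h1]; exact h2
    · obtain ⟨i, hi⟩ := hD.cluster _ h1
      by_contra hlt
      have h4 := (hO4 _ h1 i hi).1
      obtain ⟨x, hx, hxt⟩ := exists_rank_eq (s := (O i).filter fun x => col x = s.1.2.1)
        (t := s.2.toNat) (by omega)
      rw [Finset.mem_filter] at hx
      have hxc := hO1 i hx.1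
      refine (of_decide_eq_true hs2) (Finset.mem_image.2 ⟨x, hxc, ?_⟩)
      rcases hφ3 x hxc with ⟨j, k1, k2, k3, k4, k5⟩ | ⟨k1, -⟩
      · have hij : j = i := by
          by_contra hne
          exact Finset.disjoint_left.1 (hO2 j i hne) k1 hx.1
        subst hij
        rw [hx.2] at k4 k5
        refine Prod.ext (hD.eq k2 h1 (k3.trans hi) k4) ?_
        rw [k5, hxt]; omega
      · exact absurd hx.1 (k1 i)
  -- The matching reads only the names of the nodes. The first `|C|` slot numbers were dropped, so
  -- the `j`-th dummy is called `-1 - (|C| + j)` and receives the `j`-th remaining slot. The default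
  -- values are never reached.
  let f : ℤ × List ℤ → ℤ := fun a =>
    if 0 ≤ a.1 then ((l.idxOf (if h : a.1.toNat < I.n then φ ⟨a.1.toNat, h⟩ else default) : ℕ) : ℤ)
    else ((l.idxOf (R.getD ((-1 - a.1).toNat - I.clients.card) default) : ℕ) : ℤ)
  have hf1 : ∀ (x : Fin I.n) (b : List ℤ), f (name x, b) = ((l.idxOf (φ x) : ℕ) : ℤ) := by
    intro x b
    simp [f, name]
  have hf2 : ∀ (j : ℕ) (b : List ℤ), f (-1 - ((I.clients.card + j : ℕ) : ℤ), b) =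
      ((l.idxOf (R.getD j default) : ℕ) : ℤ) := by
    intro j b
    have h1 : ¬ 0 ≤ -1 - ((I.clients.card + j : ℕ) : ℤ) := by omega
    have h2 : (-1 - (-1 - ((I.clients.card + j : ℕ) : ℤ))).toNat - I.clients.card = j := by omega
    simp only [f, h1, if_false, h2]
  have hmem : ∀ a ∈ lefts (I.toInput e).mat (prep (I.toInput e, ks)).1 (I.centersList F) r
      (I.toInput e).cli (enum l), (∃ x ∈ I.clients, a.1 = name x ∧
        a.2 = ((enum l).filter fun s => fits (I.toInput e).mat (prep (I.toInput e, ks)).1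
          (I.centersList F) r (name x) s.2).map fun s => s.1) ∨
      ∃ j : ℕ, I.clients.card + j < l.length ∧ a.1 = -1 - ((I.clients.card + j : ℕ) : ℤ) ∧
        a.2 = ((enum l).filter fun s => ile s.2.1.2.2.1 s.2.2).map fun s => s.1 := by
    intro a ha
    rw [lefts, foldl_tail, length_cli] at ha
    rcases List.mem_append.1 ha with ha | ha
    · obtain ⟨i, hi, rfl⟩ := List.mem_map.1 ha
      obtain ⟨x, hx, rfl⟩ := (I.mem_cli e).1 hi
      exact .inl ⟨x, hx, rfl, rfl⟩
    · obtain ⟨⟨i, s⟩, hs, rfl⟩ := List.mem_map.1 ha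
      obtain ⟨j, rfl, hj⟩ := mem_drop_enum hs
      exact .inr ⟨j, hj, rfl, rfl⟩
  have hRget : ∀ j : ℕ, I.clients.card + j < l.length → ∃ h : j < R.length,
      R.getD j default = R[j] := fun j hj => by
    have h : j < R.length := by omega
    exact ⟨h, List.getD_eq_getElem _ _ h⟩
  have hσ : ∀ s ∈ l, ((l.idxOf s : ℕ) : ℤ) ∈ (enum l).map fun s => s.1 := fun s hs =>
    List.mem_map.2 ⟨_, mem_enum_idxOf hs, rfl⟩
  have hσinj : ∀ s ∈ l, ∀ s', ((l.idxOf s : ℕ) : ℤ) = ((l.idxOf s' : ℕ) : ℤ) → s = s' :=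
    fun s hs s' h => (List.idxOf_inj hs).1 (by exact_mod_cast h)
  have hRl : ∀ s ∈ R, s ∈ l := fun s hs => (List.mem_filter.1 hs).1
  unfold boundsTest
  beta_reduce
  rw [hprep, slots_toInput, ← hl, Ne, List.map_eq_nil_iff]
  refine auction_complete (nodup_lefts_fst e).of_map (map_fst_enum_nodup l) f ?_ ?_
  · intro a ha
    rcases hmem a ha with ⟨x, hx, h1, h2⟩ | ⟨j, hj, h1, h2⟩
    · rw [show a = (name x, a.2) from Prod.ext h1 rfl, hf1, h2]
      exact ⟨hσ _ (hφ1 x hx), List.mem_map.2 ⟨_, List.mem_filter.2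
        ⟨mem_enum_idxOf (hφ1 x hx), hφ2 x hx⟩, rfl⟩⟩
    · obtain ⟨hj', hg⟩ := hRget j hj
      rw [show a = (_, a.2) from Prod.ext h1 rfl, hf2, h2, hg]
      have hm := List.getElem_mem hj'
      exact ⟨hσ _ (hRl _ hm), List.mem_map.2 ⟨_, List.mem_filter.2
        ⟨mem_enum_idxOf (hRl _ hm), by simpa using hRdummy _ hm⟩, rfl⟩⟩
  · intro a ha b hb hab
    have himg : ∀ x ∈ I.clients, ∀ s ∈ R, φ x ≠ s := by
      rintro x hx s hs rfl
      exact of_decide_eq_true (List.mem_filter.1 hs).2 (Finset.mem_image_of_mem _ hx)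
    rcases hmem a ha with ⟨x, hx, h1, h2⟩ | ⟨j, hj, h1, h2⟩ <;>
    rcases hmem b hb with ⟨y, hy, k1, k2⟩ | ⟨j', hj', k1, k2⟩ <;>
    rw [show a = (_, a.2) from Prod.ext h1 rfl, show b = (_, b.2) from Prod.ext k1 rfl] at hab
    · rw [hf1, hf1] at hab
      obtain rfl := hφinj x hx y hy (hσinj _ (hφ1 x hx) _ hab)
      exact Prod.ext (h1.trans k1.symm) (h2.trans k2.symm)
    · obtain ⟨hi, hg⟩ := hRget j' hj'
      rw [hf1, hf2, hg] at hab
      exact absurd (hσinj _ (hφ1 x hx) _ hab) (himg x hx _ (List.getElem_mem hi))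
    · obtain ⟨hi, hg⟩ := hRget j hj
      rw [hf1, hf2, hg] at hab
      exact absurd (hσinj _ (hφ1 y hy) _ hab.symm) (himg y hy _ (List.getElem_mem hi))
    · obtain ⟨hi, hg⟩ := hRget j hj
      obtain ⟨hi', hg'⟩ := hRget j' hj'
      rw [hf2, hf2, hg, hg'] at hab
      have := (hRnd.getElem_inj_iff).1 (hσinj _ (hRl _ (List.getElem_mem hi)) _ hab)
      subst this
      exact Prod.ext (h1.trans k1.symm) (h2.trans k2.symm)

/-- There are at least as many left nodes as slots, so a matching of all left nodes fills every
slot. Slots below the lower bound are closed to dummies and hence hold clients, which gives the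
lower bounds. Clients sit below the upper bound at distinct positions, which gives the upper bounds
and the bound `m` on the outliers. -/
theorem boundsTest_sound (e : ε) {ks : List ℤ}
    {prep : Input ε × List ℤ → List ℤ × List (ℤ × ℤ × ℤ × ℤ)}
    (hcol : ∀ x ∈ I.clients, nthD 0 (prep (I.toInput e, ks)).1 (name x) = col x)
    (hprep : (prep (I.toInput e, ks)).2 = D) (hD : I.IsDemand col D) {F : I.Centers} {r : ℝ}
    {o : Data} (ho : o ∈ boundsTest prep (I.toInput e, ks) (I.centersList F) r) :
    ∃ a : Fin I.n → Option (Fin I.k), o = .cons (I.encCenters F) (I.encLabels a) ∧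
      I.ofLabels a ∈ I.bounded col D ∧ ∀ i, ∀ x ∈ I.ofLabels a i, I.within F r x i := by
  classical
  unfold boundsTest at ho
  beta_reduce at ho
  rw [hprep, slots_toInput] at ho
  obtain ⟨M, hM, rfl⟩ := List.mem_map.1 ho
  set l := I.slotList D with hl
  have hnd : l.Nodup := hD.nodup_slotList
  obtain ⟨hM1, hM2, hM3⟩ := auction_sound (map_fst_enum_nodup l) hM
  have hlnd := nodup_lefts_fst (I := I) (D := D) (r := r) e
    (colors := (prep (I.toInput e, ks)).1) (F := I.centersList F)
  rw [← hl] at hlnd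
  set A := lefts (I.toInput e).mat (prep (I.toInput e, ks)).1 (I.centersList F) r
    (I.toInput e).cli (enum l) with hA
  have hMfst : (M.map Prod.fst).Nodup := hM1.nodup_iff.2 hlnd
  have hMsnd : M.map Prod.snd = indices l.length := by
    rw [← map_fst_enum]
    refine hM2.eq_of_length_le ?_
    have h1 := hM1.length_eq
    simp only [List.length_map] at h1 ⊢
    -- The dummies make up for the difference between slots and clients.
    have h2 : l.length ≤ A.length := by
      rw [hA, lefts, foldl_tail]
      simp [enum]; omega
    rw [h1]
    simpa [enum] using h2
  have hMsndnd : (M.map Prod.snd).Nodup := hMsnd ▸ nodup_indices _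
  have hleft : ∀ p ∈ M, (∃ x ∈ I.clients, p.1 = name x ∧ ∃ s, (p.2, s) ∈ enum l ∧
      fits (I.toInput e).mat (prep (I.toInput e, ks)).1 (I.centersList F) r (name x) s = true) ∨
      p.1 < 0 ∧ ∃ s : Slot, (p.2, s) ∈ enum l ∧ s.1.2.2.1 ≤ s.2 := by
    intro p hp
    obtain ⟨a, ha, h1, h2⟩ := hM3 p hp
    rw [hA, lefts, foldl_tail] at ha
    rcases List.mem_append.1 ha with ha | ha
    · obtain ⟨i, hi, rfl⟩ := List.mem_map.1 ha
      obtain ⟨x, hx, rfl⟩ := (I.mem_cli e).1 hi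
      obtain ⟨⟨i, s⟩, hs, h3⟩ := List.mem_map.1 h2
      obtain ⟨hs1, hs2⟩ := List.mem_filter.1 hs
      simp only at h3
      exact .inl ⟨x, hx, h1.symm, s, h3 ▸ hs1, hs2⟩
    · obtain ⟨⟨i, s⟩, hs, rfl⟩ := List.mem_map.1 ha
      obtain ⟨j, rfl, hj⟩ := mem_drop_enum hs
      obtain ⟨⟨i, s⟩, hs, h3⟩ := List.mem_map.1 h2
      obtain ⟨hs1, hs2⟩ := List.mem_filter.1 hs
      simp only at h3 h1
      refine .inr ⟨by omega, s, h3 ▸ hs1, by simpa using hs2⟩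
  have henum : ∀ {i s s'}, (i, s) ∈ enum l → (i, s') ∈ enum l → s = s' := by
    intro i s s' h h'
    obtain ⟨j, hj, g⟩ := mem_enum.1 h
    obtain ⟨j', hj', g'⟩ := mem_enum.1 h'
    obtain rfl : j' = j := by exact_mod_cast hj'.trans hj.symm
    rw [g] at g'
    exact Option.some.inj g'
  have henum' : ∀ {i i' s}, (i, s) ∈ enum l → (i', s) ∈ enum l → i = i' := by
    intro i i' s h h'
    obtain ⟨j, rfl, g⟩ := mem_enum.1 h
    obtain ⟨j', rfl, g'⟩ := mem_enum.1 h'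
    obtain ⟨hj, g⟩ := List.getElem?_eq_some_iff.1 g
    obtain ⟨hj', g'⟩ := List.getElem?_eq_some_iff.1 g'
    rw [(hnd.getElem_inj_iff (hi := hj) (hj := hj')).1 (g.trans g'.symm)]
  have hτ : ∀ x ∈ I.clients, ∃ s : Slot, ∃ i, (name x, i) ∈ M ∧ (i, s) ∈ enum l ∧ s ∈ l ∧
      fits (I.toInput e).mat (prep (I.toInput e, ks)).1 (I.centersList F) r (name x) s = true := by
    intro x hx
    have h1 : name x ∈ A.map Prod.fst := by
      rw [hA, lefts]
      refine List.mem_map.2 ⟨_, List.mem_append.2 (.inl (List.mem_map.2 ⟨name x, ?_, rfl⟩)), rfl⟩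
      exact (I.mem_cli e).2 ⟨x, hx, rfl⟩
    obtain ⟨⟨y, i⟩, hp, rfl⟩ := List.mem_map.1 (hM1.mem_iff.2 h1)
    rcases hleft _ hp with ⟨y, hy, h2, s, hs, h3⟩ | ⟨h2, -⟩
    · obtain rfl := name_injective h2
      obtain ⟨j, -, hj⟩ := mem_enum.1 hs
      exact ⟨s, i, hp, hs, List.mem_of_getElem? hj, h3⟩
    · simp [name] at h2
      omega
  choose! τ ι hτ1 hτ2 hτ3 hτ4 using hτ
  have hτinj : ∀ x ∈ I.clients, ∀ y ∈ I.clients, τ x = τ y → x = y := by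
    intro x hx y hy h
    have h1 : ι x = ι y := henum' (hτ2 x hx) (h ▸ hτ2 y hy)
    have h2 := List.inj_on_of_nodup_map hMsndnd (hτ1 x hx) (hτ1 y hy) h1
    exact name_injective (congrArg Prod.fst h2)
  have hfit : ∀ x ∈ I.clients, (τ x).2 < (τ x).1.2.2.2 ∧ ((τ x).1 = (-1, 0, 0, (I.m : ℤ)) ∨
      (τ x).1 ∈ D ∧ (τ x).1.2.1 = col x ∧
        ∀ i : Fin I.k, name i = (τ x).1.1 → I.within F r x i) := by
    intro x hx
    have h1 := hτ4 x hx
    simp only [fits, Bool.and_eq_true, Bool.or_eq_true, ilt_iff, ieq_iff] at h1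
    refine ⟨h1.1, (mem_slotList.1 (hτ3 x hx)).1.imp_right fun h2 => ?_⟩
    obtain ⟨h3, h4⟩ := h1.2.resolve_left (by have := hD.nonneg h2; omega)
    refine ⟨h2, by rw [← h3, hcol x hx], fun i hi => ?_⟩
    rw [← hi, nthD_of_getElem? (a := name (F i : Fin I.n)) (List.getElem?_eq_some_iff.2
      ⟨by simp [centersList], by simp [centersList]⟩)] at h4
    exact (I.near_toInput e x (F i) r).1 h4
  let a : Fin I.n → Option (Fin I.k) := fun x =>
    if h : x ∈ I.clients ∧ ∃ i : Fin I.k, name i = (τ x).1.1 then some h.2.choose else none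
  have ha : ∀ x i, a x = some i ↔ x ∈ I.clients ∧ name i = (τ x).1.1 := by
    intro x i
    by_cases h : x ∈ I.clients ∧ ∃ i : Fin I.k, name i = (τ x).1.1
    · have := h.2.choose_spec
      simp only [a, dif_pos h, Option.some.injEq]
      exact ⟨fun h' => ⟨h.1, h' ▸ this⟩, fun h' => name_injective (this.trans h'.2.symm)⟩
    · simp only [a, dif_neg h]
      simp only [reduceCtorEq, false_iff]
      exact fun h' => h ⟨h'.1, i, h'.2⟩
  have hmem : ∀ i x, x ∈ I.ofLabels a i ↔ x ∈ I.clients ∧ name i = (τ x).1.1 := by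
    intro i x
    simp [ofLabels, ha]
  refine ⟨a, ?_, ⟨⟨?_, ?_, ?_⟩, ?_⟩, ?_⟩
  · have hc : enc (I.centersList F) = I.encCenters F := by
      simp only [enc, centersList, encCenters, Data.vec, List.map_ofFn, Function.comp_def]
    have hlab : enc ((I.toInput e).pts.map fun x => label (enum l) M x) = I.encLabels a := by
      simp only [enc, pts_toInput, encLabels, Data.vec, List.map_ofFn, Function.comp_def]
      congr 2
      funext x
      unfold label
      beta_reduce
      by_cases hx : x ∈ I.clients
      · rw [assocD_eq_of_mem hMfst (hτ1 x hx)]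
        obtain ⟨j, hj, hj'⟩ := mem_enum.1 (hτ2 x hx)
        have : nthD (-1) ((enum l).map fun s => s.2.1.1) (ι x) = (τ x).1.1 := by
          rw [← hj]
          refine nthD_of_getElem? ?_
          simp [enum, hj']
        rw [this]
        rcases (hfit x hx).2 with h | ⟨h, -⟩
        · have : a x = none := by
            rw [Option.eq_none_iff_forall_ne_some]
            intro i hi
            have := ((ha x i).1 hi).2
            rw [h] at this
            simp [name] at this
          rw [this, h]
          rfl
        · obtain ⟨i, hi⟩ := hD.cluster _ h
          rw [(ha x i).2 ⟨hx, hi⟩, ← hi, show ile 0 (name i) = true by simp [name]]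
          rfl
      -- A point that is not a client is not matched. The default `-1` is no slot number, and the
      -- lookup again gives `-1`, which is read as unassigned.
      · have h1 : name x ∉ M.map Prod.fst := by
          intro h
          obtain ⟨p, hp, h⟩ := List.mem_map.1 h
          rcases hleft p hp with ⟨y, hy, h2, -⟩ | ⟨h2, -⟩
          · exact hx (name_injective (h.symm.trans h2) ▸ hy)
          · rw [h] at h2
            simp [name] at h2
            omega
        have : a x = none := by
          rw [Option.eq_none_iff_forall_ne_some]
          intro i hi
          exact hx ((ha x i).1 hi).1
        rw [assocD_eq_default h1, nthD_neg (by norm_num), this]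
        rfl
    rw [← hc, ← hlab]
    rfl
  · intro i x hx
    exact ((hmem i x).1 hx).1
  · intro i j hij
    rw [Finset.disjoint_left]
    intro x hx hx'
    exact hij (name_injective (((hmem i x).1 hx).2.trans ((hmem j x).1 hx').2.symm))
  · have hout : ∀ x ∈ I.clients \ Finset.univ.biUnion (I.ofLabels a),
        x ∈ I.clients ∧ (τ x).1 = (-1, 0, 0, (I.m : ℤ)) := by
      intro x hx
      simp only [Finset.mem_sdiff, Finset.mem_biUnion, Finset.mem_univ, true_and, not_exists] at hx
      refine ⟨hx.1, (hfit x hx.1).2.resolve_right fun h => ?_⟩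
      obtain ⟨i, hi⟩ := hD.cluster _ h.1
      exact hx.2 i ((hmem i x).2 ⟨hx.1, hi⟩)
    have hcard := Finset.card_le_card_of_injOn (s := I.clients \ Finset.univ.biUnion (I.ofLabels a))
      (t := Finset.range I.m) (fun x => (τ x).2.toNat) (fun x hx => by
        obtain ⟨h1, h2⟩ := hout x hx
        have h3 := (hfit x h1).1
        rw [h2] at h3
        have h4 := (mem_slotList.1 (hτ3 x h1)).2
        simp only [Finset.coe_range, Set.mem_Iio] at h3 ⊢
        omega) (fun x hx y hy hxy => by
        obtain ⟨h1, h2⟩ := hout x hx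
        obtain ⟨k1, k2⟩ := hout y hy
        have h4 := (mem_slotList.1 (hτ3 x h1)).2
        have k4 := (mem_slotList.1 (hτ3 y k1)).2
        simp only at hxy
        exact hτinj x h1 y k1 (Prod.ext (h2.trans k2.symm) (by omega)))
    simpa using hcard
  · intro q hq i hi
    set B := (I.ofLabels a i).filter fun x => col x = q.2.1 with hB
    have hBq : ∀ x ∈ B, x ∈ I.clients ∧ (τ x).1 = q := by
      intro x hx
      obtain ⟨h1, h2⟩ := Finset.mem_filter.1 hx
      obtain ⟨h3, h4⟩ := (hmem i x).1 h1
      rcases (hfit x h3).2 with h | ⟨h, h5, -⟩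
      · rw [h] at h4
        simp [name] at h4
      · exact ⟨h3, hD.eq h hq (h4.symm.trans hi) (h5.trans h2)⟩
    constructor
    -- Only `n + 1` positions exist, hence the minimum. Since `B` has at most `n` elements, the
    -- minimum cannot be `n + 1`, and the full lower bound follows.
    · have hcard := Finset.card_le_card_of_surjOn (s := B)
        (t := Finset.range (min q.2.2.1.toNat (I.n + 1))) (fun x => (τ x).2.toNat) (by
          intro t ht
          simp only [Finset.coe_range, Set.mem_Iio] at ht
          have hs : ((q, (t : ℤ)) : Slot) ∈ l :=
            mem_slotList.2 ⟨.inr hq, by simp, by simp; omega⟩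
          have hs' := mem_enum_idxOf hs
          have : ((l.idxOf ((q, (t : ℤ)) : Slot) : ℕ) : ℤ) ∈ M.map Prod.snd := by
            rw [hMsnd, ← map_fst_enum]
            exact List.mem_map.2 ⟨_, hs', rfl⟩
          obtain ⟨p, hp, hp2⟩ := List.mem_map.1 this
          rw [← hp2] at hs'
          rcases hleft p hp with ⟨x, hx, h1, s, h2, h3⟩ | ⟨-, s, h2, h3⟩
          · have h4 : (p.1, p.2) = (name x, ι x) := by
              refine List.inj_on_of_nodup_map hMfst hp (hτ1 x hx) h1
            have h5 : τ x = (q, (t : ℤ)) := by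
              refine henum (hτ2 x hx) ?_
              rwa [← (Prod.mk.inj h4).2]
            have h6 : (τ x).1 = q := by rw [h5]
            refine ⟨x, ?_, by simp [h5]⟩
            rw [Finset.mem_coe, hB, Finset.mem_filter, hmem]
            refine ⟨⟨hx, by rw [h6, hi]⟩, ?_⟩
            rcases (hfit x hx).2 with h | ⟨-, h, -⟩
            · have := hD.nonneg hq
              rw [h6] at h
              rw [h] at this
              simp at this
            · rw [← h, h6]
          · obtain rfl := henum hs' h2
            simp only at h3
            omega)
      have hn : B.card ≤ I.n := (Finset.card_le_univ _).trans (by simp)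
      rw [Finset.card_range] at hcard
      omega
    · have hcard := Finset.card_le_card_of_injOn (s := B)
        (t := Finset.range q.2.2.2.toNat) (fun x => (τ x).2.toNat) (fun x hx => by
          obtain ⟨h1, h2⟩ := hBq x hx
          have h3 := (hfit x h1).1
          rw [h2] at h3
          have h4 := (mem_slotList.1 (hτ3 x h1)).2
          simp only [Finset.coe_range, Set.mem_Iio]
          omega) (fun x hx y hy hxy => by
          obtain ⟨h1, h2⟩ := hBq x hx
          obtain ⟨k1, k2⟩ := hBq y hy
          have h4 := (mem_slotList.1 (hτ3 x h1)).2
          have k4 := (mem_slotList.1 (hτ3 y k1)).2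
          simp only at hxy
          exact hτinj x h1 y k1 (Prod.ext (h2.trans k2.symm) (by omega)))
      have := hD.upper q hq
      rw [Finset.card_range] at hcard
      omega
  · intro i x hx
    obtain ⟨h1, h2⟩ := (hmem i x).1 hx
    rcases (hfit x h1).2 with h | ⟨-, -, h⟩
    · rw [h] at h2
      simp [name] at h2
    · exact h i h2

end Inst

end OutlierClustering

end

noncomputable section

namespace OutlierClustering

open Enc (enc)

/-! ### The six problems -/

namespace Inst

variable {X : Type u} [MetricSpace X] {I : Inst X}

instance : Nonempty I.Centers := ⟨fun _ => ⟨_, I.locs_nonempty.choose_spec⟩⟩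

instance : Nonempty (Fin I.k) := ⟨⟨0, I.k_pos⟩⟩

/-! ### Costs and radii -/

theorem psi_le {F : I.Centers} {O : I.Clustering} {r : ℝ≥0}
    (h : ∀ i, ∀ x ∈ O i, I.within F r x i) : I.psi F O ≤ r ^ I.z := by
  refine Finset.sup_le fun i _ => (ciInf_le (OrderBot.bddBelow _) i).trans ?_
  refine Finset.sup_le fun x hx => NNReal.rpow_le_rpow ?_ I.z_pos.le
  exact_mod_cast h i x hx

/-- In `psi` every cluster uses its best facility. Several facilities may share a location, so the
facilities can be reindexed such that cluster `i` is served by the `i`-th one. -/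
theorem exists_within_psiStar (O : I.Clustering) : ∃ F : I.Centers, ∀ i, ∀ x ∈ O i,
    I.within F ((I.psiStar O ^ I.z⁻¹ : ℝ≥0) : ℝ) x i := by
  obtain ⟨F, hF⟩ := exists_eq_ciInf_of_finite (f := fun F : I.Centers => I.psi F O)
  have : ∀ i, ∃ j, ∀ x ∈ O i, nndist (I.pt x) (I.pt (F j)) ≤ I.psiStar O ^ I.z⁻¹ := by
    intro i
    obtain ⟨j, hj⟩ := exists_eq_ciInf_of_finite
      (f := fun j : Fin I.k => (O i).sup fun x => I.pcost x (F j))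
    refine ⟨j, fun x hx => (NNReal.le_rpow_inv_iff I.z_pos).2 ?_⟩
    have h1 : I.pcost x (F j) ≤ (O i).sup fun x => I.pcost x (F j) :=
      Finset.le_sup (f := fun x => I.pcost x (F j)) hx
    refine h1.trans (hj.le.trans ?_)
    unfold psiStar
    rw [← hF]
    exact Finset.le_sup (f := fun i => ⨅ j : Fin I.k, (O i).sup fun x => I.pcost x (F j))
      (Finset.mem_univ i)
  choose j hj using this
  exact ⟨fun i => F (j i), fun i x hx => by exact_mod_cast hj i x hx⟩

/-- Passing from radii to `z`-th powers turns a factor `c` between radii into `c ^ z` between costs.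
-/
theorem le_rpow_mul {a b s r c : ℝ≥0} (ha : a ≤ r ^ I.z) (hr : r ≤ c * s) (hs : s = b ^ I.z⁻¹) :
    a ≤ c ^ I.z * b := by
  refine ha.trans ((NNReal.rpow_le_rpow hr I.z_pos.le).trans ?_)
  rw [hs, NNReal.mul_rpow, NNReal.rpow_inv_rpow I.z_pos.ne']

/-- Clustering problems that are given by demands computed in polynomial time. -/
theorem exists_solvesClustering {ε : Type} [Enc ε]
    {prep : Input ε × List ℤ → List ℤ × List (ℤ × ℤ × ℤ × ℤ)} (hp : PolyFun prep) :
    ∃ (p : Code) (c : ℕ), ∀ (X : Type u) [MetricSpace X] (I : Inst X) (e : ε)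
      (col : Fin I.n → ℤ) (D : List (ℤ × ℤ × ℤ × ℤ)) (S : Set I.Clustering),
      esize e ≤ 8 * (I.n + I.k) →
      (∀ x ∈ I.clients, nthD 0 (prep (I.toInput e, indices I.k)).1 (name x) = col x) →
      (prep (I.toInput e, indices I.k)).2 = D → I.IsDemand col D → S = I.bounded col D →
      I.SolvesClustering p c (enc e) S := by
  obtain ⟨p, c, h⟩ := exists_solver_timeBound hp.boundsTest
  refine ⟨p, c, fun X _ I e col D S he hcol hprep hD hS => ?_⟩
  obtain ⟨t, h1, h2⟩ := h X I e he
  refine ⟨_, t, h1, h2, ?_⟩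
  have hspec := I.bestOutcome_spec e (ks := indices I.k) (by simp [indices])
    -- Solvable means that some feasible clustering has every cluster `i` within reach of the center
    -- `i`. A feasible clustering provides such a radius by `exists_within_psiStar`, so the absence
    -- of outcomes forces `S` to be empty.
    (test := boundsTest prep) (Q := fun N => ∃ O ∈ S, ∀ i, ∀ x ∈ O i, N x i)
    (fun N N' hN ⟨O, hO, h⟩ => ⟨O, hO, fun i x hx =>
      hN x ((hS ▸ hO : O ∈ I.bounded col D).1.1 i hx) i (h i x hx)⟩)
    (fun N ⟨O, hO, h⟩ => ⟨_, (hS ▸ hO : O ∈ I.bounded col D).1.2.2, fun x hx hxZ => by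
      simp only [Finset.mem_sdiff, hx, true_and, not_not, Finset.mem_biUnion, Finset.mem_univ] at hxZ
      obtain ⟨i, hi⟩ := hxZ
      exact ⟨i, h i x hi⟩⟩)
    (fun F r ⟨O, hO, h⟩ => boundsTest_complete e hcol hprep hD (hS ▸ hO) h)
  rcases hspec with ⟨h3, h4⟩ | ⟨F, r, hr, h3, h4⟩
  · refine ⟨fun _ => h3, fun ⟨O, hO⟩ => ?_⟩
    obtain ⟨F, hF⟩ := exists_within_psiStar O
    exact absurd ⟨O, hO, hF⟩ (h4 F _ (NNReal.coe_nonneg _))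
  · obtain ⟨a, h5, h6, h7⟩ := boundsTest_sound e hcol hprep hD h3
    rw [← hS] at h6
    lift r to ℝ≥0 using hr
    refine ⟨fun hS => absurd h6 (by simp [hS]), fun _ => ⟨F, a, h5, h6, fun O hO => ?_,
      fun hLC O hO => ?_⟩⟩
    · obtain ⟨F', hF'⟩ := exists_within_psiStar O
      exact le_rpow_mul (psi_le h7)
        (by exact_mod_cast (h4 F' _ (NNReal.coe_nonneg _) ⟨O, hO, hF'⟩).1) rfl
    · obtain ⟨F', hF'⟩ := exists_within_psiStar O
      exact le_rpow_mul (psi_le h7)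
        (by exact_mod_cast (h4 F' _ (NNReal.coe_nonneg _) ⟨O, hO, hF'⟩).2 hLC) rfl

end Inst

open Inst (name name_injective)

/-! ### The constraints as demands -/

theorem enum_ofFn {α : Type} {n : ℕ} (f : Fin n → α) :
    enum (List.ofFn f) = List.ofFn fun i => (name i, f i) := by
  refine List.ext_getElem (by simp [enum]) fun i h1 h2 => ?_
  simp [enum]

theorem indices_eq_ofFn (n : ℕ) : indices n = List.ofFn fun i : Fin n => name i := by
  refine List.ext_getElem (by simp [indices]) fun i h1 h2 => ?_
  simp [indices]

theorem nthD_ofFn {n : ℕ} (d : ℤ) (f : Fin n → ℤ) (i : Fin n) :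
    nthD d (List.ofFn f) (name i) = f i :=
  nthD_of_getElem? (List.getElem?_eq_some_iff.2 ⟨by simp, by simp⟩)

theorem enc_ofFn_int {n : ℕ} (f : Fin n → ℤ) :
    enc (List.ofFn f) = .vec fun i => .int (f i) := by
  simp only [enc, Data.vec, List.map_ofFn, Function.comp_def]

namespace Inst

variable {X : Type u} [MetricSpace X] (I : Inst X)

theorem isDemand_ofFn (lo up : Fin I.k → ℤ) (hup : ∀ i, 0 ≤ up i) :
    I.IsDemand (fun _ => 0) (List.ofFn fun i => (name i, 0, lo i, up i)) where
  nodup := by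
    rw [List.map_ofFn, List.nodup_ofFn]
    intro i j h
    exact name_injective (Prod.mk.inj h).1
  cluster := by
    simp only [List.mem_ofFn, forall_exists_index, forall_apply_eq_imp_iff]
    exact fun i => ⟨i, rfl⟩
  exists_mem := fun i x _ => ⟨_, List.mem_ofFn.2 ⟨i, rfl⟩, rfl, rfl⟩
  upper := by
    simpa only [List.mem_ofFn, forall_exists_index, forall_apply_eq_imp_iff] using hup

theorem mem_bounded_ofFn {lo up : Fin I.k → ℤ} {O : I.Clustering} :
    O ∈ I.bounded (fun _ => 0) (List.ofFn fun i => (name i, 0, lo i, up i)) ↔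
      I.IsOutlierPartition O ∧ ∀ i, lo i ≤ (O i).card ∧ ((O i).card : ℤ) ≤ up i := by
  refine and_congr_right fun _ => ?_
  simp only [List.mem_ofFn, forall_exists_index, forall_apply_eq_imp_iff, Finset.filter_true]
  exact ⟨fun h i => h i i rfl, fun h i j hij => by rw [name_injective hij]; exact h i⟩

theorem card_le_n (s : Finset (Fin I.n)) : s.card ≤ I.n :=
  (Finset.card_le_univ _).trans (by simp)

/-- The same demands on the colors for every cluster. -/
def colorDemands (k : ℕ) (cs : List (ℤ × ℤ × ℤ)) : List (ℤ × ℤ × ℤ × ℤ) :=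
  (indices k).flatMap fun i => cs.map fun p => (i, p)

theorem mem_colorDemands {k : ℕ} {cs : List (ℤ × ℤ × ℤ)} {q : ℤ × ℤ × ℤ × ℤ} :
    q ∈ colorDemands k cs ↔ ∃ i : Fin k, name i = q.1 ∧ q.2 ∈ cs := by
  simp only [colorDemands, indices_eq_ofFn, List.mem_flatMap, List.mem_ofFn, List.mem_map]
  constructor
  · rintro ⟨_, ⟨i, rfl⟩, p, hp, rfl⟩
    exact ⟨i, rfl, hp⟩
  · rintro ⟨i, hi, hq⟩
    exact ⟨_, ⟨i, rfl⟩, _, hq, Prod.ext hi rfl⟩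

theorem isDemand_colorDemands {col : Fin I.n → ℤ} {cs : List (ℤ × ℤ × ℤ)}
    (hcs : (cs.map Prod.fst).Nodup) (hcol : ∀ x ∈ I.clients, col x ∈ cs.map Prod.fst)
    (hup : ∀ p ∈ cs, 0 ≤ p.2.2) : I.IsDemand col (colorDemands I.k cs) where
  nodup := by
    rw [colorDemands, List.map_flatMap]
    refine List.nodup_flatMap.2 ⟨fun i _ => ?_, (nodup_indices _).imp fun {i j} hij => ?_⟩
    · have := hcs.map (f := fun c => (i, c)) fun c c' h => (Prod.mk.inj h).2
      simpa [List.map_map, Function.comp_def] using this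
    · rw [Function.onFun, List.disjoint_left]
      intro q hq hq'
      simp only [List.map_map, List.mem_map, Function.comp_def] at hq hq'
      obtain ⟨p, -, rfl⟩ := hq
      obtain ⟨p', -, h⟩ := hq'
      exact hij (Prod.mk.inj h).1.symm
  cluster := fun q hq => by
    obtain ⟨i, hi, -⟩ := mem_colorDemands.1 hq
    exact ⟨i, hi⟩
  exists_mem := fun i x hx => by
    obtain ⟨p, hp, h⟩ := List.mem_map.1 (hcol x hx)
    exact ⟨(name i, p), mem_colorDemands.2 ⟨i, rfl, hp⟩, rfl, h⟩
  upper := fun q hq => by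
    obtain ⟨i, -, h⟩ := mem_colorDemands.1 hq
    exact hup _ h

theorem mem_bounded_colorDemands {col : Fin I.n → ℤ} {cs : List (ℤ × ℤ × ℤ)} {O : I.Clustering} :
    O ∈ I.bounded col (colorDemands I.k cs) ↔ I.IsOutlierPartition O ∧ ∀ i, ∀ p ∈ cs,
      p.2.1 ≤ ((O i).filter fun x => col x = p.1).card ∧
        (((O i).filter fun x => col x = p.1).card : ℤ) ≤ p.2.2 := by
  refine and_congr_right fun _ => ⟨fun h i p hp => ?_, fun h q hq i hi => ?_⟩
  · exact h (name i, p) (mem_colorDemands.2 ⟨i, rfl, hp⟩) i rfl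
  · obtain ⟨j, -, hq⟩ := mem_colorDemands.1 hq
    exact h i _ hq

end Inst

/-- The elements of a list without repetition. -/
def distinct (l : List ℤ) : List ℤ :=
  l.foldl (fun b c => bif b.any fun d => ieq d c then b else c :: b) []

theorem distinct_spec (l : List ℤ) : (distinct l).Nodup ∧ (distinct l).length ≤ l.length ∧
    ∀ c, c ∈ distinct l ↔ c ∈ l := by
  unfold distinct
  induction l using List.reverseRecOn with
  | nil => simp
  | append_singleton l c ih =>
    rw [List.foldl_append, List.foldl_cons, List.foldl_nil]
    obtain ⟨h1, h2, h3⟩ := ih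
    set b := l.foldl (fun b c => bif b.any fun d => ieq d c then b else c :: b) []
    cases hb : b.any fun d => ieq d c with
    | true =>
      simp only [List.any_eq_true, ieq_iff, exists_eq_right] at hb
      refine ⟨h1, by simp; omega, fun d => ?_⟩
      have := (h3 c).1 hb
      simp only [cond_true, h3, List.mem_append, List.mem_singleton]
      refine ⟨.inl, fun h => h.elim id fun h => h ▸ this⟩
    | false =>
      have hc : c ∉ b := fun h => by
        have : (b.any fun d => ieq d c) = true := by
          simp only [List.any_eq_true, ieq_iff, exists_eq_right]; exact h
        rw [hb] at this; simp at this
      refine ⟨List.nodup_cons.2 ⟨hc, h1⟩, by simpa using h2, fun d => ?_⟩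
      simp [h3, or_comm]

@[fun_prop] theorem polyFun_distinct : PolyFun distinct := by
  refine .foldl (by fun_prop) (by fun_prop) (by fun_prop) ⟨.X, fun l l' h => ?_⟩
  have h1 := (distinct_spec l').2.1
  have h2 := h.length_le
  unfold distinct at h1
  simp
  omega

/-- The empty list of colors gives every client the default color 0, so each cluster has a single
demand. The upper bound `n + 1` never binds. -/
theorem exists_gather : ∃ (p : Code) (c : ℕ), ∀ (X : Type u) [MetricSpace X] (I : Inst X)
    (r : Fin I.k → ℕ), I.SolvesClustering p c (.vec fun i => .int (r i)) (I.gather r) := by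
  obtain ⟨p, c, h⟩ := Inst.exists_solvesClustering
    (prep := fun a : Input (List ℤ) × List ℤ =>
      ([], (enum a.1.dat).map fun p => (p.1, 0, p.2, a.1.nn + 1))) (by fun_prop)
  refine ⟨p, c, fun X _ I r => ?_⟩
  have h1 := h X I (List.ofFn fun i => (r i : ℤ)) (fun _ => 0) _ (I.gather r)
    (by simp; have := I.k_pos; omega) (fun x _ => assocD_eq_default (by simp [enum]))
    (show _ = List.ofFn fun i => (name i, 0, (r i : ℤ), (I.n : ℤ) + 1) by
      simp only [Inst.toInput, Input.dat, Input.nn, enum_ofFn, List.map_ofFn, Function.comp_def])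
    (I.isDemand_ofFn _ _ fun i => by omega) (by
      ext O
      rw [Inst.mem_bounded_ofFn]
      refine and_congr_right fun _ => forall_congr' fun i => ?_
      have := I.card_le_n (O i)
      omega)
  rwa [enc_ofFn_int] at h1

theorem exists_capacity : ∃ (p : Code) (c : ℕ), ∀ (X : Type u) [MetricSpace X] (I : Inst X)
    (r : Fin I.k → ℕ), I.SolvesClustering p c (.vec fun i => .int (r i)) (I.capacity r) := by
  obtain ⟨p, c, h⟩ := Inst.exists_solvesClustering
    (prep := fun a : Input (List ℤ) × List ℤ =>
      ([], (enum a.1.dat).map fun p => (p.1, 0, 0, p.2))) (by fun_prop)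
  refine ⟨p, c, fun X _ I r => ?_⟩
  have h1 := h X I (List.ofFn fun i => (r i : ℤ)) (fun _ => 0) _ (I.capacity r)
    (by simp; have := I.k_pos; omega) (fun x _ => assocD_eq_default (by simp [enum]))
    (show _ = List.ofFn fun i => (name i, 0, 0, (r i : ℤ)) by
      simp only [Inst.toInput, Input.dat, enum_ofFn, List.map_ofFn, Function.comp_def])
    (I.isDemand_ofFn _ _ fun i => by omega) (by
      ext O
      rw [Inst.mem_bounded_ofFn]
      refine and_congr_right fun _ => forall_congr' fun i => ?_
      omega)
  rwa [enc_ofFn_int] at h1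

theorem exists_balanced : ∃ (p : Code) (c : ℕ), ∀ (X : Type u) [MetricSpace X] (I : Inst X)
    (l r : Fin I.k → ℕ), I.SolvesClustering p c
      (.cons (.vec fun i => .int (l i)) (.vec fun i => .int (r i))) (I.balanced l r) := by
  obtain ⟨p, c, h⟩ := Inst.exists_solvesClustering
    (prep := fun a : Input (List ℤ × List ℤ) × List ℤ =>
      ([], (enum a.1.dat.1).map fun p => (p.1, 0, p.2, nthD 0 a.1.dat.2 p.1))) (by fun_prop)
  refine ⟨p, c, fun X _ I l r => ?_⟩
  have h1 := h X I (List.ofFn fun i => (l i : ℤ), List.ofFn fun i => (r i : ℤ)) (fun _ => 0) _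
    (I.balanced l r)
    (by simp; have := I.k_pos; omega) (fun x _ => assocD_eq_default (by simp [enum]))
    (show _ = List.ofFn fun i => (name i, 0, (l i : ℤ), (r i : ℤ)) by
      simp only [Inst.toInput, Input.dat, enum_ofFn, List.map_ofFn, Function.comp_def, nthD_ofFn])
    (I.isDemand_ofFn _ _ fun i => by omega) (by
      ext O
      rw [Inst.mem_bounded_ofFn]
      refine and_congr_right fun _ => forall_congr' fun i => ?_
      omega)
  rw [← enc_ofFn_int, ← enc_ofFn_int]
  exact h1

/-- Each pair of a cluster and an occurring color gets the bounds 0 and 1. Repetitions of colors are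
removed because demands must be unique. -/
theorem exists_chromatic : ∃ (p : Code) (c : ℕ), ∀ (X : Type u) [MetricSpace X] (I : Inst X)
    (color : Fin I.n → ℕ),
      I.SolvesClustering p c (.vec fun x => .int (color x)) (I.chromatic color) := by
  obtain ⟨p, c, h⟩ := Inst.exists_solvesClustering
    (prep := fun a : Input (List ℤ) × List ℤ =>
      (a.1.dat, a.2.flatMap fun i => ((distinct a.1.dat).map fun c => (c, 0, 1)).map fun p =>
        (i, p))) (by fun_prop)
  refine ⟨p, c, fun X _ I color => ?_⟩
  obtain ⟨d1, -, d2⟩ := distinct_spec (List.ofFn fun x => (color x : ℤ))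
  have h1 := h X I (List.ofFn fun i => (color i : ℤ)) (fun x => color x) (Inst.colorDemands I.k
    ((distinct (List.ofFn fun x => (color x : ℤ))).map fun c => (c, 0, 1))) (I.chromatic color)
    (by simp; have := I.k_pos; omega)
    (fun x _ => by simp only [Inst.toInput, Input.dat]; rw [nthD_ofFn])
    (by simp only [Inst.toInput, Input.dat, Inst.colorDemands])
    (I.isDemand_colorDemands (by simpa [List.map_map, Function.comp_def] using d1)
      (fun x _ => by
        rw [List.map_map]
        exact List.mem_map.2 ⟨color x, (d2 _).2 (List.mem_ofFn.2 ⟨x, rfl⟩), rfl⟩)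
      (by simp)) (by
      ext O
      rw [Inst.mem_bounded_colorDemands]
      refine and_congr_right fun _ => forall_congr' fun i => ?_
      simp only [List.mem_map, forall_exists_index, and_imp, d2,
        List.mem_ofFn, forall_apply_eq_imp_iff, Nat.cast_inj]
      constructor
      · intro h x
        refine ⟨by simp, ?_⟩
        norm_cast
        refine Finset.card_le_one.2 fun y hy z hz => ?_
        rw [Finset.mem_filter] at hy hz
        exact h y hy.1 z hz.1 (hy.2.trans hz.2.symm)
      · intro h x hx y hy hxy
        have := (h x).2
        norm_cast at this
        exact Finset.card_le_one.1 this x (by simp [hx]) y (by simp [hy, hxy]))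
  rwa [enc_ofFn_int] at h1

theorem exists_stronglyPrivate : ∃ (p : Code) (c : ℕ), ∀ (X : Type u) [MetricSpace X]
    (I : Inst X) (ω : ℕ) (color : Fin I.n → ℕ) (l : Fin ω → ℤ), I.IsColoring ω color →
      I.SolvesClustering p c (.cons (.vec fun x => .int (color x)) (.vec fun j => .int (l j)))
        (I.stronglyPrivate color l) := by
  obtain ⟨p, c, h⟩ := Inst.exists_solvesClustering
    (prep := fun a : Input (List ℤ × List ℤ) × List ℤ =>
      (a.1.dat.1, a.2.flatMap fun i => ((enum a.1.dat.2).map fun p =>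
        (p.1, p.2, a.1.nn + 1)).map fun p => (i, p))) (by fun_prop)
  refine ⟨p, c, fun X _ I ω color l hcol => ?_⟩
  -- The classes are nonempty and disjoint. This is what bounds the size of the constraint data.
  have hω : ω ≤ I.n := by
    choose x hx hxc using hcol.2
    have := Fintype.card_le_of_injective (fun j : Fin ω => x j j.2) fun j j' h => by
      rw [Fin.ext_iff, ← hxc j j.2, ← hxc j' j'.2]
      exact congrArg color h
    simpa using this
  have h1 := h X I (List.ofFn fun i => (color i : ℤ), List.ofFn l) (fun x => color x)
    (Inst.colorDemands I.k (List.ofFn fun j : Fin ω => (name j, l j, (I.n : ℤ) + 1)))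
    (I.stronglyPrivate color l)
    (by simp; have := I.k_pos; omega)
    (fun x _ => by simp only [Inst.toInput, Input.dat]; rw [nthD_ofFn])
    (by simp only [Inst.toInput, Input.dat, Input.nn, Inst.colorDemands, enum_ofFn, List.map_ofFn,
      Function.comp_def])
    (I.isDemand_colorDemands (by
        rw [List.map_ofFn, List.nodup_ofFn]
        exact fun i j h => name_injective h)
      (fun x hx => by
        rw [List.map_ofFn]
        exact List.mem_ofFn.2 ⟨⟨color x, hcol.1 x hx⟩, rfl⟩)
      (by simp only [List.mem_ofFn, forall_exists_index, forall_apply_eq_imp_iff]; intro; omega)) (by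
      ext O
      rw [Inst.mem_bounded_colorDemands]
      refine and_congr_right fun _ => forall_congr' fun i => ?_
      simp only [List.mem_ofFn, forall_exists_index, forall_apply_eq_imp_iff, name, Nat.cast_inj]
      refine forall_congr' fun j => ?_
      have := I.card_le_n ((O i).filter fun x => color x = (j : ℕ))
      constructor <;> intro h <;> omega)
  rw [← enc_ofFn_int, ← enc_ofFn_int]
  exact h1

/-! ### The fault-tolerant problem -/

theorem length_filter_ofFn {k : ℕ} (f : Fin k → ℤ) (p : ℤ → Bool) :
    ((List.ofFn f).filter p).length = (Finset.univ.filter fun j => p (f j)).card := by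
  rw [List.ofFn_eq_map, List.filter_map, List.length_map,
    ← List.toFinset_card_of_nodup ((List.nodup_finRange k).filter _), List.toFinset_filter,
    List.toFinset_finRange]
  rfl

namespace Inst

variable {X : Type u} [MetricSpace X] {I : Inst X}

-- The infimum that defines `kthDist` is attained: its set of radii is a finite union of
-- intersections of closed half-lines, and it contains the largest distance to a center because `l ≤
-- k`.
open Classical in
theorem le_card_within_of_kthDist_le {F : I.Centers} {l : ℕ} (hl : l ≤ I.k) {x : Fin I.n} {r : ℝ≥0}
    (h : I.kthDist F l x ≤ r) : l ≤ (Finset.univ.filter fun j => I.within F r x j).card := by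
  set S := {ρ : ℝ≥0 |
    l ≤ (Finset.univ.filter fun j : Fin I.k => nndist (I.pt x) (I.pt (F j)) ≤ ρ).card} with hS
  have hclosed : IsClosed S := by
    have : S = ⋃ J ∈ (Finset.univ.filter fun J : Finset (Fin I.k) => l ≤ J.card),
        ⋂ j ∈ J, {ρ : ℝ≥0 | nndist (I.pt x) (I.pt (F j)) ≤ ρ} := by
      ext ρ
      simp only [hS, Set.mem_ofPred_eq, Set.mem_iUnion, Finset.mem_filter, Finset.mem_univ, true_and,
        Set.mem_iInter, exists_prop]
      refine ⟨fun h => ⟨_, h, fun j hj => (Finset.mem_filter.1 hj).2⟩, ?_⟩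
      rintro ⟨J, hJ, h⟩
      exact hJ.trans (Finset.card_le_card fun j hj => Finset.mem_filter.2 ⟨Finset.mem_univ _, h j hj⟩)
    rw [this]
    exact isClosed_biUnion_finset fun J _ => isClosed_biInter fun j _ =>
      isClosed_le continuous_const continuous_id
  have hne : S.Nonempty := by
    refine ⟨Finset.univ.sup fun j => nndist (I.pt x) (I.pt (F j)), ?_⟩
    rw [hS, Set.mem_ofPred_eq, Finset.filter_true_of_mem fun j hj =>
      Finset.le_sup (f := fun j => nndist (I.pt x) (I.pt (F j))) hj]
    simpa using hl
  have hmem : I.kthDist F l x ∈ S := hclosed.csInf_mem hne (OrderBot.bddBelow _)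
  refine le_trans hmem (Finset.card_le_card fun j hj => ?_)
  rw [Finset.mem_filter] at hj ⊢
  exact ⟨hj.1, by exact_mod_cast hj.2.trans h⟩

open Classical in
theorem ftCost_le {l : Fin I.n → ℕ} {F : I.Centers} {Z : Finset (Fin I.n)} {r : ℝ≥0}
    (h : ∀ x ∈ I.clients, x ∉ Z → l x ≤ (Finset.univ.filter fun j => I.within F r x j).card) :
    I.ftCost l F Z ≤ r ^ I.z := by
  refine Finset.sup_le fun x hx => NNReal.rpow_le_rpow ?_ I.z_pos.le
  rw [Finset.mem_sdiff] at hx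
  refine csInf_le (OrderBot.bddBelow _) ((h x hx.1 hx.2).trans (Finset.card_le_card fun j hj => ?_))
  rw [Finset.mem_filter] at hj ⊢
  exact ⟨hj.1, by exact_mod_cast hj.2⟩

theorem kthDist_le {l : Fin I.n → ℕ} {F : I.Centers} {Z : Finset (Fin I.n)} {x : Fin I.n}
    (hx : x ∈ I.clients) (hxZ : x ∉ Z) : I.kthDist F (l x) x ≤ I.ftCost l F Z ^ I.z⁻¹ :=
  (NNReal.le_rpow_inv_iff I.z_pos).2
    (Finset.le_sup (f := fun x => I.kthDist F (l x) x ^ I.z) (Finset.mem_sdiff.2 ⟨hx, hxZ⟩))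

open Classical in
/-- The clients with too few centers within the radius `r`. -/
def deficient (I : Inst X) (l : Fin I.n → ℕ) (F : I.Centers) (r : ℝ) : Finset (Fin I.n) :=
  I.clients.filter fun x => (Finset.univ.filter fun j => I.within F r x j).card < l x

-- For fixed centers and radius the deficient clients must all be outliers, and making exactly them
-- outliers suffices. So the test compares their number with `m`.
open Classical in
theorem ftTest_eq (l : Fin I.n → ℕ) (ks : List ℤ) (F : I.Centers) (r : ℝ) :
    ftTest (I.toInput (List.ofFn fun x => (l x : ℤ)), ks) (I.centersList F) r =
      if (I.deficient l F r).card ≤ I.m then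
        [.cons (I.encCenters F) (.vec fun x => .ofProp (x ∈ I.deficient l F r))] else [] := by
  have hcount : ∀ x : Fin I.n, ((I.centersList F).filter fun f =>
      near (I.toInput (List.ofFn fun x => (l x : ℤ))).mat (name x) f r).length =
      (Finset.univ.filter fun j => I.within F r x j).card := by
    intro x
    rw [centersList, length_filter_ofFn]
    congr 1
    exact Finset.filter_congr fun j _ => I.near_toInput _ x _ r
  have hdat : ∀ x : Fin I.n, nthD 0 (I.toInput (List.ofFn fun x => (l x : ℤ))).dat (name x) = l x :=
    fun x => nthD_ofFn _ _ _
  have hp : ∀ x : Fin I.n, ilt (len ((I.centersList F).filter fun f =>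
      near (I.toInput (List.ofFn fun x => (l x : ℤ))).mat (name x) f r))
      (nthD 0 (I.toInput (List.ofFn fun x => (l x : ℤ))).dat (name x)) = true ↔
      (Finset.univ.filter fun j => I.within F r x j).card < l x := by
    intro x
    rw [ilt_iff, len_eq, hcount, hdat, Nat.cast_lt]
  unfold ftTest
  beta_reduce
  set Z := (I.toInput (List.ofFn fun x => (l x : ℤ))).cli.filter fun x =>
    ilt (len ((I.centersList F).filter fun f =>
      near (I.toInput (List.ofFn fun x => (l x : ℤ))).mat x f r))
      (nthD 0 (I.toInput (List.ofFn fun x => (l x : ℤ))).dat x)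
  have hZ : Z.length = (I.deficient l F r).card := by
    rw [length_filter_cli]
    exact congrArg _ (Finset.filter_congr fun x _ => hp x)
  have hmem : ∀ x : Fin I.n, (Z.any fun y => ieq y (name x)) = true ↔ x ∈ I.deficient l F r := by
    intro x
    simp only [List.any_eq_true, ieq_iff, exists_eq_right, Z, List.mem_filter, hp, mem_cli,
      deficient, Finset.mem_filter]
    refine and_congr_left fun _ => ⟨?_, fun h => ⟨x, h, rfl⟩⟩
    rintro ⟨y, hy, h⟩
    exact name_injective h ▸ hy
  have hc : enc (I.centersList F) = I.encCenters F := by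
    simp only [enc, centersList, encCenters, Data.vec, List.map_ofFn, Function.comp_def]
  have hflags : enc ((I.toInput (List.ofFn fun x => (l x : ℤ))).pts.map fun x =>
      Z.any fun y => ieq y x) = .vec fun x => .ofProp (x ∈ I.deficient l F r) := by
    simp only [pts_toInput, enc, Data.vec, List.map_ofFn, Function.comp_def]
    congr 2
    funext x
    simp only [Data.ofProp, hmem]
  by_cases h : (I.deficient l F r).card ≤ I.m
  · have : ile (len Z) (I.toInput (List.ofFn fun x => (l x : ℤ))).mm = true := by
      rw [ile_iff, len_eq, hZ]
      exact (Nat.cast_le (α := ℤ)).2 h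
    rw [this, cond_true, if_pos h, ← hc, ← hflags]
    rfl
  · have : ile (len Z) (I.toInput (List.ofFn fun x => (l x : ℤ))).mm = false := by
      rw [Bool.eq_false_iff, Ne, ile_iff, len_eq, hZ]
      exact fun h' => h ((Nat.cast_le (α := ℤ)).1 h')
    rw [this, cond_false, if_neg h]

end Inst

theorem exists_faultTolerant : ∃ (p : Code) (c : ℕ), ∀ (X : Type u) [MetricSpace X] (I : Inst X)
    (l : Fin I.n → ℕ), (∀ x ∈ I.clients, 1 ≤ l x ∧ l x ≤ I.k) → I.SolvesFaultTolerant p c l := by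
  classical
  obtain ⟨p, c, h⟩ := Inst.exists_solver_timeBound polyFun_ftTest
  refine ⟨p, c, fun X _ I l hl => ?_⟩
  obtain ⟨t, h1, h2⟩ := h X I (List.ofFn fun x => (l x : ℤ)) (by
    simp; have := I.k_pos; omega)
  rw [enc_ofFn_int] at h1
  refine ⟨_, t, h1, h2, ?_⟩
  have hQ : ∀ (F' : I.Centers) (Z' : Finset (Fin I.n)), Z' ⊆ I.clients → Z'.card ≤ I.m →
      ∃ Z : Finset (Fin I.n), Z.card ≤ I.m ∧ ∀ x ∈ I.clients, x ∉ Z →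
        l x ≤ (Finset.univ.filter fun j =>
          I.within F' ((I.ftCost l F' Z' ^ I.z⁻¹ : ℝ≥0) : ℝ) x j).card :=
    fun F' Z' _ hZ' => ⟨Z', hZ', fun x hx hxZ =>
      Inst.le_card_within_of_kthDist_le (hl x hx).2 (Inst.kthDist_le hx hxZ)⟩
  have hspec := I.bestOutcome_spec (List.ofFn fun x => (l x : ℤ)) (ks := indices I.k)
    (by simp [indices]) (test := ftTest)
    (Q := fun N => ∃ Z : Finset (Fin I.n), Z.card ≤ I.m ∧ ∀ x ∈ I.clients, x ∉ Z →
      l x ≤ (Finset.univ.filter fun j => N x j).card)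
    (fun N N' hN ⟨Z, hZ, h⟩ => ⟨Z, hZ, fun x hx hxZ => (h x hx hxZ).trans
      (Finset.card_le_card fun j hj => by
        rw [Finset.mem_filter] at hj ⊢
        exact ⟨hj.1, hN x hx j hj.2⟩)⟩)
    -- The requirement `1 ≤ l x` ensures that every client outside `Z` has some center nearby, as
    -- the greedy cover needs.
    (fun N ⟨Z, hZ, h⟩ => ⟨Z, hZ, fun x hx hxZ => by
      have := (hl x hx).1.trans (h x hx hxZ)
      obtain ⟨j, hj⟩ := Finset.card_pos.1 this
      exact ⟨j, (Finset.mem_filter.1 hj).2⟩⟩)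
    (fun F r ⟨Z, hZ, h⟩ => by
      rw [Inst.ftTest_eq, if_pos]
      · simp
      · refine (Finset.card_le_card fun x hx => ?_).trans hZ
        obtain ⟨hx1, hx2⟩ := Finset.mem_filter.1 hx
        by_contra hxZ
        exact absurd (h x hx1 hxZ) (by omega))
  rcases hspec with ⟨-, h4⟩ | ⟨F, r, hr, h3, h4⟩
  -- Some outcome exists: arbitrary centers without outliers are a solution at the radius given by
  -- their own cost.
  · exact absurd (hQ (Classical.arbitrary _) ∅ (by simp) (by simp))
      (h4 (Classical.arbitrary _) _ (NNReal.coe_nonneg _))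
  · rw [Inst.ftTest_eq] at h3
    split_ifs at h3 with hm
    · rw [List.mem_singleton] at h3
      lift r to ℝ≥0 using hr
      have hcost : I.ftCost l F (I.deficient l F r) ≤ r ^ I.z := by
        refine Inst.ftCost_le fun x hx hxZ => ?_
        by_contra hlt
        exact hxZ (Finset.mem_filter.2 ⟨hx, by omega⟩)
      refine ⟨F, I.deficient l F r, ?_, Finset.filter_subset _ _, hm, fun F' Z' h5 h6 => ?_,
        fun hLC F' Z' h5 h6 => ?_⟩
      · rw [h3]
      · exact Inst.le_rpow_mul hcost
          (by exact_mod_cast (h4 F' _ (NNReal.coe_nonneg _) (hQ F' Z' h5 h6)).1) rfl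
      · exact Inst.le_rpow_mul hcost
          (by exact_mod_cast (h4 F' _ (NNReal.coe_nonneg _) (hQ F' Z' h5 h6)).2 hLC) rfl
    · simp at h3

end OutlierClustering

end

theorem mainTheorem6 :
    -- r-gather
    (∃ (p : OutlierClustering.Code) (c : ℕ),
      ∀ (X : Type u) [MetricSpace X] (I : OutlierClustering.Inst X) (r : Fin I.k → ℕ),
        I.SolvesClustering p c (.vec fun i => .int (r i)) (I.gather r)) ∧
    -- r-capacity
    (∃ (p : OutlierClustering.Code) (c : ℕ),
      ∀ (X : Type u) [MetricSpace X] (I : OutlierClustering.Inst X) (r : Fin I.k → ℕ),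
        I.SolvesClustering p c (.vec fun i => .int (r i)) (I.capacity r)) ∧
    -- balanced
    (∃ (p : OutlierClustering.Code) (c : ℕ),
      ∀ (X : Type u) [MetricSpace X] (I : OutlierClustering.Inst X) (l r : Fin I.k → ℕ),
        I.SolvesClustering p c (.cons (.vec fun i => .int (l i)) (.vec fun i => .int (r i)))
          (I.balanced l r)) ∧
    -- chromatic
    (∃ (p : OutlierClustering.Code) (c : ℕ),
      ∀ (X : Type u) [MetricSpace X] (I : OutlierClustering.Inst X) (color : Fin I.n → ℕ),
        I.SolvesClustering p c (.vec fun x => .int (color x)) (I.chromatic color)) ∧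
    -- fault-tolerant
    (∃ (p : OutlierClustering.Code) (c : ℕ),
      ∀ (X : Type u) [MetricSpace X] (I : OutlierClustering.Inst X) (l : Fin I.n → ℕ),
        (∀ x ∈ I.clients, 1 ≤ l x ∧ l x ≤ I.k) →
          I.SolvesFaultTolerant p c l) ∧
    -- strongly private
    (∃ (p : OutlierClustering.Code) (c : ℕ),
      ∀ (X : Type u) [MetricSpace X] (I : OutlierClustering.Inst X)
        (ω : ℕ) (color : Fin I.n → ℕ) (l : Fin ω → ℤ),
        I.IsColoring ω color →
          I.SolvesClustering p c
            (.cons (.vec fun x => .int (color x)) (.vec fun j => .int (l j)))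
            (I.stronglyPrivate color l)) :=
  ⟨OutlierClustering.exists_gather, OutlierClustering.exists_capacity,
    OutlierClustering.exists_balanced, OutlierClustering.exists_chromatic,
    OutlierClustering.exists_faultTolerant, OutlierClustering.exists_stronglyPrivate⟩
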